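/- **Generalised homogeneity relation for the prepotential.** Let $n\ge 1$ and let $W(x)=g_0+\sum_{k=1}^{n+1}\frac{g_k}{k}x^k$ with $g_k\in\mathbb C$, $g_{n+1}=1$. Consider a hyperelliptic curve $$y^2=W'(x)^2+f_0(x)=\prod_{i=1}^n(x-a_i^-)(x-a_i^+),$$ where $f_0$ is a polynomial of degree exactly $n-1$ with leading coefficient $-4t$ (so $t\neq0$) and the $2n$ branch points are distinct. Let $\lambda:\mathbb R\to\mathbb C$ be a smooth injective path with $\dot\lambda\ne 0$ carrying disjoint cuts $\mathcal C_i=\lambda([s_i^-,s_i^+])$, $\lambda(s_i^\pm)=a_i^\pm$, numbered in the order in which they occur along the path. Let $y_0$ be the branch of $y$, holomorphic on $\mathbb C\setminus\bigcup_i\mathcal C_i$, with $y_0\sim W'$ at infinity, let $\omega_0=(W'-y_0)/(2t)$, and put $$\rho_0(s)=\dot\lambda(s)\lim_{\epsilon\to0^+}\frac1{2\pi i}\big[\omega_0(\lambda(s)-i\epsilon\dot\lambda(s))-\omega_0(\lambda(s)+i\epsilon\dot\lambda(s))\big],$$ $$S_i=t\int_{\lambda^{-1}(\mathcal C_i)}\rho_0(s)\,ds,\qquad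 \tilde S_i=\sum_{j\le i}S_j\quad(1\le i\le n-1),$$ $$\mathcal F_0=t^2\,\mathcal P\!\!\int ds\int ds'\,\ln(\lambda(s)-\lambda(s'))\,\rho_0(s)\rho_0(s')-t\int ds\,W(\lambda(s))\,\rho_0(s).$$ Here $\mathcal P\ln(\lambda(s)-\lambda(s'))=\ln|s-s'|+\ell(s,s')$, where $\ell$ is a continuous function on $\mathbb R^2$ with $e^{\ell(s,s')}=\frac{\lambda(s)-\lambda(s')}{s-s'}$ for $s\neq s'$ (the mean of the two continuations of the logarithm past $s=s'$ on either side of the path). Let $U\subset\mathbb C\times\mathbb C^{n-1}$ be open, fix $W$, and suppose that for every $(t,\tilde S)\in U$ such a curve with cuts, path and $\ell$ is given whose parameters are $t$ and $\tilde S_1,\dots,\tilde S_{n-1}$, with $\lambda(s)$ smooth (over $\mathbb R$) jointly in $s$ and $(t,\tilde S)$, $s_i^\pm$ smooth in $(t,\tilde S)$, and $\ell$ jointly continuous in $(t,\tilde S)$ and $(s,s')$. Then, on $U$, the limit defining $\rho_0$ exists for all $s$; the functions $\rho_0$, $\mathcal P\ln(\lambda(s)-\lambda(s'))\,\rho_0(s)\rho_0(s')$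 and $W(\lambda(s))\rho_0(s)$ are integrable; $\mathcal F_0$ is a holomorphic function of $(t,\tilde S)$; and $$\sum_{i=1}^{n-1}\tilde S_i\frac{\partial\mathcal F_0}{\partial\tilde S_i}(t,\tilde S)+t\frac{\partial\mathcal F_0}{\partial t}(t,\tilde S)=2\mathcal F_0(t,\tilde S)+t\int ds\,\rho_0(s;t,\tilde S)\,W(\lambda(s)).$$ -/

import Mathlib

open Polynomial Filter Topology
open scoped ContDiff

/-- A hyperelliptic curve `y² = W'(x)² + f(x)` of genus `m` (so there are `n = m + 1` cuts), together
with a choice of cuts lying on a path, of the branch `y₀` on the cut plane, and of the logarithm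
along the path.

The path `lam : ℝ → ℂ` is smooth, regular and without self-intersections; any regular parameter is
allowed, in particular the length.  The `i`-th cut is the arc `lam '' [left i, right i]` from the
branch point `a_i⁻ = lam (left i)` to the branch point `a_i⁺ = lam (right i)`; the cuts are numbered
in the order in which they are met along the path. -/
structure SpectralCurve (m : ℕ) (W : ℂ[X]) where
  /-- the deformation polynomial, of degree `n - 1 = m` -/
  f : ℂ[X]
  degree_f : f.degree = m
  /-- the path carrying the cuts -/
  lam : ℝ → ℂ
  contDiff_lam : ContDiff ℝ ∞ lam
  deriv_lam_ne_zero : ∀ s, deriv lam s ≠ 0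
  injective_lam : Function.Injective lam
  /-- parameter of the starting point of the `i`-th cut -/
  left : Fin (m + 1) → ℝ
  /-- parameter of the end point of the `i`-th cut -/
  right : Fin (m + 1) → ℝ
  left_lt_right : ∀ i, left i < right i
  right_lt_left : ∀ i j, i < j → right i < left j
  /-- the end points of the cuts are the `2n` branch points of the curve -/
  branch_points : derivative W ^ 2 + f =
    ∏ i, (X - C (lam (left i))) * (X - C (lam (right i)))
  /-- the branch of `y` on the upper sheet, i.e. the one with `y₀ ∼ W'` at infinity;
  its values on the cuts themselves are irrelevant -/
  y₀ : ℂ → ℂ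
  differentiableOn_y₀ :
    DifferentiableOn ℂ y₀ (⋃ i, lam '' Set.Icc (left i) (right i))ᶜ
  sq_y₀ : ∀ x ∈ (⋃ i, lam '' Set.Icc (left i) (right i))ᶜ,
    y₀ x ^ 2 = (derivative W ^ 2 + f).eval x
  y₀_asymptotic :
    Tendsto (fun x => y₀ x / (derivative W).eval x) (Bornology.cobounded ℂ) (𝓝 1)
  /-- a continuous logarithm of the (nowhere vanishing) difference quotient
  `(lam s - lam s') / (s - s')` of the path -/
  logQuot : ℝ → ℝ → ℂ
  continuous_logQuot : Continuous (Function.uncurry logQuot)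
  exp_logQuot : ∀ s s', Complex.exp (logQuot s s') * ((s : ℂ) - (s' : ℂ)) = lam s - lam s'

namespace SpectralCurve

variable {m : ℕ} {W : ℂ[X]}

/-- The coupling `t`: `-1/4` times the leading coefficient of `f`. -/
noncomputable def t (Γ : SpectralCurve m W) : ℂ := -Γ.f.leadingCoeff / 4

/-- The resolvent `ω₀`, defined by `y₀ = W' - 2 t ω₀`. -/
noncomputable def resolvent (Γ : SpectralCurve m W) (x : ℂ) : ℂ :=
  ((derivative W).eval x - Γ.y₀ x) / (2 * Γ.t)

/-- The quantity `λ'(s) / (2πi) * (ω₀(λ(s) - iελ'(s)) - ω₀(λ(s) + iελ'(s)))`. -/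
noncomputable def discontinuity (Γ : SpectralCurve m W) (s ε : ℝ) : ℂ :=
  deriv Γ.lam s * (1 / (2 * (Real.pi : ℂ) * Complex.I)) *
    (Γ.resolvent (Γ.lam s - Complex.I * ε * deriv Γ.lam s) -
      Γ.resolvent (Γ.lam s + Complex.I * ε * deriv Γ.lam s))

/-- The (complex) spectral density `ρ₀(s)`: the discontinuity of the resolvent across the path. -/
noncomputable def density (Γ : SpectralCurve m W) (s : ℝ) : ℂ :=
  limUnder (𝓝[>] (0 : ℝ)) (Γ.discontinuity s)

/-- The principal value of `ln (λ(s) - λ(s'))`.  Continuing `ln (λ(s) - λ(s'))` from `s > s'` to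
`s < s'` past `λ(s')` on one side of the path or on the other gives
`ln |s - s'| ± iπ + logQuot s s'`; the principal value is the mean of the two. -/
noncomputable def pvLog (Γ : SpectralCurve m W) (s s' : ℝ) : ℂ :=
  (Real.log |s - s'| : ℂ) + Γ.logQuot s s'

/-- `S_i = t ∫ ρ₀(s) ds` over the part of the path lying on the `i`-th cut. -/
noncomputable def fillingFraction (Γ : SpectralCurve m W) (i : Fin (m + 1)) : ℂ :=
  Γ.t * ∫ s in Γ.lam ⁻¹' (Γ.lam '' Set.Icc (Γ.left i) (Γ.right i)), Γ.density s

/-- `S̃_i = S_1 + ⋯ + S_i` for `i = 1, …, n - 1`. -/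
noncomputable def partialSum (Γ : SpectralCurve m W) (i : Fin m) : ℂ :=
  ∑ j ∈ Finset.Iic i.castSucc, Γ.fillingFraction j

/-- The prepotential
`𝓕₀ = t² 𝒫∫ds ∫ds' ln(λ(s) - λ(s')) ρ₀(s) ρ₀(s') - t ∫ds W(λ(s)) ρ₀(s)`. -/
noncomputable def prepotential (Γ : SpectralCurve m W) : ℂ :=
  Γ.t ^ 2 * (∫ s, ∫ s', Γ.pvLog s s' * Γ.density s * Γ.density s') -
    Γ.t * ∫ s, W.eval (Γ.lam s) * Γ.density s

end SpectralCurve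

/-- A family of curves with cuts, indexed by an open set of parameters `(t, S̃)`, whose paths and cut
end points vary smoothly (over `ℝ`) with the parameters and whose logarithms vary continuously, and
for which the parameters are the values of `t` and `S̃_1, …, S̃_{n-1}`. -/
structure IsSpecialCoordinateFamily {m : ℕ} {W : ℂ[X]} (U : Set (ℂ × (Fin m → ℂ)))
    (Γ : ℂ × (Fin m → ℂ) → SpectralCurve m W) : Prop where
  isOpen : IsOpen U
  t_eq : ∀ p ∈ U, (Γ p).t = p.1
  partialSum_eq : ∀ p ∈ U, ∀ i, (Γ p).partialSum i = p.2 i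
  contDiffOn_lam : ContDiffOn ℝ ∞
    (fun q : (ℂ × (Fin m → ℂ)) × ℝ => (Γ q.1).lam q.2) (U ×ˢ Set.univ)
  contDiffOn_left : ∀ i, ContDiffOn ℝ ∞ (fun p => (Γ p).left i) U
  contDiffOn_right : ∀ i, ContDiffOn ℝ ∞ (fun p => (Γ p).right i) U
  continuousOn_logQuot : ContinuousOn
    (fun q : (ℂ × (Fin m → ℂ)) × ℝ × ℝ => (Γ q.1).logQuot q.2.1 q.2.2) (U ×ˢ Set.univ)

/-! Write μ = tρ₀ (`SpectralCurve.mass`). The boundary values of y₀ on the two sides of a cut are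
opposite, so those of the Cauchy transform (W' − y₀)/2 of μ have sum W'. This is the equilibrium
condition: along each cut the effective potential W(λ(s)) − 2 ∫ 𝒫 ln(λ(s) − λ(s')) μ(s') ds' has
zero derivative, hence equals a constant L_i on the i-th cut
(`SpectralCurve.potential_eq_multiplier`).

Everything follows from dF₀ = −Σ L_i dS_i (`IsSpecialCoordinateFamily.hasFDerivAt_prepotential`).
The S̃_i are the partial sums of the S_i, and the total is t, so each S_i is a linear function of
(t, S̃). The differential is therefore complex linear, which gives holomorphy although the data
depend only real-smoothly on the parameters. The left side of the relation is this differential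
applied to the vector (t, S̃) itself, that is −Σ L_i S_i. Integrating the effective potential
against μ turns it into 2 ∬ ln · μμ − ∫ Wμ = 2F₀ + ∫ Wμ.

To differentiate F₀, a nearby curve is transported to the cuts of a reference curve by a change of
parameter matching all end points. Let η be the displacement of the path, and let primes mark the
nearby curve. Since the potential of each curve is constant on cuts, integrating it against the
density of the other curve gives an exact identity, `SpectralCurve.Close.prepotential_sub`: F₀' − F₀
+ ½ Σ (L_i + L_i')(S_i' − S_i) = ∬ (ln' − ln) μ μ' − ½ ∫ (W∘λ' − W∘λ)(μ + μ'). Its right side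
carries only differences of kernels and of values of W, which are of first order in η; the
difference of the densities enters only in products with these. To first order it is ∬ (η − η̃)/(λ −
λ̃) μμ − ∫ η W' μ, where the tilde marks the second variable, and this vanishes by the loop
equation, the equilibrium condition symmetrised in the two variables. Hence the error is O(|η|(|η| +
|μ' − μ|)). The path moves at a Lipschitz rate in the parameters, while continuity of the
transported density suffices; no derivative of the density, which has square-root factors at the
moving end points, is ever taken.

The explicit density comes from y₀ = ∏ of one-arc square roots: both are continuous square roots of
one polynomial on the complement of the cuts, which is connected, and they agree at infinity. Each
one-arc root is a polynomial plus a Cauchy transform (`LogPath.root_eq_sub_cauchy`), obtained from a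
first-order differential equation rather than by contour deformation, and products keep this form
(`LogPath.exists_prod_root_rep`). -/

/-! ### Continuous square roots and logarithms; arcs do not separate the plane. -/

/-- A continuous function is differentiable where its square is, away from its zeros. -/
theorem hasDerivAt_of_sq {𝕜 : Type*} [NontriviallyNormedField 𝕜] [NormedAlgebra 𝕜 ℂ]
    {f : 𝕜 → ℂ} {x : 𝕜} {d : ℂ} (hf : ContinuousAt f x) (h0 : f x ≠ 0)
    (hd : HasDerivAt (fun y => f y ^ 2) d x) : HasDerivAt f (d / (2 * f x)) x := by
  rw [hasDerivAt_iff_tendsto_slope] at hd ⊢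
  have h1 : Tendsto (fun y => (f y + f x)) (𝓝[≠] x) (𝓝 (2 * f x)) := by
    rw [two_mul]
    exact ((hf.tendsto).mono_left nhdsWithin_le_nhds).add tendsto_const_nhds
  -- The slope of f² is the slope of f times f(y) + f(x), and that factor tends to 2 f(x) ≠ 0.
  have h2 := hd.div h1 (mul_ne_zero two_ne_zero h0)
  refine h2.congr' ?_
  have h3 : ∀ᶠ y in 𝓝[≠] x, f y + f x ≠ 0 := h1.eventually_ne (mul_ne_zero two_ne_zero h0)
  filter_upwards [h3] with y hy
  simp only [slope, vsub_eq_sub, Pi.div_apply]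
  rw [div_eq_iff hy, smul_mul_assoc]
  ring_nf

/-- A continuous function is differentiable where its exponential is. -/
theorem hasDerivAt_of_exp {f : ℝ → ℂ} {x : ℝ} {d : ℂ} (hf : ContinuousAt f x)
    (hd : HasDerivAt (fun y => Complex.exp (f y)) d x) :
    HasDerivAt f (d / Complex.exp (f x)) x := by
  -- Near x the function is f(x) plus the principal logarithm of exp f(y) / exp f(x); the two agree
  -- once |f(y) − f(x)| < 1, which is less than π.
  have h1 : HasDerivAt (fun y => f x + Complex.log (Complex.exp (f y) / Complex.exp (f x)))
      (d / Complex.exp (f x)) x := by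
    have h2 := (hd.div_const (Complex.exp (f x))).clog_real (by simp [Complex.exp_ne_zero])
    rw [div_self (Complex.exp_ne_zero _), div_one] at h2
    exact h2.const_add (f x)
  refine h1.congr_of_eventuallyEq ?_
  have h3 : ∀ᶠ y in 𝓝 x, ‖f y - f x‖ < 1 := by
    have : Tendsto (fun y => ‖f y - f x‖) (𝓝 x) (𝓝 0) := by
      simpa using (hf.tendsto.sub_const (f x)).norm
    exact this.eventually_lt_const one_pos
  filter_upwards [h3] with y hy
  have h4 := (Complex.abs_im_le_norm (f y - f x)).trans_lt hy
  rw [abs_lt] at h4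
  rw [← Complex.exp_sub, Complex.log_exp (by linarith [Real.pi_gt_three])
    (by linarith [Real.pi_gt_three])]
  ring

/-- Two continuous logarithms of the same function on a preconnected set differ by a constant. -/
theorem exp_lift_sub_eq {A : Type*} [TopologicalSpace A] {s : Set A} (hs : IsPreconnected s)
    {f g : A → ℂ} (hf : ContinuousOn f s) (hg : ContinuousOn g s)
    (h : ∀ x ∈ s, Complex.exp (f x) = Complex.exp (g x)) {a b : A} (ha : a ∈ s) (hb : b ∈ s) :
    f b - f a = g b - g a := by
  have := Complex.isCoveringMap_exp.eqOn_of_comp_eqOn (g₁ := fun x => f x - f a)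
    (g₂ := fun x => g x - g a) hs (hf.sub continuousOn_const) (hg.sub continuousOn_const)
    (fun x hx => by simp [Complex.exp_sub, h x hx, h a ha]) ha (by simp)
  exact this hb

theorem IsSimplyConnected.univ_of_contractible {E : Type*} [TopologicalSpace E]
    [ContractibleSpace E] : IsSimplyConnected (Set.univ : Set E) := by
  have : ContractibleSpace (Set.univ : Set E) :=
    (Homeomorph.Set.univ E).contractibleSpace
  exact (inferInstance : SimplyConnectedSpace (Set.univ : Set E))

/-- A nonvanishing continuous function on the line or the plane has a continuous logarithm. -/
theorem exists_continuous_exp_eq {E : Type*} [NormedAddCommGroup E] [NormedSpace ℝ E]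
    {g : E → ℂ} (hg : Continuous g) (h0 : ∀ x, g x ≠ 0) :
    ∃ f : E → ℂ, Continuous f ∧ ∀ x, Complex.exp (f x) = g x := by
  obtain ⟨f, hf, hfg⟩ := Complex.exists_continuousOn_eqOn_exp_comp (U := (Set.univ : Set E))
    IsSimplyConnected.univ_of_contractible isOpen_univ hg.continuousOn (by simpa using h0)
  exact ⟨f, by simpa [continuousOn_univ] using hf, fun x => hfg (Set.mem_univ x)⟩

theorem exists_continuousOn_Icc_exp_eq {a b : ℝ} {g : ℝ → ℂ} (hg : Continuous g)
    (h0 : ∀ x ∈ Set.Icc a b, g x ≠ 0) :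
    ∃ f : ℝ → ℂ, ContinuousOn f (Set.Icc a b) ∧
      ∀ s ∈ Set.Icc a b, Complex.exp (f s) = g s := by
  by_cases hab : a ≤ b
  · obtain ⟨f, hf, hf2⟩ := exists_continuous_exp_eq (E := ℝ)
      (g := fun s => g (Set.projIcc a b hab s))
      (hg.comp (continuous_subtype_val.comp continuous_projIcc))
      (fun s => h0 _ (Set.projIcc a b hab s).2)
    refine ⟨f, hf.continuousOn, fun s hs => ?_⟩
    rw [hf2, Set.projIcc_of_mem hab hs]
  · exact ⟨fun _ => 0, continuousOn_const, fun s hs => absurd (hs.1.trans hs.2) hab⟩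

/-- The identity has no continuous logarithm on a circle. -/
theorem not_exists_log_on_circle (x₀ : ℂ) {r : ℝ} (hr : 0 < r) {g : ℂ → ℂ} (hg : Continuous g)
    (h : ∀ x, ‖x - x₀‖ = r → Complex.exp (g x) = x - x₀) : False := by
  let γ : ℝ → ℂ := fun θ => x₀ + r * Complex.exp (θ * Complex.I)
  have hγ : Continuous γ := by fun_prop
  have h1 := exp_lift_sub_eq (s := Set.univ) (isPreconnected_univ (α := ℝ))
    (f := fun θ => g (γ θ)) (g := fun θ : ℝ => (Real.log r : ℂ) + θ * Complex.I)
    (hg.comp hγ).continuousOn (by fun_prop) (fun θ _ => by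
      rw [h _ (by simp [γ, Complex.norm_exp_ofReal_mul_I, abs_of_pos hr]), Complex.exp_add,
        ← Complex.ofReal_exp, Real.exp_log hr]
      simp [γ]) (Set.mem_univ (0 : ℝ)) (Set.mem_univ (2 * Real.pi))
  have h2 : γ (2 * Real.pi) = γ 0 := by
    simp [γ]
  simp only [h2, sub_self] at h1
  simp [Complex.ext_iff, Real.pi_ne_zero] at h1

/-- If every `x - x₀` with `x₀ ∉ K` has a continuous logarithm on the compact set `K`, then
the plane compact set `K` does not separate the plane (one half of Eilenberg's criterion). -/
theorem isPreconnected_compl_of_exists_log {K : Set ℂ} (hK : IsCompact K)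
    (h : ∀ x₀ ∉ K, ∃ g : ℂ → ℂ, Continuous g ∧ ∀ x ∈ K, Complex.exp (g x) = x - x₀) :
    IsPreconnected Kᶜ := by
  obtain ⟨r, hr, hKr⟩ := hK.isBounded.subset_closedBall_lt 0 0
  -- The exterior of a disc is the image of a half-plane under the exponential.
  have hE : IsPreconnected {x : ℂ | r < ‖x‖} := by
    have : {x : ℂ | r < ‖x‖} = Complex.exp '' {z : ℂ | Real.log r < z.re} := by
      ext x
      simp only [Set.mem_ofPred_eq, Set.mem_image]
      constructor
      · intro hx
        have hx0 : x ≠ 0 := by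
          rintro rfl
          simp at hx
          linarith
        exact ⟨Complex.log x, by simpa [Complex.log_re] using Real.log_lt_log hr hx,
          Complex.exp_log hx0⟩
      · rintro ⟨z, hz, rfl⟩
        rw [Complex.norm_exp]
        exact (Real.log_lt_iff_lt_exp hr).1 hz
    rw [this]
    refine IsPreconnected.image ?_ _ Complex.continuous_exp.continuousOn
    exact (convex_halfSpace_re_gt (Real.log r)).isPreconnected
  have hEK : {x : ℂ | r < ‖x‖} ⊆ Kᶜ := fun x hx hxK => by
    have := hKr hxK
    simp at this
    exact absurd hx (not_lt.2 this)
  have key : ∀ u v : Set ℂ, IsOpen u → IsOpen v → Kᶜ ⊆ u ∪ v → Kᶜ ∩ (u ∩ v) = ∅ →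
      {x : ℂ | r < ‖x‖} ⊆ u → Kᶜ ⊆ u := by
    intro u v hu hv huv hd hEu x₀ hx₀
    by_contra hx₀u
    have hx₀v : x₀ ∈ v := (huv hx₀).resolve_left hx₀u
    obtain ⟨g, hg, hgK⟩ := h x₀ hx₀
    classical
    have hKo : IsOpen Kᶜ := hK.isClosed.isOpen_compl
    set B : Set ℂ := Kᶜ ∩ v with hB
    have hBo : IsOpen B := hKo.inter hv
    have hBu : ∀ x, x ∈ B → x ∉ u := fun x hx hxu =>
      (Set.eq_empty_iff_forall_notMem.1 hd x) ⟨hx.1, hxu, hx.2⟩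
    have hfr : ∀ x ∈ frontier B, x ∈ K := by
      intro x hx
      by_contra hxK
      rw [frontier, hBo.interior_eq] at hx
      rcases huv hxK with hxu | hxv
      · have : x ∈ closure B := hx.1
        rw [mem_closure_iff] at this
        obtain ⟨y, hy1, hy2⟩ := this u hu hxu
        exact hBu y hy2 hy1
      · exact hx.2 ⟨hxK, hxv⟩
    -- B is the part of the complement of K lying in v, hence away from infinity, and its frontier
    -- lies in K, where exp g = x − x₀. Gluing exp g on B with x − x₀ elsewhere removes the zero at
    -- x₀, so the glued function has a global logarithm. On a large circle this would be a logarithm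
    -- of x − x₀, which does not exist.
    let F : ℂ → ℂ := fun x => if x ∈ B then Complex.exp (g x) else x - x₀
    have hF : Continuous F := by
      refine Continuous.if (fun x hx => hgK x (hfr x hx)) (Complex.continuous_exp.comp hg)
        (by fun_prop)
    have hF0 : ∀ x, F x ≠ 0 := by
      intro x
      by_cases hx : x ∈ B
      · simp [F, hx, Complex.exp_ne_zero]
      · simp only [F, hx, if_false]
        intro h0
        rw [sub_eq_zero] at h0
        exact hx (h0 ▸ ⟨hx₀, hx₀v⟩)
    obtain ⟨f, hf, hfF⟩ := exists_continuous_exp_eq hF hF0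
    refine not_exists_log_on_circle x₀ (r := r + ‖x₀‖ + 1) (by positivity) hf fun x hx => ?_
    rw [hfF]
    have : x ∉ B := fun hxB => hBu x hxB (hEu (by
      have := norm_sub_le x x₀
      simp only [Set.mem_ofPred_eq]
      linarith))
    simp [F, this]
  rw [isPreconnected_iff_subset_of_disjoint]
  intro u v hu hv huv hd
  have hE2 := isPreconnected_iff_subset_of_disjoint.1 hE u v hu hv (hEK.trans huv)
    (Set.eq_empty_of_subset_empty fun x hx => by
      rw [← hd]
      exact ⟨hEK hx.1, hx.2⟩)
  rcases hE2 with h1 | h1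
  · exact Or.inl (key u v hu hv huv hd h1)
  · exact Or.inr (key v u hv hu (by rwa [Set.union_comm]) (by rwa [Set.inter_comm v u]) h1)

/-- The complement of finitely many disjoint arcs is connected. -/
theorem isPreconnected_compl_arcs {ι : Type*} [Finite ι] {lam : ℝ → ℂ} (hlam : Continuous lam)
    (hinj : Function.Injective lam) (a b : ι → ℝ)
    (hdis : Pairwise fun i j => Disjoint (Set.Icc (a i) (b i)) (Set.Icc (a j) (b j))) :
    IsPreconnected (⋃ i, lam '' Set.Icc (a i) (b i))ᶜ := by
  classical
  have hK : IsCompact (⋃ i, lam '' Set.Icc (a i) (b i)) :=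
    isCompact_iUnion fun i => isCompact_Icc.image hlam
  refine isPreconnected_compl_of_exists_log hK fun x₀ hx₀ => ?_
  simp only [Set.mem_iUnion, not_exists] at hx₀
  set T : Set ℝ := ⋃ i, Set.Icc (a i) (b i) with hT
  have hTc : IsCompact T := isCompact_iUnion fun i => isCompact_Icc
  have hlog : ∀ i, ∃ f : ℝ → ℂ, ContinuousOn f (Set.Icc (a i) (b i)) ∧
      ∀ s ∈ Set.Icc (a i) (b i), Complex.exp (f s) = lam s - x₀ := fun i =>
    exists_continuousOn_Icc_exp_eq (hlam.sub continuous_const) fun s hs h0 =>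
      hx₀ i ⟨s, hs, sub_eq_zero.1 h0⟩
  choose f hf hf2 using hlog
  let g : ℝ → ℂ := fun s => if h : ∃ i, s ∈ Set.Icc (a i) (b i) then f h.choose s else 0
  have hgf : ∀ i, ∀ s ∈ Set.Icc (a i) (b i), g s = f i s := by
    intro i s hs
    have h : ∃ i, s ∈ Set.Icc (a i) (b i) := ⟨i, hs⟩
    have h2 : h.choose = i := by
      by_contra hne
      exact (Set.disjoint_left.1 (hdis hne)) h.choose_spec hs
    simp only [g, h, dif_pos, h2]
  have hg : ContinuousOn g T := by
    refine (locallyFinite_of_finite _).continuousOn_iUnion (fun i => isClosed_Icc) fun i => ?_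
    exact (hf i).congr (hgf i)
  have : CompactSpace T := isCompact_iff_compactSpace.1 hTc
  have hemb : IsClosedEmbedding (fun s : T => lam s) :=
    (hlam.comp continuous_subtype_val).isClosedEmbedding
      (hinj.comp Subtype.val_injective)
  -- Tietze: the logarithms found on the separate parameter intervals form a continuous function on
  -- T, which `lam` embeds as a closed subset of the plane.
  obtain ⟨G, hG⟩ := ContinuousMap.exists_extension' hemb (⟨T.domRestrict g, hg.domRestrict⟩ : C(T, ℂ))
  refine ⟨G, G.continuous, fun x hx => ?_⟩
  obtain ⟨i, s, hs, rfl⟩ := Set.mem_iUnion.1 hx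
  have := congr_fun hG ⟨s, Set.mem_iUnion.2 ⟨i, hs⟩⟩
  simp only [Function.comp_apply, ContinuousMap.coe_mk, Set.domRestrict_apply] at this
  rw [this, hgf i s hs, hf2 i s hs]

/-! ### Difference quotients of the path, and points on its normals. -/

/-- A smooth path in the plane with a continuous logarithm of its difference quotient. -/
structure LogPath where
  /-- the path -/
  lam : ℝ → ℂ
  /-- the logarithm of the difference quotient -/
  ell : ℝ → ℝ → ℂ
  contDiff_lam : ContDiff ℝ ∞ lam
  continuous_ell : Continuous (Function.uncurry ell)
  exp_ell : ∀ s s', Complex.exp (ell s s') * ((s : ℂ) - (s' : ℂ)) = lam s - lam s'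

namespace LogPath

variable (G : LogPath)

theorem continuous_lam : Continuous G.lam := G.contDiff_lam.continuous

theorem hasDerivAt_lam (s : ℝ) : HasDerivAt G.lam (deriv G.lam s) s :=
  (G.contDiff_lam.differentiable (by simp) s).hasDerivAt

theorem contDiff_deriv : ContDiff ℝ ∞ (deriv G.lam) :=
  ((contDiff_infty_iff_deriv).1 G.contDiff_lam).2

theorem continuous_deriv : Continuous (deriv G.lam) := G.contDiff_deriv.continuous

theorem continuous_ell_comp {α : Type*} [TopologicalSpace α] {f g : α → ℝ} (hf : Continuous f)
    (hg : Continuous g) : Continuous fun x => G.ell (f x) (g x) :=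
  G.continuous_ell.comp (hf.prodMk hg)

theorem lam_sub_ne_zero {s s' : ℝ} (h : s ≠ s') : G.lam s - G.lam s' ≠ 0 := by
  rw [← G.exp_ell]
  exact mul_ne_zero (Complex.exp_ne_zero _) (sub_ne_zero.2 (by exact_mod_cast h))

theorem injective_lam : Function.Injective G.lam := fun s s' h => by
  by_contra hne
  exact G.lam_sub_ne_zero hne (sub_eq_zero.2 h)

theorem exp_ell_of_ne {s s' : ℝ} (h : s ≠ s') :
    Complex.exp (G.ell s s') = (G.lam s - G.lam s') / ((s : ℂ) - s') := by
  rw [eq_div_iff (sub_ne_zero.2 (by exact_mod_cast h)), G.exp_ell]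

/-- The defining relation says nothing on the diagonal; continuity of `ell` determines the value
there as the limit of difference quotients. In particular the path is regular. -/
theorem exp_ell_self (s : ℝ) : Complex.exp (G.ell s s) = deriv G.lam s := by
  have h1 := hasDerivAt_iff_tendsto_slope.1 (G.hasDerivAt_lam s)
  have h2 : Tendsto (fun σ => Complex.exp (G.ell σ s)) (𝓝[≠] s) (𝓝 (Complex.exp (G.ell s s))) :=
    ((Complex.continuous_exp.comp (G.continuous_ell_comp continuous_id
      (continuous_const (y := s)))).tendsto s).mono_left nhdsWithin_le_nhds
  refine tendsto_nhds_unique (h2.congr' ?_) h1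
  filter_upwards [self_mem_nhdsWithin] with σ hσ
  rw [G.exp_ell_of_ne hσ, slope, vsub_eq_sub, Complex.real_smul, div_eq_inv_mul]
  push_cast
  rfl

theorem deriv_ne_zero (s : ℝ) : deriv G.lam s ≠ 0 := by
  rw [← G.exp_ell_self]
  exact Complex.exp_ne_zero _

/-- The difference quotient is symmetric, so `ell` and its transpose are two continuous logarithms
of one function on the plane; they agree on the diagonal, hence everywhere. -/
theorem ell_symm (s s' : ℝ) : G.ell s s' = G.ell s' s := by
  have h := exp_lift_sub_eq (s := (Set.univ : Set (ℝ × ℝ))) isPreconnected_univ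
    (f := fun q => G.ell q.1 q.2) (g := fun q => G.ell q.2 q.1)
    (G.continuous_ell_comp continuous_fst continuous_snd).continuousOn
    (G.continuous_ell_comp continuous_snd continuous_fst).continuousOn
    (fun q _ => by
      by_cases hq : q.1 = q.2
      · rw [hq]
      · rw [G.exp_ell_of_ne hq, G.exp_ell_of_ne (Ne.symm hq), ← neg_sub (G.lam q.2),
          ← neg_sub (q.2 : ℂ), neg_div_neg_eq])
    (Set.mem_univ (s, s)) (Set.mem_univ (s, s'))
  simpa using h

/-- Uniform bounds for the difference quotient of the path on a compact interval. -/
structure Bounds (A B C c : ℝ) : Prop where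
  C_pos : 0 < C
  c_pos : 0 < c
  lower : ∀ σ ∈ Set.Icc A B, ∀ s ∈ Set.Icc A B, c ≤ ‖Complex.exp (G.ell σ s)‖
  lip : ∀ σ ∈ Set.Icc A B, ∀ s ∈ Set.Icc A B,
    ‖deriv G.lam s - Complex.exp (G.ell σ s)‖ ≤ C * |σ - s|

theorem exists_bounds (A B : ℝ) : ∃ C c : ℝ, G.Bounds A B C c := by
  have hK : IsCompact (Set.Icc A B ×ˢ Set.Icc A B) := isCompact_Icc.prod isCompact_Icc
  have hE : Continuous fun q : ℝ × ℝ => Complex.exp (G.ell q.1 q.2) :=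
    Complex.continuous_exp.comp (G.continuous_ell_comp continuous_fst continuous_snd)
  obtain ⟨C₂, hC₂⟩ := hK.exists_bound_of_continuousOn
    (f := fun q : ℝ × ℝ => (Complex.exp (G.ell q.1 q.2))⁻¹)
    (hE.inv₀ fun q => Complex.exp_ne_zero _).continuousOn
  obtain ⟨C₃, hC₃⟩ := isCompact_Icc.exists_bound_of_continuousOn (s := Set.Icc A B)
    (f := deriv (deriv G.lam))
    ((contDiff_infty_iff_deriv).1 G.contDiff_deriv).2.continuous.continuousOn
  have hd : ∀ s ∈ Set.Icc A B, ∀ s' ∈ Set.Icc A B,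
      ‖deriv G.lam s - deriv G.lam s'‖ ≤ C₃ * |s - s'| := fun s hs s' hs' =>
    (convex_Icc A B).norm_image_sub_le_of_norm_deriv_le
      (fun x _ => G.contDiff_deriv.differentiable (by simp) x) hC₃ hs' hs
  refine ⟨max C₃ 1, (max C₂ 1)⁻¹, by positivity, by positivity, ?_, ?_⟩
  · intro σ hσ s hs
    have h1 := hC₂ (σ, s) ⟨hσ, hs⟩
    rw [norm_inv] at h1
    have h2 : 0 < ‖Complex.exp (G.ell σ s)‖ := norm_pos_iff.2 (Complex.exp_ne_zero _)
    exact inv_le_of_inv_le₀ h2 (h1.trans (le_max_left _ _))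
  · intro σ hσ s hs
    by_cases hne : σ = s
    · subst hne
      simp [G.exp_ell_self]
    have hC₃0 : 0 ≤ C₃ := (norm_nonneg _).trans (hC₃ s hs)
    -- Mean value inequality for λ(x) − x λ'(s), whose derivative is O(|σ − s|) between s and σ.
    have h1 : ‖(G.lam σ - σ * deriv G.lam s) - (G.lam s - s * deriv G.lam s)‖ ≤
        C₃ * |σ - s| * ‖σ - s‖ := by
      refine (convex_uIcc s σ).norm_image_sub_le_of_norm_hasDerivWithin_le
        (f := fun x : ℝ => G.lam x - x * deriv G.lam s)
        (f' := fun x => deriv G.lam x - 1 * deriv G.lam s) (fun x _ =>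
        ((G.hasDerivAt_lam x).sub
          ((Complex.ofRealCLM.hasDerivAt (x := x)).mul_const _)).hasDerivWithinAt) ?_
        Set.left_mem_uIcc Set.right_mem_uIcc
      intro x hx
      rw [one_mul]
      refine (hd x (Set.uIcc_subset_Icc hs hσ hx) s hs).trans ?_
      exact mul_le_mul_of_nonneg_left (Set.abs_sub_left_of_mem_uIcc hx) hC₃0
    have h2 : deriv G.lam s - Complex.exp (G.ell σ s) =
        -((G.lam σ - σ * deriv G.lam s) - (G.lam s - s * deriv G.lam s)) / ((σ : ℂ) - s) := by
      have h3 : (σ : ℂ) - s ≠ 0 := sub_ne_zero.2 (by exact_mod_cast hne)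
      rw [G.exp_ell_of_ne hne]
      field_simp
      ring
    have h4 : ‖(σ : ℂ) - s‖ = |σ - s| := by
      rw [← Complex.ofReal_sub, Complex.norm_real, Real.norm_eq_abs]
    have h5 : 0 < |σ - s| := abs_pos.2 (sub_ne_zero.2 hne)
    rw [h2, norm_div, norm_neg, h4, div_le_iff₀ h5]
    refine h1.trans ?_
    rw [Real.norm_eq_abs]
    gcongr
    exact le_max_left _ _

/-- The point at signed normal distance `ε |λ'(s)|` from `λ(s)`. -/
noncomputable def off (s ε : ℝ) : ℂ := G.lam s + Complex.I * ε * deriv G.lam s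

/-- The quotient `(λ(σ) - off s ε) / (σ - s - i ε)`. -/
noncomputable def ratio (s ε σ : ℝ) : ℂ := (G.lam σ - G.off s ε) / ((σ : ℂ) - s - Complex.I * ε)

theorem _root_.sub_I_mul_ne_zero (a : ℝ) {ε : ℝ} (hε : ε ≠ 0) : (a : ℂ) - Complex.I * ε ≠ 0 := by
  intro h
  have := congr_arg Complex.im h
  simp at this
  exact hε this

theorem _root_.abs_le_norm_sub_I_mul (a ε : ℝ) : |a| ≤ ‖(a : ℂ) - Complex.I * ε‖ := by
  have := Complex.abs_re_le_norm ((a : ℂ) - Complex.I * ε)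
  simpa using this

theorem den_ne_zero (σ s : ℝ) {ε : ℝ} (hε : ε ≠ 0) : (σ : ℂ) - s - Complex.I * ε ≠ 0 := by
  rw [← Complex.ofReal_sub]
  exact sub_I_mul_ne_zero _ hε

theorem lam_sub_off (s σ : ℝ) {ε : ℝ} (hε : ε ≠ 0) :
    G.lam σ - G.off s ε = ((σ : ℂ) - s - Complex.I * ε) * G.ratio s ε σ := by
  rw [ratio, mul_div_cancel₀ _ (den_ne_zero σ s hε)]

/-- The numerator on the right is O(|σ − s|) and so is absorbed by the denominator, whose modulus is
at least |σ − s|. This makes `ratio` converge to the difference quotient at rate O(ε), uniformly up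
to σ = s. -/
theorem ratio_sub (s σ : ℝ) {ε : ℝ} (hε : ε ≠ 0) :
    G.ratio s ε σ - Complex.exp (G.ell σ s) = - (Complex.I * ε) *
      (deriv G.lam s - Complex.exp (G.ell σ s)) / ((σ : ℂ) - s - Complex.I * ε) := by
  rw [ratio, eq_div_iff (den_ne_zero σ s hε), sub_mul, div_mul_cancel₀ _ (den_ne_zero σ s hε), off]
  linear_combination -G.exp_ell σ s

variable {G} {A B C c : ℝ}

theorem Bounds.norm_ratio_sub_le (hG : G.Bounds A B C c) {s σ : ℝ} (hs : s ∈ Set.Icc A B)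
    (hσ : σ ∈ Set.Icc A B) {ε : ℝ} (hε : ε ≠ 0) :
    ‖G.ratio s ε σ - Complex.exp (G.ell σ s)‖ ≤ C * |ε| := by
  have h1 : 0 < ‖(σ : ℂ) - s - Complex.I * ε‖ := norm_pos_iff.2 (den_ne_zero σ s hε)
  rw [G.ratio_sub s σ hε, norm_div, div_le_iff₀ h1, norm_mul, norm_neg, norm_mul, Complex.norm_I,
    one_mul, Complex.norm_real, Real.norm_eq_abs]
  have h2 := abs_le_norm_sub_I_mul (σ - s) ε
  rw [Complex.ofReal_sub] at h2
  have h3 := hG.lip σ hσ s hs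
  have h5 := hG.C_pos.le
  calc |ε| * ‖deriv G.lam s - Complex.exp (G.ell σ s)‖ ≤ |ε| * (C * |σ - s|) := by gcongr
    _ ≤ |ε| * (C * ‖(σ : ℂ) - s - Complex.I * ε‖) := by gcongr
    _ = _ := by ring

theorem Bounds.norm_ratio_div_sub_one_le (hG : G.Bounds A B C c) {s σ : ℝ}
    (hs : s ∈ Set.Icc A B) (hσ : σ ∈ Set.Icc A B) {ε : ℝ} (hε : ε ≠ 0) :
    ‖G.ratio s ε σ / Complex.exp (G.ell σ s) - 1‖ ≤ C / c * |ε| := by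
  have h0 := Complex.exp_ne_zero (G.ell σ s)
  rw [div_sub_one h0, norm_div, div_le_iff₀ (norm_pos_iff.2 h0)]
  refine (hG.norm_ratio_sub_le hs hσ hε).trans ?_
  have h1 := hG.lower σ hσ s hs
  have h2 := hG.c_pos
  have h3 := hG.C_pos
  calc C * |ε| = C / c * |ε| * c := by field_simp
    _ ≤ _ := by gcongr

theorem Bounds.le_norm_ratio (hG : G.Bounds A B C c) {s σ : ℝ} (hs : s ∈ Set.Icc A B)
    (hσ : σ ∈ Set.Icc A B) {ε : ℝ} (hε : ε ≠ 0) (hεc : C * |ε| ≤ c / 2) :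
    c / 2 ≤ ‖G.ratio s ε σ‖ := by
  have h1 := hG.norm_ratio_sub_le hs hσ hε
  have h2 := hG.lower σ hσ s hs
  have h3 := norm_sub_norm_le (Complex.exp (G.ell σ s)) (G.ratio s ε σ)
  rw [norm_sub_rev] at h3
  linarith

theorem Bounds.ratio_ne_zero (hG : G.Bounds A B C c) {s σ : ℝ} (hs : s ∈ Set.Icc A B)
    (hσ : σ ∈ Set.Icc A B) {ε : ℝ} (hε : ε ≠ 0) (hεc : C * |ε| ≤ c / 2) :
    G.ratio s ε σ ≠ 0 := by
  have h1 := hG.le_norm_ratio hs hσ hε hεc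
  have h2 := hG.c_pos
  exact norm_pos_iff.1 (by linarith)

theorem Bounds.lam_ne_off (hG : G.Bounds A B C c) {s σ : ℝ} (hs : s ∈ Set.Icc A B)
    (hσ : σ ∈ Set.Icc A B) {ε : ℝ} (hε : ε ≠ 0) (hεc : C * |ε| ≤ c / 2) :
    G.lam σ ≠ G.off s ε := by
  rw [← sub_ne_zero, G.lam_sub_off s σ hε]
  exact mul_ne_zero (den_ne_zero σ s hε) (hG.ratio_ne_zero hs hσ hε hεc)

theorem Bounds.eventually_small (hG : G.Bounds A B C c) :
    ∀ᶠ ε : ℝ in 𝓝 0, C * |ε| ≤ c / 2 := by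
  have h : Tendsto (fun ε : ℝ => C * |ε|) (𝓝 0) (𝓝 (C * |(0 : ℝ)|)) :=
    (continuous_const.mul continuous_abs).tendsto 0
  rw [abs_zero, mul_zero] at h
  exact h.eventually_le_const (by linarith [hG.c_pos])

variable (G)

theorem tendsto_off (s : ℝ) : Tendsto (G.off s) (𝓝 0) (𝓝 (G.lam s)) := by
  have : Continuous (G.off s) := by
    unfold off
    fun_prop
  simpa [off] using this.tendsto 0

/-- Near the path, the normals of the path do not meet it. -/
theorem eventually_off_notMem (a b s : ℝ) :
    ∀ᶠ ε : ℝ in 𝓝[≠] 0, G.off s ε ∉ G.lam '' Set.Icc a b := by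
  obtain ⟨C, c, hG⟩ := G.exists_bounds (min a s) (max b s)
  filter_upwards [nhdsWithin_le_nhds hG.eventually_small, self_mem_nhdsWithin] with ε h1 h2
  rintro ⟨σ, hσ, h⟩
  exact hG.lam_ne_off ⟨min_le_right _ _, le_max_right _ _⟩
    ⟨(min_le_left _ _).trans hσ.1, hσ.2.trans (le_max_left _ _)⟩ h2 h1 h

end LogPath

/-! ### Cauchy transforms, and the square root attached to one arc. -/

theorem cexp_half_log {y : ℝ} (hy : 0 < y) :
    Complex.exp ((Real.log y : ℂ) / 2) = (Real.sqrt y : ℂ) := by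
  rw [show ((Real.log y : ℂ) / 2) = ((Real.log y / 2 : ℝ) : ℂ) by push_cast; ring,
    ← Complex.ofReal_exp, Real.exp_half, Real.exp_log hy]

namespace LogPath

variable (G : LogPath)

/-- The Cauchy transform of a density on a subset of the path. -/
noncomputable def cauchy (T : Set ℝ) (α : ℝ → ℂ) (x : ℂ) : ℂ :=
  ∫ σ in T, α σ / (x - G.lam σ)

variable {T : Set ℝ} {α : ℝ → ℂ}

theorem sub_lam_ne_zero {x : ℂ} (hx : x ∉ G.lam '' T) {σ : ℝ} (hσ : σ ∈ T) : x - G.lam σ ≠ 0 :=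
  fun h => hx ⟨σ, hσ, (sub_eq_zero.1 h).symm⟩

theorem exists_lower_bound_sub_lam (hT : IsCompact T) {x : ℂ} (hx : x ∉ G.lam '' T) :
    ∃ δ > 0, ∀ y ∈ Metric.ball x δ, ∀ σ ∈ T, δ ≤ ‖y - G.lam σ‖ := by
  have h1 : IsClosed (G.lam '' T) := (hT.image G.continuous_lam).isClosed
  obtain ⟨δ, hδ, hball⟩ := Metric.isOpen_iff.1 h1.isOpen_compl x hx
  refine ⟨δ / 2, by positivity, fun y hy σ hσ => ?_⟩
  by_contra hlt
  have h2 : G.lam σ ∈ Metric.ball x δ := by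
    rw [Metric.mem_ball] at hy ⊢
    have := dist_triangle_left (G.lam σ) x y
    rw [dist_eq_norm y] at this
    linarith
  exact hball h2 ⟨σ, hσ, rfl⟩

theorem integrableOn_cauchy (hT : IsCompact T) (hα : MeasureTheory.IntegrableOn α T) {x : ℂ}
    (hx : x ∉ G.lam '' T) : MeasureTheory.IntegrableOn (fun σ => α σ / (x - G.lam σ)) T := by
  simp_rw [div_eq_mul_inv]
  refine hα.mul_continuousOn ?_ hT
  exact (continuousOn_const.sub G.continuous_lam.continuousOn).inv₀
    fun σ hσ => G.sub_lam_ne_zero hx hσ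

theorem hasDerivAt_cauchy (hT : IsCompact T) (hα : MeasureTheory.IntegrableOn α T) {x : ℂ}
    (hx : x ∉ G.lam '' T) :
    HasDerivAt (G.cauchy T α) (∫ σ in T, -(α σ / (x - G.lam σ) ^ 2)) x := by
  obtain ⟨δ, hδ, hδT⟩ := G.exists_lower_bound_sub_lam hT hx
  have hm : ∀ y, MeasureTheory.AEStronglyMeasurable (fun σ => α σ / (y - G.lam σ))
      (MeasureTheory.volume.restrict T) := fun y => by
    simp_rw [div_eq_mul_inv]
    exact hα.aestronglyMeasurable.mul
      (measurable_const.sub G.continuous_lam.measurable).inv.aestronglyMeasurable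
  refine (hasDerivAt_integral_of_dominated_loc_of_deriv_le (Metric.ball_mem_nhds x hδ)
    (F := fun y σ => α σ / (y - G.lam σ)) (F' := fun y σ => -(α σ / (y - G.lam σ) ^ 2))
    (bound := fun σ => ‖α σ‖ / δ ^ 2) (Eventually.of_forall hm)
    (G.integrableOn_cauchy hT hα hx) ?_ ?_ (hα.norm.div_const _) ?_).2
  · refine (hα.aestronglyMeasurable.mul
      (((measurable_const (a := x)).sub
        G.continuous_lam.measurable).pow_const 2).inv.aestronglyMeasurable).neg.congr
      (Eventually.of_forall fun σ => ?_)
    simp [div_eq_mul_inv]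
  · filter_upwards [MeasureTheory.ae_restrict_mem hT.measurableSet] with σ hσ y hy
    have h1 := hδT y hy σ hσ
    rw [norm_neg, norm_div, norm_pow]
    gcongr
  · filter_upwards [MeasureTheory.ae_restrict_mem hT.measurableSet] with σ hσ y hy
    have h1 := hδT y hy σ hσ
    have h2 : y - G.lam σ ≠ 0 := norm_pos_iff.1 (hδ.trans_le h1)
    have h3 := ((hasDerivAt_id y).sub_const (G.lam σ)).inv h2
    convert! h3.const_mul (α σ) using 1
    simp [div_eq_mul_inv]

theorem continuousOn_cauchy (hT : IsCompact T) (hα : MeasureTheory.IntegrableOn α T) :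
    ContinuousOn (G.cauchy T α) (G.lam '' T)ᶜ := fun _ hx =>
  (G.hasDerivAt_cauchy hT hα hx).continuousAt.continuousWithinAt

theorem tendsto_cauchy (hT : IsCompact T) (hα : MeasureTheory.IntegrableOn α T) :
    Tendsto (G.cauchy T α) (Bornology.cobounded ℂ) (𝓝 0) := by
  obtain ⟨R, hR⟩ := (hT.image G.continuous_lam).isBounded.exists_norm_le
  have hR' : ∀ σ ∈ T, ‖G.lam σ‖ ≤ R := fun σ hσ => hR _ ⟨σ, hσ, rfl⟩
  have h1 : Tendsto (fun x : ℂ => (∫ σ in T, ‖α σ‖) / (‖x‖ - R)) (Bornology.cobounded ℂ)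
      (𝓝 0) := by
    refine Tendsto.div_atTop tendsto_const_nhds ?_
    exact tendsto_atTop_add_const_right _ (-R) tendsto_norm_cobounded_atTop
  refine squeeze_zero_norm' ?_ h1
  filter_upwards [tendsto_norm_cobounded_atTop.eventually_gt_atTop R] with x hx
  rw [cauchy, ← MeasureTheory.integral_div]
  refine MeasureTheory.norm_integral_le_of_norm_le (hα.norm.div_const _) ?_
  filter_upwards [MeasureTheory.ae_restrict_mem hT.measurableSet] with σ hσ
  rw [norm_div]
  have h2 := hR' σ hσ
  have h3 := norm_sub_norm_le x (G.lam σ)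
  have h4 : 0 < ‖x‖ - R := by linarith
  gcongr
  linarith

theorem tendsto_mul_cauchy (hT : IsCompact T) (hα : MeasureTheory.IntegrableOn α T) :
    Tendsto (fun x => x * G.cauchy T α x) (Bornology.cobounded ℂ) (𝓝 (∫ σ in T, α σ)) := by
  have hα' : MeasureTheory.IntegrableOn (fun σ => α σ * G.lam σ) T :=
    hα.mul_continuousOn G.continuous_lam.continuousOn hT
  have h1 := (G.tendsto_cauchy hT hα').const_add (∫ σ in T, α σ)
  rw [add_zero] at h1
  refine h1.congr' ?_
  have hb : (G.lam '' T)ᶜ ∈ Bornology.cobounded ℂ :=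
    Bornology.isBounded_def.1 (hT.image G.continuous_lam).isBounded
  filter_upwards [hb] with x hx
  rw [cauchy, cauchy, ← MeasureTheory.integral_add hα (G.integrableOn_cauchy hT hα' hx),
    ← MeasureTheory.integral_const_mul]
  refine MeasureTheory.setIntegral_congr_fun hT.measurableSet fun σ hσ => ?_
  have := G.sub_lam_ne_zero hx hσ
  field_simp
  ring

/-- The branch of `√((x - λ(a)) (x - λ(b)))` on the complement of the arc from `λ(a)` to `λ(b)`
that behaves like `x` at infinity. -/
noncomputable def root (a b : ℝ) (x : ℂ) : ℂ :=
  (x - G.lam a) * Complex.exp (-(1 / 2) * G.cauchy (Set.Icc a b) (deriv G.lam) x)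

theorem integrableOn_deriv (a b : ℝ) : MeasureTheory.IntegrableOn (deriv G.lam) (Set.Icc a b) :=
  G.continuous_deriv.integrableOn_Icc

variable {a b : ℝ}

/-- The exponent in `root` is half the increment along the arc of a logarithm of λ(σ) − x. Any
continuous logarithm may be used to compute it, so each position of x can be given a convenient one.
-/
theorem root_eq_of_log (hab : a ≤ b) {x : ℂ} (hx : x ∉ G.lam '' Set.Icc a b) {g : ℝ → ℂ}
    (hg : ContinuousOn g (Set.Icc a b))
    (hgx : ∀ σ ∈ Set.Icc a b, Complex.exp (g σ) = G.lam σ - x) :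
    G.root a b x = (x - G.lam a) * Complex.exp ((g b - g a) / 2) := by
  have h1 : ∫ σ in a..b, deriv G.lam σ / (G.lam σ - x) = g b - g a := by
    refine intervalIntegral.integral_eq_sub_of_hasDerivAt_of_le hab hg (fun σ hσ => ?_) ?_
    · have hσ' := Set.Ioo_subset_Icc_self hσ
      rw [← hgx σ hσ']
      refine hasDerivAt_of_exp (hg.continuousAt (Icc_mem_nhds hσ.1 hσ.2)) ?_
      refine ((G.hasDerivAt_lam σ).sub_const x).congr_of_eventuallyEq ?_
      filter_upwards [Icc_mem_nhds hσ.1 hσ.2] with y hy using hgx y hy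
    · refine ContinuousOn.intervalIntegrable ?_
      rw [Set.uIcc_of_le hab]
      refine G.continuous_deriv.continuousOn.div
        (G.continuous_lam.continuousOn.sub continuousOn_const) fun σ hσ h => ?_
      exact hx ⟨σ, hσ, sub_eq_zero.1 h⟩
  have h2 : G.cauchy (Set.Icc a b) (deriv G.lam) x = -(g b - g a) := by
    rw [← h1, intervalIntegral.integral_of_le hab, ← MeasureTheory.integral_Icc_eq_integral_Ioc,
      cauchy, ← MeasureTheory.integral_neg]
    congr 1
    ext σ
    rw [← neg_sub (G.lam σ) x, div_neg]
  rw [root, h2]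
  ring_nf

theorem root_sq (hab : a ≤ b) {x : ℂ} (hx : x ∉ G.lam '' Set.Icc a b) :
    G.root a b x ^ 2 = (x - G.lam a) * (x - G.lam b) := by
  obtain ⟨g, hg, hgx⟩ := exists_continuousOn_Icc_exp_eq (a := a) (b := b)
    (g := fun σ => G.lam σ - x) (G.continuous_lam.sub continuous_const)
    (fun σ hσ h => hx ⟨σ, hσ, sub_eq_zero.1 h⟩)
  have ha := hgx a (Set.left_mem_Icc.2 hab)
  have hb := hgx b (Set.right_mem_Icc.2 hab)
  have ha0 : G.lam a - x ≠ 0 := ha ▸ Complex.exp_ne_zero _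
  rw [G.root_eq_of_log hab hx hg hgx, mul_pow, ← Complex.exp_nat_mul]
  rw [show ((2 : ℕ) : ℂ) * ((g b - g a) / 2) = g b - g a by push_cast; ring, Complex.exp_sub,
    ha, hb]
  field_simp
  ring

theorem root_ne_zero (hab : a ≤ b) {x : ℂ} (hx : x ∉ G.lam '' Set.Icc a b) :
    G.root a b x ≠ 0 :=
  mul_ne_zero (G.sub_lam_ne_zero hx (Set.left_mem_Icc.2 hab)) (Complex.exp_ne_zero _)

theorem continuousOn_root : ContinuousOn (G.root a b) (G.lam '' Set.Icc a b)ᶜ := by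
  refine (continuousOn_id.sub continuousOn_const).mul (ContinuousOn.cexp ?_)
  exact continuousOn_const.mul (G.continuousOn_cauchy isCompact_Icc (G.integrableOn_deriv a b))

theorem continuousAt_root {x : ℂ} (hx : x ∉ G.lam '' Set.Icc a b) :
    ContinuousAt (G.root a b) x :=
  G.continuousOn_root.continuousAt
    ((isCompact_Icc.image G.continuous_lam).isClosed.isOpen_compl.mem_nhds hx)

theorem hasDerivAt_root (hab : a ≤ b) {x : ℂ} (hx : x ∉ G.lam '' Set.Icc a b) :
    HasDerivAt (G.root a b) ((x - (G.lam a + G.lam b) / 2) / G.root a b x) x := by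
  have h1 := hasDerivAt_of_sq (d := ((x - G.lam a) + (x - G.lam b))) (G.continuousAt_root hx)
    (G.root_ne_zero hab hx) ?_
  · convert! h1 using 1
    have := G.root_ne_zero hab hx
    field_simp
    ring
  · have h2 := ((hasDerivAt_id x).sub_const (G.lam a)).mul ((hasDerivAt_id x).sub_const (G.lam b))
    have h3 : (fun y => G.root a b y ^ 2) =ᶠ[𝓝 x] fun y => (y - G.lam a) * (y - G.lam b) := by
      filter_upwards [(isCompact_Icc.image G.continuous_lam).isClosed.isOpen_compl.mem_nhds hx]
        with y hy using G.root_sq hab hy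
    convert! h2.congr_of_eventuallyEq h3 using 1
    simp
    ring

theorem tendsto_root_div (d : ℂ) :
    Tendsto (fun x => G.root a b x / (x - d)) (Bornology.cobounded ℂ) (𝓝 1) := by
  have h1 : Tendsto (fun x => Complex.exp (-(1 / 2) * G.cauchy (Set.Icc a b) (deriv G.lam) x))
      (Bornology.cobounded ℂ) (𝓝 1) := by
    have := ((G.tendsto_cauchy isCompact_Icc (G.integrableOn_deriv a b)).const_mul
      (-(1 / 2))).cexp
    simpa using this
  have h2 : Tendsto (fun x : ℂ => x - d) (Bornology.cobounded ℂ) (Bornology.cobounded ℂ) := by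
    refine tendsto_norm_atTop_iff_cobounded.1 ?_
    refine tendsto_atTop_mono (fun x => norm_sub_norm_le x d) ?_
    exact tendsto_atTop_add_const_right _ (-‖d‖) tendsto_norm_cobounded_atTop
  have h3 : Tendsto (fun x : ℂ => 1 + (d - G.lam a) * (x - d)⁻¹) (Bornology.cobounded ℂ)
      (𝓝 1) := by
    have := ((tendsto_inv₀_cobounded.comp h2).const_mul (d - G.lam a)).const_add 1
    simpa using this
  have h4 := h3.mul h1
  rw [one_mul] at h4
  refine h4.congr' ?_
  have h5 : ∀ᶠ x : ℂ in Bornology.cobounded ℂ, x - d ≠ 0 :=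
    h2.eventually (Bornology.eventually_ne_cobounded 0)
  filter_upwards [h5] with x hx
  rw [root]
  field_simp
  ring

/-- The modulus-like factor of the boundary values of `root`. -/
noncomputable def edge (a b s : ℝ) : ℂ :=
  (Real.sqrt |s - a| : ℂ) * (Real.sqrt |s - b| : ℂ) *
    Complex.exp ((G.ell b s + G.ell a s) / 2)

theorem continuous_edge (a b : ℝ) : Continuous (G.edge a b) := by
  have h1 := G.continuous_ell_comp (continuous_const (y := b)) continuous_id
  have h2 := G.continuous_ell_comp (continuous_const (y := a)) continuous_id
  unfold edge
  simp only [id] at h1 h2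
  fun_prop

/-- Here p and q are the distances of the parameter from the two ends. One factor √p cancels against
the exponential of −½ log p, which leaves the product √p √q of `edge`. -/
theorem edge_aux {p q : ℝ} (hp : 0 < p) (u v : ℂ) :
    Complex.exp u * (p : ℂ) * Complex.exp (((Real.log q + v) - (Real.log p + u)) / 2) =
      Real.sqrt p * Complex.exp (Real.log q / 2) * Complex.exp ((v + u) / 2) := by
  have h1 : ((Real.log q + v) - (Real.log p + u)) / 2 =
    (Real.log q : ℂ) / 2 - (Real.log p : ℂ) / 2 + ((v + u) / 2 - u) := by ring
  have h3 : (p : ℂ) = Real.sqrt p * Real.sqrt p := by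
    rw [← Complex.ofReal_mul, Real.mul_self_sqrt hp.le]
  have h4 : (Real.sqrt p : ℂ) ≠ 0 := by exact_mod_cast (Real.sqrt_pos.2 hp).ne'
  rw [h1, Complex.exp_add, Complex.exp_sub, Complex.exp_sub _ u, cexp_half_log hp]
  have h5 := Complex.exp_ne_zero u
  rw [h3]
  field_simp

/-- Before the arc s − a is negative, and this is the only source of the minus sign; after the arc
there is none. On a given cut these signs, taken over the other cuts, form `SpectralCurve.sign`. -/
theorem root_lam_of_lt (hab : a ≤ b) {s : ℝ} (hs : s < a) : G.root a b (G.lam s) = -G.edge a b s := by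
  have hx : G.lam s ∉ G.lam '' Set.Icc a b := by
    rintro ⟨σ, hσ, h⟩
    rw [G.injective_lam h] at hσ
    exact absurd hσ.1 (not_le.2 hs)
  rw [G.root_eq_of_log hab hx (g := fun σ => Real.log (σ - s) + G.ell σ s)]
  · have h1 := G.exp_ell a s
    have h2 := edge_aux (p := a - s) (q := b - s) (by linarith) (G.ell a s) (G.ell b s)
    rw [cexp_half_log (by linarith : 0 < b - s)] at h2
    rw [edge, abs_of_neg (by linarith : s - a < 0), abs_of_neg (by linarith : s - b < 0),
      neg_sub, neg_sub, ← h2, ← neg_sub (G.lam a), ← h1]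
    push_cast
    ring
  · refine ContinuousOn.add ?_ (G.continuous_ell_comp continuous_id continuous_const).continuousOn
    refine Complex.continuous_ofReal.comp_continuousOn (ContinuousOn.log (by fun_prop) ?_)
    intro σ hσ
    linarith [hσ.1]
  · intro σ hσ
    rw [Complex.exp_add, ← Complex.ofReal_exp, Real.exp_log (by linarith [hσ.1]), ← G.exp_ell]
    push_cast
    ring

theorem root_lam_of_gt (hab : a ≤ b) {s : ℝ} (hs : b < s) : G.root a b (G.lam s) = G.edge a b s := by
  have hx : G.lam s ∉ G.lam '' Set.Icc a b := by
    rintro ⟨σ, hσ, h⟩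
    rw [G.injective_lam h] at hσ
    exact absurd hσ.2 (not_le.2 hs)
  -- `ell` carries the sign of σ − s while the real logarithm is that of s − σ; the constant πi
  -- makes up the sign and drops out of the increment.
  rw [G.root_eq_of_log hab hx (g := fun σ => Real.log (s - σ) + G.ell σ s + Real.pi * Complex.I)]
  · have h1 := G.exp_ell a s
    have h2 := edge_aux (p := s - a) (q := s - b) (by linarith) (G.ell a s) (G.ell b s)
    rw [cexp_half_log (by linarith : 0 < s - b)] at h2
    rw [edge, abs_of_pos (by linarith : 0 < s - a), abs_of_pos (by linarith : 0 < s - b),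
      ← h2, ← neg_sub (G.lam a), ← h1, add_sub_add_right_eq_sub]
    push_cast
    ring
  · refine ContinuousOn.add (ContinuousOn.add ?_
      (G.continuous_ell_comp continuous_id continuous_const).continuousOn) continuousOn_const
    refine Complex.continuous_ofReal.comp_continuousOn (ContinuousOn.log (by fun_prop) ?_)
    intro σ hσ
    linarith [hσ.2]
  · intro σ hσ
    rw [Complex.exp_add, Complex.exp_add, ← Complex.ofReal_exp,
      Real.exp_log (by linarith [hσ.2]), Complex.exp_pi_mul_I, ← G.exp_ell]
    push_cast
    ring

/-- A continuous logarithm along an arc of the difference with a point on a normal. -/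
noncomputable def offLog (s ε σ : ℝ) : ℂ :=
  Complex.log ((σ : ℂ) - s - Complex.I * ε) + G.ell σ s +
    Complex.log (G.ratio s ε σ / Complex.exp (G.ell σ s))

theorem tendsto_log_div_ratio (s σ : ℝ) :
    Tendsto (fun ε => Complex.log (G.ratio s ε σ / Complex.exp (G.ell σ s))) (𝓝[≠] 0) (𝓝 0) := by
  obtain ⟨C, c, hG⟩ := G.exists_bounds (min s σ) (max s σ)
  have h1 : Tendsto (fun ε => G.ratio s ε σ / Complex.exp (G.ell σ s) - 1) (𝓝[≠] 0) (𝓝 0) := by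
    refine squeeze_zero_norm' (a := fun ε => C / c * |ε|) ?_ ?_
    · filter_upwards [self_mem_nhdsWithin] with ε hε
      exact hG.norm_ratio_div_sub_one_le ⟨min_le_left _ _, le_max_left _ _⟩
        ⟨min_le_right _ _, le_max_right _ _⟩ hε
    · have : Tendsto (fun ε : ℝ => C / c * |ε|) (𝓝 0) (𝓝 (C / c * |(0 : ℝ)|)) :=
        (continuous_const.mul continuous_abs).tendsto 0
      simp only [abs_zero, mul_zero] at this
      exact this.mono_left nhdsWithin_le_nhds
  have h2 : Tendsto (fun ε => G.ratio s ε σ / Complex.exp (G.ell σ s)) (𝓝[≠] 0) (𝓝 1) := by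
    simpa using h1.add_const 1
  have := h2.clog (by simp)
  rwa [Complex.log_one] at this

/-- For ε ≠ 0 the point σ − s − iε stays off the negative axis, and for small ε the quotient of
`ratio` by the difference quotient stays within distance 1 of 1. So both principal logarithms in
`offLog` are continuous along the whole arc. -/
theorem eventually_root_off (hab : a ≤ b) {s : ℝ} (hs : s ∈ Set.Icc a b) :
    ∀ᶠ ε in 𝓝[≠] (0 : ℝ), G.root a b (G.off s ε) = (G.off s ε - G.lam a) *
      Complex.exp ((G.offLog s ε b - G.offLog s ε a) / 2) := by
  obtain ⟨C, c, hG⟩ := G.exists_bounds a b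
  have h1 : Tendsto (fun ε : ℝ => C / c * |ε|) (𝓝 0) (𝓝 (C / c * |(0 : ℝ)|)) :=
    (continuous_const.mul continuous_abs).tendsto 0
  rw [abs_zero, mul_zero] at h1
  filter_upwards [G.eventually_off_notMem a b s, self_mem_nhdsWithin,
    nhdsWithin_le_nhds (h1.eventually_lt_const one_pos)] with ε hx hε hε1
  have hsl : ∀ σ ∈ Set.Icc a b, G.ratio s ε σ / Complex.exp (G.ell σ s) ∈ Complex.slitPlane := by
    intro σ hσ
    refine Complex.mem_slitPlane_of_norm_lt_one
      (z := G.ratio s ε σ / Complex.exp (G.ell σ s) - 1) ?_ |> fun h => by simpa using h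
    exact (hG.norm_ratio_div_sub_one_le hs hσ hε).trans_lt hε1
  have hell : Continuous fun σ => G.ell σ s := G.continuous_ell_comp continuous_id continuous_const
  refine G.root_eq_of_log hab hx ?_ ?_
  · refine ContinuousOn.add (ContinuousOn.add ?_ hell.continuousOn) ?_
    · refine ContinuousOn.clog (by fun_prop) fun σ _ => ?_
      refine Complex.mem_slitPlane_iff.2 (Or.inr ?_)
      simpa using hε
    · refine ContinuousOn.clog ?_ hsl
      refine ContinuousOn.div ?_ hell.cexp.continuousOn fun σ _ => Complex.exp_ne_zero _
      unfold ratio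
      exact (G.continuous_lam.continuousOn.sub continuousOn_const).div (by fun_prop)
        fun σ _ => den_ne_zero σ s hε
  · intro σ hσ
    have h2 := G.lam_sub_off s σ hε
    rw [offLog, Complex.exp_add, Complex.exp_add, Complex.exp_log (den_ne_zero σ s hε),
      Complex.exp_log (Complex.slitPlane_ne_zero (hsl σ hσ)), h2]
    have := Complex.exp_ne_zero (G.ell σ s)
    field_simp

/-- Of the terms of `offLog` only log(a − s − iε) depends on the side of approach, because a − s
lies on the branch cut of the logarithm. The number z, later ±πi, records the side, so the boundary
values are ±i times `edge`. -/
theorem tendsto_root_off_of_log (hab : a ≤ b) {s : ℝ} (hs : s ∈ Set.Ioo a b) {l : Filter ℝ}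
    (hl : l ≤ 𝓝[≠] 0) {z : ℂ}
    (h : Tendsto (fun ε : ℝ => Complex.log ((a : ℂ) - s - Complex.I * ε)) l
      (𝓝 (Real.log (s - a) - z))) :
    Tendsto (fun ε => G.root a b (G.off s ε)) l (𝓝 (Complex.exp (z / 2) * G.edge a b s)) := by
  have hl' : l ≤ 𝓝 0 := hl.trans nhdsWithin_le_nhds
  have hb : Tendsto (fun ε : ℝ => Complex.log ((b : ℂ) - s - Complex.I * ε)) l
      (𝓝 (Real.log (b - s))) := by
    have h1 : Continuous fun ε : ℝ => ((b : ℂ) - s - Complex.I * ε) := by fun_prop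
    have h2 := ((h1.tendsto 0).mono_left hl').clog (by
      refine Complex.mem_slitPlane_iff.2 (Or.inl ?_)
      simpa using hs.2)
    convert! h2 using 2
    rw [Complex.ofReal_log (by linarith [hs.2])]
    simp
  have h1 : ∀ {σ : ℝ} {w : ℂ}, Tendsto (fun ε : ℝ => Complex.log ((σ : ℂ) - s - Complex.I * ε)) l
      (𝓝 w) → Tendsto (fun ε => G.offLog s ε σ) l (𝓝 (w + G.ell σ s)) := by
    intro σ w hw
    simpa [offLog] using (hw.add_const (G.ell σ s)).add ((G.tendsto_log_div_ratio s σ).mono_left hl)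
  have h2 := (((G.tendsto_off s).mono_left hl').sub_const (G.lam a)).mul
    (((h1 hb).sub (h1 h)).div_const 2).cexp
  have h3 := h2.congr' (((G.eventually_root_off hab ⟨hs.1.le, hs.2.le⟩).filter_mono hl).mono
    fun ε h => h.symm)
  convert! h3 using 2
  have h4 := edge_aux (p := s - a) (q := b - s) (by linarith [hs.1]) (G.ell a s) (G.ell b s)
  rw [cexp_half_log (by linarith [hs.2] : 0 < b - s)] at h4
  rw [edge, abs_of_pos (by linarith [hs.1] : 0 < s - a), abs_of_neg (by linarith [hs.2] : s - b < 0),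
    neg_sub, ← h4, ← G.exp_ell, G.ell_symm s a,
    show ((Real.log (b - s) + G.ell b s) - ((Real.log (s - a) - z) + G.ell a s)) / 2 =
      z / 2 + ((Real.log (b - s) + G.ell b s) - (Real.log (s - a) + G.ell a s)) / 2 by ring,
    Complex.exp_add]
  push_cast
  ring

/-- At an end point no branch has to be followed: the square of the root tends to zero. -/
theorem tendsto_root_off_of_eq (hab : a ≤ b) {s : ℝ} (hs : s = a ∨ s = b) :
    Tendsto (fun ε => G.root a b (G.off s ε)) (𝓝[≠] 0) (𝓝 0) := by
  have h1 : Tendsto (fun ε => (G.off s ε - G.lam a) * (G.off s ε - G.lam b)) (𝓝[≠] 0)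
      (𝓝 ((G.lam s - G.lam a) * (G.lam s - G.lam b))) :=
    (((G.tendsto_off s).mono_left nhdsWithin_le_nhds).sub_const _).mul
      (((G.tendsto_off s).mono_left nhdsWithin_le_nhds).sub_const _)
  have h2 : (G.lam s - G.lam a) * (G.lam s - G.lam b) = 0 := by
    rcases hs with rfl | rfl <;> simp
  rw [h2] at h1
  have h3 : Tendsto (fun ε => G.root a b (G.off s ε) ^ 2) (𝓝[≠] 0) (𝓝 0) :=
    h1.congr' ((G.eventually_off_notMem a b s).mono fun ε h => (G.root_sq hab h).symm)
  rw [tendsto_zero_iff_norm_tendsto_zero] at h3 ⊢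
  simp_rw [norm_pow] at h3
  have h4 := (Real.continuous_sqrt.tendsto 0).comp h3
  simpa [Function.comp_def, Real.sqrt_sq (norm_nonneg _)] using h4

theorem edge_eq_zero {s : ℝ} (hs : s = a ∨ s = b) : G.edge a b s = 0 := by
  rcases hs with rfl | rfl <;> simp [edge]

theorem tendsto_root_off_gt (hab : a ≤ b) {s : ℝ} (hs : s ∈ Set.Icc a b) :
    Tendsto (fun ε => G.root a b (G.off s ε)) (𝓝[>] 0) (𝓝 (Complex.I * G.edge a b s)) := by
  have hl : 𝓝[>] (0 : ℝ) ≤ 𝓝[≠] 0 := nhdsWithin_mono _ fun x hx => ne_of_gt hx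
  by_cases he : s = a ∨ s = b
  · rw [G.edge_eq_zero he, mul_zero]
    exact (G.tendsto_root_off_of_eq hab he).mono_left hl
  push Not at he
  have hs' : s ∈ Set.Ioo a b := ⟨lt_of_le_of_ne hs.1 he.1.symm, lt_of_le_of_ne hs.2 he.2⟩
  have h := G.tendsto_root_off_of_log hab hs' hl (z := Real.pi * Complex.I) ?_
  · rwa [show (Real.pi : ℂ) * Complex.I / 2 = Real.pi / 2 * Complex.I by ring,
      Complex.exp_pi_div_two_mul_I] at h
  · have h1 := Complex.tendsto_log_nhdsWithin_im_neg_of_re_neg_of_im_zero (z := (a - s : ℝ))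
      (by simpa using hs'.1) (by simp)
    rw [Complex.norm_real, Real.norm_eq_abs, abs_of_neg (by linarith [hs'.1]), neg_sub] at h1
    refine h1.comp (tendsto_nhdsWithin_iff.2 ⟨?_, ?_⟩)
    · have h1 : Continuous fun ε : ℝ => ((a : ℂ) - s - Complex.I * ε) := by fun_prop
      simpa using (h1.tendsto 0).mono_left (nhdsWithin_le_nhds (s := Set.Ioi 0))
    · filter_upwards [self_mem_nhdsWithin] with ε hε
      simpa using hε

theorem tendsto_root_off_lt (hab : a ≤ b) {s : ℝ} (hs : s ∈ Set.Icc a b) :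
    Tendsto (fun ε => G.root a b (G.off s ε)) (𝓝[<] 0) (𝓝 (-(Complex.I * G.edge a b s))) := by
  have hl : 𝓝[<] (0 : ℝ) ≤ 𝓝[≠] 0 := nhdsWithin_mono _ fun x hx => ne_of_lt hx
  by_cases he : s = a ∨ s = b
  · rw [G.edge_eq_zero he, mul_zero, neg_zero]
    exact (G.tendsto_root_off_of_eq hab he).mono_left hl
  push Not at he
  have hs' : s ∈ Set.Ioo a b := ⟨lt_of_le_of_ne hs.1 he.1.symm, lt_of_le_of_ne hs.2 he.2⟩
  have h := G.tendsto_root_off_of_log hab hs' hl (z := -(Real.pi * Complex.I)) ?_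
  · rwa [show -((Real.pi : ℂ) * Complex.I) / 2 = -(Real.pi / 2 * Complex.I) by ring,
      Complex.exp_neg, Complex.exp_pi_div_two_mul_I, Complex.inv_I, neg_mul] at h
  · have h1 := Complex.tendsto_log_nhdsWithin_im_nonneg_of_re_neg_of_im_zero (z := (a - s : ℝ))
      (by simpa using hs'.1) (by simp)
    rw [Complex.norm_real, Real.norm_eq_abs, abs_of_neg (by linarith [hs'.1]), neg_sub] at h1
    rw [sub_neg_eq_add]
    refine h1.comp (tendsto_nhdsWithin_iff.2 ⟨?_, ?_⟩)
    · have h1 : Continuous fun ε : ℝ => ((a : ℂ) - s - Complex.I * ε) := by fun_prop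
      simpa using (h1.tendsto 0).mono_left (nhdsWithin_le_nhds (s := Set.Iio 0))
    · filter_upwards [self_mem_nhdsWithin] with ε hε
      simpa using (show ε < 0 from hε).le

end LogPath

/-! ### Jump of a Cauchy transform; the one-arc root as a Cauchy transform. -/

namespace LogPath

variable (G : LogPath) {a b : ℝ}

theorem norm_off_kernel_aux (s σ : ℝ) {ε : ℝ} (hε : ε ≠ 0) :
    (G.off s ε - G.lam σ) * (G.off s (-ε) - G.lam σ) =
      (((σ - s) ^ 2 + ε ^ 2 : ℝ) : ℂ) * (G.ratio s ε σ * G.ratio s (-ε) σ) := by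
  have h1 := G.lam_sub_off s σ hε
  have h2 := G.lam_sub_off s σ (neg_ne_zero.2 hε)
  rw [← neg_sub (G.lam σ), ← neg_sub (G.lam σ) (G.off s (-ε)), h1, h2]
  push_cast
  linear_combination -(ε ^ 2 * G.ratio s ε σ * G.ratio s (-ε) σ) * Complex.I_sq

theorem tendsto_ratio {s σ : ℝ} {l : Filter ℝ} {e : ℝ → ℝ} {p : ℝ → ℝ}
    (he : Tendsto e l (𝓝[≠] 0)) (hp : Tendsto p l (𝓝 σ)) :
    Tendsto (fun ε => G.ratio s (e ε) (p ε)) l (𝓝 (Complex.exp (G.ell σ s))) := by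
  obtain ⟨C, c, hG⟩ := G.exists_bounds (min s σ - 1) (max s σ + 1)
  have he0 : Tendsto e l (𝓝 0) := he.mono_right nhdsWithin_le_nhds
  have h1 : Tendsto (fun ε => G.ratio s (e ε) (p ε) - Complex.exp (G.ell (p ε) s)) l (𝓝 0) := by
    refine squeeze_zero_norm' (a := fun ε => C * |e ε|) ?_ ?_
    · have h2 : ∀ᶠ ε in l, p ε ∈ Set.Icc (min s σ - 1) (max s σ + 1) :=
        hp.eventually (Icc_mem_nhds (by linarith [min_le_right s σ])
          (by linarith [le_max_right s σ]))
      filter_upwards [h2, he.eventually self_mem_nhdsWithin] with ε h3 h4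
      exact hG.norm_ratio_sub_le
        ⟨by linarith [min_le_left s σ], by linarith [le_max_left s σ]⟩ h3 h4
    · simpa using (he0.abs).const_mul C
  have h2 : Tendsto (fun ε => Complex.exp (G.ell (p ε) s)) l (𝓝 (Complex.exp (G.ell σ s))) :=
    (((G.continuous_ell_comp continuous_id continuous_const).cexp.tendsto σ).comp hp)
  simpa using h1.add h2

/-- The jump of a Cauchy transform across the path. -/
theorem tendsto_cauchy_jump {α : ℝ → ℂ} (hα : Continuous α) {s : ℝ} (hs : s ∈ Set.Ioo a b) :
    Tendsto (fun ε => G.cauchy (Set.Icc a b) (fun σ => α σ * deriv G.lam σ) (G.off s ε) -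
      G.cauchy (Set.Icc a b) (fun σ => α σ * deriv G.lam σ) (G.off s (-ε))) (𝓝[>] 0)
      (𝓝 (-(2 * Real.pi * Complex.I) * α s)) := by
  obtain ⟨C, c, hG⟩ := G.exists_bounds a b
  have hαd : Continuous fun σ => α σ * deriv G.lam σ := hα.mul G.continuous_deriv
  have hl : 𝓝[>] (0 : ℝ) ≤ 𝓝[≠] 0 := nhdsWithin_mono _ fun x hx => ne_of_gt hx
  have hneg : Tendsto (fun ε : ℝ => -ε) (𝓝[>] 0) (𝓝[≠] 0) := by
    refine tendsto_nhdsWithin_iff.2 ⟨?_, ?_⟩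
    · simpa using ((continuous_neg (G := ℝ)).tendsto 0).mono_left (nhdsWithin_le_nhds (s := Set.Ioi 0))
    · filter_upwards [self_mem_nhdsWithin] with ε hε
      exact neg_ne_zero.2 (ne_of_gt hε)
  obtain ⟨M, hM⟩ := isCompact_Icc.exists_bound_of_continuousOn (s := Set.Icc a b) hαd.continuousOn
  -- The difference of the two kernels is ε/((σ − s)² + ε²) times this bounded factor. After σ = s +
  -- εu the kernel becomes 1/(1 + u²), of integral π, and the factor converges to −2i α(s).
  let F : ℝ → ℝ → ℂ := fun ε σ => (Set.Icc a b).indicator (fun σ =>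
    -(2 * Complex.I * deriv G.lam s) * (α σ * deriv G.lam σ) /
      (G.ratio s ε σ * G.ratio s (-ε) σ)) σ
  have hint : ∀ᶠ ε in 𝓝[>] (0 : ℝ), G.cauchy (Set.Icc a b) (fun σ => α σ * deriv G.lam σ) (G.off s ε) -
      G.cauchy (Set.Icc a b) (fun σ => α σ * deriv G.lam σ) (G.off s (-ε)) =
      ∫ u : ℝ, F ε (s + ε * u) * ((1 + u ^ 2 : ℝ) : ℂ)⁻¹ := by
    filter_upwards [hl (G.eventually_off_notMem a b s), hneg.eventually (G.eventually_off_notMem a b s),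
      self_mem_nhdsWithin, hl.trans nhdsWithin_le_nhds hG.eventually_small] with ε h1 h2 hε hεc
    have hε' : ε ≠ 0 := ne_of_gt hε
    have hα' : MeasureTheory.IntegrableOn (fun σ => α σ * deriv G.lam σ) (Set.Icc a b) :=
      hαd.integrableOn_Icc
    rw [cauchy, cauchy, ← MeasureTheory.integral_sub (G.integrableOn_cauchy isCompact_Icc hα' h1)
      (G.integrableOn_cauchy isCompact_Icc hα' h2)]
    let g : ℝ → ℂ := fun σ => ε * F ε σ * (((σ - s) ^ 2 + ε ^ 2 : ℝ) : ℂ)⁻¹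
    have hg : ∫ σ in Set.Icc a b, (α σ * deriv G.lam σ / (G.off s ε - G.lam σ) -
        α σ * deriv G.lam σ / (G.off s (-ε) - G.lam σ)) = ∫ σ, g σ := by
      rw [← MeasureTheory.integral_indicator measurableSet_Icc]
      congr 1
      ext σ
      by_cases hσ : σ ∈ Set.Icc a b
      · simp only [g, F, Set.indicator_of_mem hσ]
        have h3 := G.sub_lam_ne_zero h1 hσ
        have h4 := G.sub_lam_ne_zero h2 hσ
        have h5 := G.norm_off_kernel_aux s σ hε'
        rw [div_sub_div _ _ h3 h4, h5]
        have h6 := hG.ratio_ne_zero (Set.Ioo_subset_Icc_self hs) hσ hε' hεc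
        have h7 := hG.ratio_ne_zero (Set.Ioo_subset_Icc_self hs) hσ (neg_ne_zero.2 hε')
          (by rwa [abs_neg])
        have h8 : (((σ - s) ^ 2 + ε ^ 2 : ℝ) : ℂ) ≠ 0 := by
          exact_mod_cast (by positivity : (σ - s) ^ 2 + ε ^ 2 ≠ 0)
        field_simp
        simp only [off]
        push_cast
        ring
      · simp [g, F, Set.indicator_of_notMem hσ]
    rw [hg]
    have hcv : ∫ u : ℝ, g (s + ε * u) = |ε⁻¹| • ∫ σ, g σ := by
      rw [MeasureTheory.Measure.integral_comp_mul_left (fun y => g (s + y)) ε,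
        MeasureTheory.integral_add_left_eq_self g s]
    have hg2 : ∫ σ, g σ = ∫ u : ℝ, (ε : ℂ) * g (s + ε * u) := by
      rw [MeasureTheory.integral_const_mul, hcv, Complex.real_smul,
        abs_of_pos (inv_pos.2 hε), Complex.ofReal_inv,
        mul_inv_cancel_left₀ (by exact_mod_cast hε')]
    rw [hg2]
    congr 1
    ext u
    simp only [g]
    have h9 : ((1 + u ^ 2 : ℝ) : ℂ) ≠ 0 := by exact_mod_cast (by positivity : 1 + u ^ 2 ≠ 0)
    have h10 : (((s + ε * u - s) ^ 2 + ε ^ 2 : ℝ) : ℂ) = (ε : ℂ) ^ 2 * ((1 + u ^ 2 : ℝ) : ℂ) := by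
      push_cast
      ring
    have h11 : (ε : ℂ) ≠ 0 := by exact_mod_cast hε'
    rw [h10]
    field_simp
  have hlim : Tendsto (fun ε => ∫ u : ℝ, F ε (s + ε * u) * ((1 + u ^ 2 : ℝ) : ℂ)⁻¹) (𝓝[>] 0)
      (𝓝 (∫ u : ℝ, -(2 * Complex.I) * α s * ((1 + u ^ 2 : ℝ) : ℂ)⁻¹)) := by
    refine MeasureTheory.tendsto_integral_filter_of_dominated_convergence
      (fun u => (2 * ‖deriv G.lam s‖ * M / (c / 2 * (c / 2))) * (1 + u ^ 2)⁻¹) ?_ ?_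
      (integrable_inv_one_add_sq.const_mul _) ?_
    · filter_upwards with ε
      refine Measurable.aestronglyMeasurable ?_
      have hmr : ∀ e, Measurable fun σ => G.ratio s e σ := fun e => by
        unfold ratio
        exact (G.continuous_lam.measurable.sub measurable_const).div
          ((Complex.measurable_ofReal.sub measurable_const).sub measurable_const)
      have hF : Measurable (F ε) :=
        Measurable.indicator ((measurable_const.mul hαd.measurable).div
          ((hmr ε).mul (hmr (-ε)))) measurableSet_Icc
      exact (hF.comp (by fun_prop)).mul (by fun_prop)
    · filter_upwards [self_mem_nhdsWithin, hl.trans nhdsWithin_le_nhds hG.eventually_small]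
        with ε hε hεc
      have hε' : ε ≠ 0 := ne_of_gt hε
      refine Eventually.of_forall fun u => ?_
      have hc := hG.c_pos
      rw [norm_mul, norm_inv, Complex.norm_real, Real.norm_eq_abs,
        abs_of_pos (by positivity : 0 < 1 + u ^ 2)]
      refine mul_le_mul_of_nonneg_right ?_ (by positivity)
      by_cases hσ : s + ε * u ∈ Set.Icc a b
      · simp only [F, Set.indicator_of_mem hσ]
        have h6 := hG.le_norm_ratio (Set.Ioo_subset_Icc_self hs) hσ hε' hεc
        have h7 := hG.le_norm_ratio (Set.Ioo_subset_Icc_self hs) hσ (neg_ne_zero.2 hε')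
          (by rwa [abs_neg])
        rw [norm_div, norm_mul (G.ratio _ _ _), norm_mul, norm_neg, norm_mul, norm_mul,
          Complex.norm_I, Complex.norm_two, mul_one]
        have hM0 : 0 ≤ M := (norm_nonneg _).trans (hM _ hσ)
        have hM1 := hM _ hσ
        gcongr
      · simp only [F, Set.indicator_of_notMem hσ, norm_zero]
        have : 0 ≤ M := (norm_nonneg _).trans (hM s (Set.Ioo_subset_Icc_self hs))
        positivity
    · refine Eventually.of_forall fun u => ?_
      refine Tendsto.mul_const _ ?_
      have hp : Tendsto (fun ε : ℝ => s + ε * u) (𝓝[>] 0) (𝓝 s) := by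
        have h1 : Continuous fun ε : ℝ => s + ε * u := by fun_prop
        simpa using (h1.tendsto 0).mono_left (nhdsWithin_le_nhds (s := Set.Ioi 0))
      have h1 := G.tendsto_ratio (s := s) (tendsto_id'.2 hl) hp
      have h2 := G.tendsto_ratio (s := s) hneg hp
      have h3 := ((((hαd.tendsto s).comp hp).const_mul (-(2 * Complex.I * deriv G.lam s))).div
        (h1.mul h2) (mul_ne_zero (Complex.exp_ne_zero _) (Complex.exp_ne_zero _)))
      have h4 : -(2 * Complex.I * deriv G.lam s) * (α s * deriv G.lam s) /
          (Complex.exp (G.ell s s) * Complex.exp (G.ell s s)) = -(2 * Complex.I) * α s := by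
        rw [G.exp_ell_self]
        have := G.deriv_ne_zero s
        field_simp
      rw [h4] at h3
      refine h3.congr' ?_
      filter_upwards [hp.eventually (Icc_mem_nhds hs.1 hs.2)] with ε hσ
      rw [← Set.mem_Icc] at hσ
      simp only [F, Set.indicator_of_mem hσ, Function.comp_apply, id, Pi.div_apply]
  convert! hlim.congr' (hint.mono fun ε h => h.symm) using 2
  rw [MeasureTheory.integral_const_mul]
  have h1 : ∫ u : ℝ, ((1 + u ^ 2 : ℝ) : ℂ)⁻¹ = Real.pi := by
    rw [← integral_univ_inv_one_add_sq, ← integral_complex_ofReal]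
    simp
  rw [h1]
  ring

theorem edge_sq {s : ℝ} (hs : s ∈ Set.Icc a b) :
    G.edge a b s ^ 2 = -((G.lam s - G.lam a) * (G.lam s - G.lam b)) := by
  rw [edge, mul_pow, mul_pow, ← Complex.ofReal_pow, ← Complex.ofReal_pow, Real.sq_sqrt (abs_nonneg _),
    Real.sq_sqrt (abs_nonneg _), ← Complex.exp_nat_mul, abs_of_nonneg (by linarith [hs.1]),
    abs_of_nonpos (by linarith [hs.2]), ← G.exp_ell s a, ← G.exp_ell s b, G.ell_symm s a,
    G.ell_symm s b, show ((2 : ℕ) : ℂ) * ((G.ell b s + G.ell a s) / 2) = G.ell b s + G.ell a s by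
      push_cast; ring, Complex.exp_add]
  push_cast
  ring

theorem edge_ne_zero {s : ℝ} (ha : s ≠ a) (hb : s ≠ b) : G.edge a b s ≠ 0 := by
  have h1 : 0 < |s - a| := abs_pos.2 (sub_ne_zero.2 ha)
  have h2 : 0 < |s - b| := abs_pos.2 (sub_ne_zero.2 hb)
  refine mul_ne_zero (mul_ne_zero ?_ ?_) (Complex.exp_ne_zero _)
  · exact_mod_cast (Real.sqrt_pos.2 h1).ne'
  · exact_mod_cast (Real.sqrt_pos.2 h2).ne'

theorem hasDerivAt_edge {s : ℝ} (hs : s ∈ Set.Ioo a b) :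
    HasDerivAt (G.edge a b) (-((G.lam s - (G.lam a + G.lam b) / 2) * deriv G.lam s) /
      G.edge a b s) s := by
  have h0 := G.edge_ne_zero (a := a) (b := b) (ne_of_gt hs.1) (ne_of_lt hs.2)
  have h1 := hasDerivAt_of_sq (d := -((deriv G.lam s) * (G.lam s - G.lam b) +
    (G.lam s - G.lam a) * deriv G.lam s)) (G.continuous_edge a b).continuousAt h0 ?_
  · convert! h1 using 1
    field_simp
    ring
  · have h2 := (((G.hasDerivAt_lam s).sub_const (G.lam a)).mul
      ((G.hasDerivAt_lam s).sub_const (G.lam b))).neg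
    refine h2.congr_of_eventuallyEq ?_
    filter_upwards [Icc_mem_nhds hs.1 hs.2] with y hy
    exact G.edge_sq hy

/-- The first-order equation satisfied by the Cauchy transform of the edge factor. -/
theorem cauchy_edge_ode (hab : a < b) {x : ℂ} (hx : x ∉ G.lam '' Set.Icc a b) :
    (x - G.lam a) * (x - G.lam b) *
        (∫ σ in Set.Icc a b, -(G.edge a b σ * deriv G.lam σ / (x - G.lam σ) ^ 2)) -
      (x - (G.lam a + G.lam b) / 2) *
        G.cauchy (Set.Icc a b) (fun σ => G.edge a b σ * deriv G.lam σ) x =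
      -2 * ∫ σ in Set.Icc a b, G.edge a b σ * deriv G.lam σ := by
  have hE := G.continuous_edge a b
  have hc1 : ContinuousOn (fun σ => x - G.lam σ) (Set.Icc a b) :=
    continuousOn_const.sub G.continuous_lam.continuousOn
  have hne : ∀ σ ∈ Set.Icc a b, x - G.lam σ ≠ 0 := fun σ hσ => G.sub_lam_ne_zero hx hσ
  have hd := G.continuous_deriv
  have hl := G.continuous_lam
  -- D is the derivative of `edge`³ / (x − λ), which vanishes at both ends. The derivative of `edge`
  -- has `edge` in its denominator; the cube cancels this singularity.
  let D : ℝ → ℂ := fun σ =>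
    -3 * G.edge a b σ * (G.lam σ - (G.lam a + G.lam b) / 2) * deriv G.lam σ / (x - G.lam σ) -
    G.edge a b σ * ((G.lam σ - G.lam a) * (G.lam σ - G.lam b)) * deriv G.lam σ / (x - G.lam σ) ^ 2
  have hDc : ContinuousOn D (Set.Icc a b) := by
    refine ContinuousOn.sub (ContinuousOn.div (by fun_prop) hc1 hne)
      (ContinuousOn.div (by fun_prop) (hc1.pow 2) fun σ hσ => pow_ne_zero 2 (hne σ hσ))
  have hD : ∫ σ in a..b, D σ = 0 := by
    rw [intervalIntegral.integral_eq_sub_of_hasDerivAt_of_le hab.le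
      (f := fun σ => G.edge a b σ ^ 3 / (x - G.lam σ))]
    · simp [G.edge_eq_zero (Or.inl rfl : a = a ∨ a = b), G.edge_eq_zero (Or.inr rfl : b = a ∨ b = b)]
    · exact ContinuousOn.div (by fun_prop) hc1 hne
    · intro σ hσ
      have hσ' := Set.Ioo_subset_Icc_self hσ
      have h0 := G.edge_ne_zero (a := a) (b := b) (ne_of_gt hσ.1) (ne_of_lt hσ.2)
      have h1 := ((G.hasDerivAt_edge hσ).pow 3).div ((G.hasDerivAt_lam σ).const_sub x) (hne σ hσ')
      convert! h1 using 1
      have h2 := G.edge_sq hσ'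
      have h3 := hne σ hσ'
      simp only [D, Pi.pow_apply]
      field_simp
      push_cast
      linear_combination (-2 * G.edge a b σ ^ 2 * deriv G.lam σ) * h2
    · refine ContinuousOn.intervalIntegrable ?_
      rwa [Set.uIcc_of_le hab.le]
  rw [intervalIntegral.integral_of_le hab.le, ← MeasureTheory.integral_Icc_eq_integral_Ioc] at hD
  have hi1 : MeasureTheory.IntegrableOn
      (fun σ => -(G.edge a b σ * deriv G.lam σ / (x - G.lam σ) ^ 2)) (Set.Icc a b) :=
    (ContinuousOn.neg (ContinuousOn.div (by fun_prop) (hc1.pow 2)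
      fun σ hσ => pow_ne_zero 2 (hne σ hσ))).integrableOn_Icc
  have hi2 : MeasureTheory.IntegrableOn
      (fun σ => G.edge a b σ * deriv G.lam σ / (x - G.lam σ)) (Set.Icc a b) :=
    (ContinuousOn.div (by fun_prop) hc1 hne).integrableOn_Icc
  have hi3 : MeasureTheory.IntegrableOn
      (fun σ => G.edge a b σ * deriv G.lam σ) (Set.Icc a b) :=
    (hE.mul hd).integrableOn_Icc
  have hkey : ∫ σ in Set.Icc a b, D σ = ∫ σ in Set.Icc a b,
      ((x - G.lam a) * (x - G.lam b) * -(G.edge a b σ * deriv G.lam σ / (x - G.lam σ) ^ 2) -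
      (x - (G.lam a + G.lam b) / 2) * (G.edge a b σ * deriv G.lam σ / (x - G.lam σ)) +
      2 * (G.edge a b σ * deriv G.lam σ)) := by
    refine MeasureTheory.setIntegral_congr_fun measurableSet_Icc fun σ hσ => ?_
    have h3 := hne σ hσ
    simp only [D]
    field_simp
    ring
  have hi12 : MeasureTheory.IntegrableOn (fun σ =>
      (x - G.lam a) * (x - G.lam b) * -(G.edge a b σ * deriv G.lam σ / (x - G.lam σ) ^ 2) -
      (x - (G.lam a + G.lam b) / 2) * (G.edge a b σ * deriv G.lam σ / (x - G.lam σ)))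
      (Set.Icc a b) := (hi1.const_mul _).sub (hi2.const_mul _)
  rw [hkey, MeasureTheory.integral_add hi12 (hi3.const_mul _),
    MeasureTheory.integral_sub (hi1.const_mul _) (hi2.const_mul _),
    MeasureTheory.integral_const_mul, MeasureTheory.integral_const_mul,
    MeasureTheory.integral_const_mul] at hD
  rw [cauchy]
  linear_combination hD

theorem isOpen_compl_arc (a b : ℝ) : IsOpen (G.lam '' Set.Icc a b)ᶜ :=
  (isCompact_Icc.image G.continuous_lam).isClosed.isOpen_compl

theorem isPreconnected_compl_arc (a b : ℝ) : IsPreconnected (G.lam '' Set.Icc a b)ᶜ := by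
  have := isPreconnected_compl_arcs (ι := Unit) G.continuous_lam G.injective_lam
    (fun _ => a) (fun _ => b) (fun i j h => absurd (Subsingleton.elim i j) h)
  rwa [Set.iUnion_const] at this

/-- The square root attached to one arc is the sum of a polynomial and a Cauchy transform. -/
theorem root_eq_sub_cauchy (hab : a < b) {x : ℂ} (hx : x ∉ G.lam '' Set.Icc a b) :
    G.root a b x = x - (G.lam a + G.lam b) / 2 - (1 / Real.pi) *
      G.cauchy (Set.Icc a b) (fun σ => G.edge a b σ * deriv G.lam σ) x := by
  set α : ℝ → ℂ := fun σ => G.edge a b σ * deriv G.lam σ with hα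
  set d : ℂ := (G.lam a + G.lam b) / 2 with hd
  have hαc : Continuous α := (G.continuous_edge a b).mul G.continuous_deriv
  have hαi : MeasureTheory.IntegrableOn α (Set.Icc a b) := hαc.integrableOn_Icc
  have hne : G.lam a - G.lam b ≠ 0 := G.lam_sub_ne_zero hab.ne
  set M₀ : ℂ := ∫ σ in Set.Icc a b, α σ with hM₀
  -- With this constant κ(x − d) solves the same inhomogeneous equation as the Cauchy transform. The
  -- difference then solves the homogeneous equation satisfied by the root, so their quotient is
  -- constant on the connected complement of the arc.
  set κ : ℂ := 8 * M₀ / (G.lam a - G.lam b) ^ 2 with hκ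
  have hderiv : ∀ y ∈ (G.lam '' Set.Icc a b)ᶜ,
      HasDerivAt (fun z => (G.cauchy (Set.Icc a b) α z - κ * (z - d)) / G.root a b z) 0 y := by
    intro y hy
    have h1 := G.hasDerivAt_cauchy isCompact_Icc hαi hy
    have h2 := (((hasDerivAt_id y).sub_const d).const_mul κ)
    have h3 := (h1.sub h2).div (G.hasDerivAt_root hab.le hy) (G.root_ne_zero hab.le hy)
    convert! h3 using 1
    have h4 := G.cauchy_edge_ode hab hy
    have h5 := G.root_sq hab.le hy
    have h6 := G.root_ne_zero hab.le hy
    rw [← h5] at h4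
    have h7 : κ * (G.lam a - G.lam b) ^ 2 = 8 * M₀ := by
      rw [hκ]
      field_simp
    have h8 : G.root a b y ^ 2 = (y - d) ^ 2 - (G.lam a - G.lam b) ^ 2 / 4 := by
      rw [h5, hd]
      ring
    have h9 : ∀ u v : ℂ, (u * G.root a b y - v * ((y - d) / G.root a b y)) =
        (u * G.root a b y ^ 2 - v * (y - d)) / G.root a b y := by
      intro u v
      field_simp
    rw [eq_comm, div_eq_zero_iff]
    left
    simp only [Pi.sub_apply, id, mul_one]
    rw [h9, div_eq_zero_iff]
    left
    linear_combination h4 - κ * h8 + h7 / 4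
  have hconst : ∃ k : ℂ, ∀ y ∈ (G.lam '' Set.Icc a b)ᶜ,
      (G.cauchy (Set.Icc a b) α y - κ * (y - d)) / G.root a b y = k := by
    refine (G.isOpen_compl_arc a b).exists_is_const_of_deriv_eq_zero
      (G.isPreconnected_compl_arc a b)
      (fun y hy => (hderiv y hy).differentiableAt.differentiableWithinAt)
      (fun y hy => (hderiv y hy).deriv)
  obtain ⟨k, hk⟩ := hconst
  have hb : (G.lam '' Set.Icc a b)ᶜ ∈ Bornology.cobounded ℂ :=
    Bornology.isBounded_def.1 (isCompact_Icc.image G.continuous_lam).isBounded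
  -- At infinity the Cauchy transform vanishes and the root is asymptotic to x − d.
  have hkκ : k = -κ := by
    have h1 : Tendsto (fun y => (G.cauchy (Set.Icc a b) α y - κ * (y - d)) / G.root a b y)
        (Bornology.cobounded ℂ) (𝓝 k) :=
      tendsto_const_nhds.congr' (by filter_upwards [hb] with y hy using (hk y hy).symm)
    refine tendsto_nhds_unique h1 ?_
    have h2 : Tendsto (fun x : ℂ => x - d) (Bornology.cobounded ℂ) (Bornology.cobounded ℂ) := by
      refine tendsto_norm_atTop_iff_cobounded.1 ?_
      refine tendsto_atTop_mono (fun x => norm_sub_norm_le x d) ?_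
      exact tendsto_atTop_add_const_right _ (-‖d‖) tendsto_norm_cobounded_atTop
    have h3 := (((G.tendsto_cauchy isCompact_Icc hαi).mul
      (tendsto_inv₀_cobounded.comp h2)).sub_const κ).div (G.tendsto_root_div (a := a) (b := b) d)
      one_ne_zero
    rw [zero_mul, zero_sub, div_one] at h3
    refine h3.congr' ?_
    filter_upwards [hb, h2.eventually (Bornology.eventually_ne_cobounded 0)] with y hy hy2
    have h6 := G.root_ne_zero hab.le hy
    simp only [Function.comp_apply, Pi.div_apply]
    field_simp
  have hK : ∀ y ∈ (G.lam '' Set.Icc a b)ᶜ,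
      G.cauchy (Set.Icc a b) α y = κ * (y - d - G.root a b y) := by
    intro y hy
    have h1 := hk y hy
    rw [div_eq_iff (G.root_ne_zero hab.le hy), hkκ] at h1
    linear_combination h1
  -- The jump across an interior point of the arc is −2πi times `edge` for the Cauchy transform and
  -- 2i times `edge` for the root.
  have hκπ : κ = Real.pi := by
    clear_value κ
    obtain ⟨s, hs⟩ : (Set.Ioo a b).Nonempty := Set.nonempty_Ioo.2 hab
    have hs' := Set.Ioo_subset_Icc_self hs
    have hl : 𝓝[>] (0 : ℝ) ≤ 𝓝[≠] 0 := nhdsWithin_mono _ fun x hx => ne_of_gt hx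
    have hneg : Tendsto (fun ε : ℝ => -ε) (𝓝[>] 0) (𝓝[<] 0) := by
      simpa using tendsto_neg_nhdsGT (a := (0 : ℝ))
    have hl' : 𝓝[<] (0 : ℝ) ≤ 𝓝[≠] 0 := nhdsWithin_mono _ fun x hx => ne_of_lt hx
    have h1 := G.tendsto_cauchy_jump (G.continuous_edge a b) hs
    have h2 := G.tendsto_root_off_gt hab.le hs'
    have h3 := (G.tendsto_root_off_lt hab.le hs').comp hneg
    have h4 := ((((G.tendsto_off s).mono_left (hl.trans nhdsWithin_le_nhds)).sub_const d).sub
      h2).const_mul κ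
    have h5 := (((((G.tendsto_off s).mono_left (hl'.trans nhdsWithin_le_nhds)).comp hneg).sub_const
      d).sub h3).const_mul κ
    have h6 := tendsto_nhds_unique h1 ((h4.sub h5).congr' ?_)
    · have h7 := G.edge_ne_zero (a := a) (b := b) (ne_of_gt hs.1) (ne_of_lt hs.2)
      have h8 : (2 * Complex.I * G.edge a b s) * κ = (2 * Complex.I * G.edge a b s) * Real.pi := by
        linear_combination h6
      exact mul_left_cancel₀ (mul_ne_zero (mul_ne_zero two_ne_zero Complex.I_ne_zero) h7) h8
    · filter_upwards [hl (G.eventually_off_notMem a b s),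
        hneg.eventually (hl' (G.eventually_off_notMem a b s))] with ε h7 h8
      rw [hK _ h7, hK _ h8]
      rfl
  rw [hK x hx, hκπ]
  have : (Real.pi : ℂ) ≠ 0 := by exact_mod_cast Real.pi_ne_zero
  field_simp
  ring

end LogPath

/-! ### Products of square roots attached to disjoint arcs. -/

namespace LogPath

variable (G : LogPath) {T S : Set ℝ} {α β γ : ℝ → ℂ}

/-- By induction it suffices to multiply by x, and x/(x − λ) = 1 + λ/(x − λ): each step moves x into
the density and leaves a constant. -/
theorem exists_eval_mul_cauchy (hT : IsCompact T) (hα : ContinuousOn α T) (p : ℂ[X]) :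
    ∃ q : ℂ[X], ∀ x ∉ G.lam '' T, p.eval x * G.cauchy T α x =
      q.eval x + G.cauchy T (fun σ => α σ * p.eval (G.lam σ)) x := by
  have hl := G.continuous_lam
  have hX : ∀ β : ℝ → ℂ, ContinuousOn β T → ∃ c : ℂ, ∀ x ∉ G.lam '' T,
      x * G.cauchy T β x = c + G.cauchy T (fun σ => β σ * G.lam σ) x := by
    intro β hβ
    refine ⟨∫ σ in T, β σ, fun x hx => ?_⟩
    have h1 : MeasureTheory.IntegrableOn β T := hβ.integrableOn_compact hT
    have h2 : MeasureTheory.IntegrableOn (fun σ => β σ * G.lam σ) T :=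
      (hβ.mul hl.continuousOn).integrableOn_compact hT
    rw [cauchy, cauchy, ← MeasureTheory.integral_add h1 (G.integrableOn_cauchy hT h2 hx),
      ← MeasureTheory.integral_const_mul]
    refine MeasureTheory.setIntegral_congr_fun hT.measurableSet fun σ hσ => ?_
    have := G.sub_lam_ne_zero hx hσ
    field_simp
    ring
  induction p using Polynomial.induction_on with
  | C c =>
    refine ⟨0, fun x _ => ?_⟩
    simp only [eval_C, eval_zero, zero_add, cauchy]
    rw [← MeasureTheory.integral_const_mul]
    congr 1
    ext σ
    ring
  | add p q hp hq =>
    obtain ⟨p', hp⟩ := hp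
    obtain ⟨q', hq⟩ := hq
    refine ⟨p' + q', fun x hx => ?_⟩
    have h1 : ∀ r : ℂ[X], MeasureTheory.IntegrableOn
        (fun σ => α σ * r.eval (G.lam σ) / (x - G.lam σ)) T := fun r =>
      G.integrableOn_cauchy hT ((hα.mul
        (r.continuous.comp hl).continuousOn).integrableOn_compact hT) hx
    have h2 : G.cauchy T (fun σ => α σ * (p + q).eval (G.lam σ)) x =
        G.cauchy T (fun σ => α σ * p.eval (G.lam σ)) x +
        G.cauchy T (fun σ => α σ * q.eval (G.lam σ)) x := by
      simp only [cauchy]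
      rw [← MeasureTheory.integral_add (h1 p) (h1 q)]
      congr 1
      ext σ
      rw [eval_add]
      ring
    rw [h2, eval_add, eval_add, add_mul, hp x hx, hq x hx]
    ring
  | monomial n c h =>
    obtain ⟨q, hq⟩ := h
    obtain ⟨d, hd⟩ := hX (fun σ => α σ * (C c * X ^ n : ℂ[X]).eval (G.lam σ))
      (hα.mul (((C c * X ^ n : ℂ[X]).continuous).comp hl).continuousOn)
    refine ⟨X * q + C d, fun x hx => ?_⟩
    have h1 := hq x hx
    have h2 := hd x hx
    have h3 : (C c * X ^ (n + 1) : ℂ[X]).eval x = x * (C c * X ^ n : ℂ[X]).eval x := by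
      simp
      ring
    rw [h3, mul_assoc, h1, mul_add, h2]
    simp only [eval_add, eval_mul, eval_X, eval_C, add_assoc]
    congr 2
    simp only [cauchy, eval_pow, eval_X]
    congr 1
    ext σ
    ring

theorem continuousOn_cauchy_lam (hT : IsCompact T) (hα : ContinuousOn α T)
    (hTS : Disjoint T S) : ContinuousOn (fun σ => G.cauchy T α (G.lam σ)) S := by
  refine (G.continuousOn_cauchy hT (hα.integrableOn_compact hT)).comp
    G.continuous_lam.continuousOn fun σ hσ h => ?_
  obtain ⟨τ, hτ, h⟩ := h
  rw [G.injective_lam h] at hτ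
  exact Set.disjoint_left.1 hTS hτ hσ

/-- Partial fractions: 1/((x − u)(x − v)) splits into 1/((x − u)(u − v)) and 1/((x − v)(v − u)).
Disjointness of T and S keeps u − v away from zero, so Fubini applies without principal values. -/
theorem cauchy_mul_cauchy (hT : IsCompact T) (hS : IsCompact S) (hα : ContinuousOn α T)
    (hβ : ContinuousOn β S) (hTS : Disjoint T S) {x : ℂ} (hxT : x ∉ G.lam '' T)
    (hxS : x ∉ G.lam '' S) :
    G.cauchy T α x * G.cauchy S β x =
      G.cauchy T (fun σ => α σ * G.cauchy S β (G.lam σ)) x +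
      G.cauchy S (fun σ => β σ * G.cauchy T α (G.lam σ)) x := by
  have hl := G.continuous_lam
  have hne : ∀ σ ∈ T, ∀ τ ∈ S, G.lam σ - G.lam τ ≠ 0 := fun σ hσ τ hτ =>
    G.lam_sub_ne_zero fun h => Set.disjoint_left.1 hTS hσ (h ▸ hτ)
  have hprod : MeasureTheory.Integrable (Function.uncurry fun σ τ =>
      β τ * α σ / ((x - G.lam τ) * (G.lam τ - G.lam σ)))
      ((MeasureTheory.volume.restrict T).prod (MeasureTheory.volume.restrict S)) := by
    rw [MeasureTheory.Measure.prod_restrict]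
    refine ContinuousOn.integrableOn_compact (hT.prod hS) ?_
    refine ContinuousOn.div ?_ (by fun_prop) ?_
    · exact (hβ.comp continuousOn_snd fun q hq => hq.2).mul
        (hα.comp continuousOn_fst fun q hq => hq.1)
    · rintro ⟨σ, τ⟩ ⟨hσ, hτ⟩
      exact mul_ne_zero (G.sub_lam_ne_zero hxS hτ) (by
        rw [← neg_sub]
        exact neg_ne_zero.2 (hne σ hσ τ hτ))
  have h1 : G.cauchy S (fun σ => β σ * G.cauchy T α (G.lam σ)) x =
      ∫ σ in T, ∫ τ in S, β τ * α σ / ((x - G.lam τ) * (G.lam τ - G.lam σ)) := by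
    rw [MeasureTheory.integral_integral_swap hprod, cauchy]
    congr 1
    ext τ
    rw [cauchy, ← MeasureTheory.integral_const_mul, ← MeasureTheory.integral_div]
    congr 1
    ext σ
    rw [mul_div_assoc', div_div, mul_comm (G.lam τ - G.lam σ)]
  have h2 : G.cauchy T α x * G.cauchy S β x =
      ∫ σ in T, (α σ * G.cauchy S β (G.lam σ) / (x - G.lam σ) +
        ∫ τ in S, β τ * α σ / ((x - G.lam τ) * (G.lam τ - G.lam σ))) := by
    rw [cauchy, ← MeasureTheory.integral_mul_const]
    refine MeasureTheory.setIntegral_congr_fun hT.measurableSet fun σ hσ => ?_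
    have hi1 : MeasureTheory.IntegrableOn
        (fun τ => α σ / (x - G.lam σ) * (β τ / (G.lam σ - G.lam τ))) S :=
      (ContinuousOn.mul continuousOn_const (hβ.div (by fun_prop)
        fun τ hτ => hne σ hσ τ hτ)).integrableOn_compact hS
    have hi2 : MeasureTheory.IntegrableOn
        (fun τ => β τ * α σ / ((x - G.lam τ) * (G.lam τ - G.lam σ))) S := by
      refine (ContinuousOn.div (hβ.mul continuousOn_const) (by fun_prop)
        fun τ hτ => ?_).integrableOn_compact hS
      exact mul_ne_zero (G.sub_lam_ne_zero hxS hτ) (by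
        rw [← neg_sub]
        exact neg_ne_zero.2 (hne σ hσ τ hτ))
    have h3 : α σ * G.cauchy S β (G.lam σ) / (x - G.lam σ) =
        ∫ τ in S, α σ / (x - G.lam σ) * (β τ / (G.lam σ - G.lam τ)) := by
      rw [MeasureTheory.integral_const_mul, cauchy]
      ring
    simp only [h3]
    rw [← MeasureTheory.integral_add hi1 hi2, cauchy, ← MeasureTheory.integral_const_mul]
    refine MeasureTheory.setIntegral_congr_fun hS.measurableSet fun τ hτ => ?_
    have e1 := G.sub_lam_ne_zero hxT hσ
    have e2 := G.sub_lam_ne_zero hxS hτ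
    have e3 := hne σ hσ τ hτ
    have e4 : G.lam τ - G.lam σ ≠ 0 := by
      rw [← neg_sub]
      exact neg_ne_zero.2 e3
    rw [show G.lam τ - G.lam σ = -(G.lam σ - G.lam τ) by ring]
    field_simp
    ring
  rw [h2, MeasureTheory.integral_add, h1]
  · rfl
  · refine G.integrableOn_cauchy hT ?_ hxT
    exact (hα.mul (G.continuousOn_cauchy_lam hS hβ hTS.symm)).integrableOn_compact hT
  · exact hprod.integral_prod_left

/-- The product of two functions of the form `polynomial + Cauchy transform` is of this form. -/
theorem exists_mul_rep (hT : IsCompact T) (hS : IsCompact S) (hα : ContinuousOn α T)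
    (hβ : ContinuousOn β S) (hTS : Disjoint T S) (p q : ℂ[X])
    (hγ₁ : ∀ σ ∈ T, γ σ = α σ * (q.eval (G.lam σ) + G.cauchy S β (G.lam σ)))
    (hγ₂ : ∀ σ ∈ S, γ σ = β σ * (p.eval (G.lam σ) + G.cauchy T α (G.lam σ))) :
    ContinuousOn γ (T ∪ S) ∧ ∃ r : ℂ[X], ∀ x ∉ G.lam '' (T ∪ S),
      (p.eval x + G.cauchy T α x) * (q.eval x + G.cauchy S β x) =
        r.eval x + G.cauchy (T ∪ S) γ x := by
  have hl := G.continuous_lam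
  have hp := p.continuous.comp hl
  have hq := q.continuous.comp hl
  have c1 := G.continuousOn_cauchy_lam hS hβ hTS.symm
  have c2 := G.continuousOn_cauchy_lam hT hα hTS
  have d1 : ContinuousOn γ T := (hα.mul (hq.continuousOn.add c1)).congr hγ₁
  have d2 : ContinuousOn γ S := (hβ.mul (hp.continuousOn.add c2)).congr hγ₂
  refine ⟨d1.union_of_isClosed d2 hT.isClosed hS.isClosed, ?_⟩
  obtain ⟨r₁, hr₁⟩ := G.exists_eval_mul_cauchy hT hα q
  obtain ⟨r₂, hr₂⟩ := G.exists_eval_mul_cauchy hS hβ p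
  refine ⟨p * q + r₁ + r₂, fun x hx => ?_⟩
  have hxT : x ∉ G.lam '' T := fun h => hx (Set.image_mono Set.subset_union_left h)
  have hxS : x ∉ G.lam '' S := fun h => hx (Set.image_mono Set.subset_union_right h)
  have h1 : G.cauchy (T ∪ S) γ x = G.cauchy T γ x + G.cauchy S γ x :=
    MeasureTheory.setIntegral_union hTS hS.measurableSet
      (G.integrableOn_cauchy hT (d1.integrableOn_compact hT) hxT)
      (G.integrableOn_cauchy hS (d2.integrableOn_compact hS) hxS)
  have h2 : G.cauchy T γ x = G.cauchy T (fun σ => α σ * q.eval (G.lam σ)) x +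
      G.cauchy T (fun σ => α σ * G.cauchy S β (G.lam σ)) x := by
    have i1 : MeasureTheory.IntegrableOn (fun σ => α σ * q.eval (G.lam σ)) T :=
      (hα.mul hq.continuousOn).integrableOn_compact hT
    have i2 : MeasureTheory.IntegrableOn (fun σ => α σ * G.cauchy S β (G.lam σ)) T :=
      (hα.mul c1).integrableOn_compact hT
    rw [cauchy, cauchy, cauchy, ← MeasureTheory.integral_add (G.integrableOn_cauchy hT i1 hxT)
      (G.integrableOn_cauchy hT i2 hxT)]
    refine MeasureTheory.setIntegral_congr_fun hT.measurableSet fun σ hσ => ?_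
    rw [hγ₁ σ hσ]
    ring
  have h3 : G.cauchy S γ x = G.cauchy S (fun σ => β σ * p.eval (G.lam σ)) x +
      G.cauchy S (fun σ => β σ * G.cauchy T α (G.lam σ)) x := by
    have i1 : MeasureTheory.IntegrableOn (fun σ => β σ * p.eval (G.lam σ)) S :=
      (hβ.mul hp.continuousOn).integrableOn_compact hS
    have i2 : MeasureTheory.IntegrableOn (fun σ => β σ * G.cauchy T α (G.lam σ)) S :=
      (hβ.mul c2).integrableOn_compact hS
    rw [cauchy, cauchy, cauchy, ← MeasureTheory.integral_add (G.integrableOn_cauchy hS i1 hxS)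
      (G.integrableOn_cauchy hS i2 hxS)]
    refine MeasureTheory.setIntegral_congr_fun hS.measurableSet fun σ hσ => ?_
    rw [hγ₂ σ hσ]
    ring
  rw [h1, h2, h3, eval_add, eval_add, eval_mul]
  linear_combination hr₁ x hxT + hr₂ x hxS + G.cauchy_mul_cauchy hT hS hα hβ hTS hxT hxS

/-- A product of square roots attached to disjoint arcs is the sum of a polynomial and of the
Cauchy transform of its jump. -/
theorem exists_prod_root_rep {ι : Type*} [DecidableEq ι] {a b : ι → ℝ} (hab : ∀ i, a i < b i)
    (hdis : Pairwise fun i j => Disjoint (Set.Icc (a i) (b i)) (Set.Icc (a j) (b j)))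
    (J : Finset ι) :
    ∃ γ : ℝ → ℂ, ContinuousOn γ (⋃ i ∈ J, Set.Icc (a i) (b i)) ∧
      (∀ i ∈ J, ∀ σ ∈ Set.Icc (a i) (b i), γ σ = -(1 / Real.pi) * (G.edge (a i) (b i) σ *
        deriv G.lam σ * ∏ j ∈ J.erase i, G.root (a j) (b j) (G.lam σ))) ∧
      ∃ p : ℂ[X], ∀ x ∉ G.lam '' (⋃ i ∈ J, Set.Icc (a i) (b i)),
        ∏ i ∈ J, G.root (a i) (b i) x =
          p.eval x + G.cauchy (⋃ i ∈ J, Set.Icc (a i) (b i)) γ x := by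
  induction J using Finset.induction_on with
  | empty => exact ⟨0, by simp, by simp, 1, by simp [cauchy]⟩
  | insert k J hk ih =>
    obtain ⟨γ, hγ, hγJ, p, hp⟩ := ih
    have hT : IsCompact (⋃ i ∈ J, Set.Icc (a i) (b i)) :=
      J.isCompact_biUnion fun i _ => isCompact_Icc
    set T := ⋃ i ∈ J, Set.Icc (a i) (b i) with hTdef
    have hTk : Disjoint (Set.Icc (a k) (b k)) T := by
      rw [hTdef, Set.disjoint_iUnion₂_right]
      intro i hi
      exact hdis fun h => hk (h ▸ hi)
    have hne : ∀ σ ∈ Set.Icc (a k) (b k), G.lam σ ∉ G.lam '' T := by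
      rintro σ hσ ⟨τ, hτ, h⟩
      rw [G.injective_lam h] at hτ
      exact Set.disjoint_left.1 hTk hσ hτ
    have hne' : ∀ σ ∈ T, G.lam σ ∉ G.lam '' Set.Icc (a k) (b k) := by
      rintro σ hσ ⟨τ, hτ, h⟩
      rw [G.injective_lam h] at hτ
      exact Set.disjoint_left.1 hTk hτ hσ
    let α : ℝ → ℂ := fun σ => -(1 / Real.pi) * (G.edge (a k) (b k) σ * deriv G.lam σ)
    have hα : Continuous α :=
      continuous_const.mul ((G.continuous_edge _ _).mul G.continuous_deriv)
    let q : ℂ[X] := X - C ((G.lam (a k) + G.lam (b k)) / 2)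
    have hroot : ∀ x ∉ G.lam '' Set.Icc (a k) (b k), G.root (a k) (b k) x =
        q.eval x + G.cauchy (Set.Icc (a k) (b k)) α x := by
      intro x hx
      rw [G.root_eq_sub_cauchy (hab k) hx]
      have h1 : q.eval x = x - (G.lam (a k) + G.lam (b k)) / 2 := by simp [q]
      simp only [h1, α, cauchy, mul_div_assoc, MeasureTheory.integral_const_mul]
      ring
    classical
    -- Only one factor jumps at a given arc, so the new density is the old one times the new root on
    -- T, and the new one times the old product on the added arc.
    let δ : ℝ → ℂ := fun σ => if σ ∈ T then γ σ * G.root (a k) (b k) (G.lam σ) else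
      α σ * ∏ j ∈ J, G.root (a j) (b j) (G.lam σ)
    have hδT : ∀ σ ∈ T, δ σ = γ σ * G.root (a k) (b k) (G.lam σ) := fun σ hσ => by
      simp only [δ, if_pos hσ]
    have hδk : ∀ σ ∈ Set.Icc (a k) (b k), δ σ =
        α σ * ∏ j ∈ J, G.root (a j) (b j) (G.lam σ) := fun σ hσ => by
      simp only [δ, if_neg fun h => Set.disjoint_left.1 hTk hσ h]
    obtain ⟨h1, r, h2⟩ := G.exists_mul_rep (γ := δ) hT isCompact_Icc hγ hα.continuousOn
      hTk.symm p q (fun σ hσ => by rw [hδT σ hσ, hroot _ (hne' σ hσ)])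
      (fun σ hσ => by rw [hδk σ hσ, hp _ (hne σ hσ)])
    have hU : ⋃ i ∈ insert k J, Set.Icc (a i) (b i) = T ∪ Set.Icc (a k) (b k) := by
      rw [Finset.set_biUnion_insert, Set.union_comm]
    rw [hU]
    refine ⟨δ, h1, ?_, r, fun x hx => ?_⟩
    · intro i hi σ hσ
      rcases Finset.mem_insert.1 hi with rfl | hi
      · rw [hδk σ hσ, Finset.erase_insert hk]
        ring
      · have hik : i ≠ k := fun h => hk (h ▸ hi)
        rw [hδT σ (Set.mem_biUnion hi hσ), hγJ i hi σ hσ, Finset.erase_insert_of_ne hik.symm,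
          Finset.prod_insert (by simp [hk])]
        ring
    · have hxT : x ∉ G.lam '' T := fun h => hx (Set.image_mono Set.subset_union_left h)
      have hxS : x ∉ G.lam '' Set.Icc (a k) (b k) := fun h =>
        hx (Set.image_mono Set.subset_union_right h)
      rw [← h2 x hx, Finset.prod_insert hk, hp x hxT, hroot x hxS, mul_comm]

end LogPath

/-! ### Behaviour at infinity, and the explicit spectral density. -/

theorem Polynomial.tendsto_eval_div_pow (p : ℂ[X]) {n : ℕ} (hn : p.natDegree ≤ n) :
    Tendsto (fun x => p.eval x / x ^ n) (Bornology.cobounded ℂ) (𝓝 (p.coeff n)) := by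
  have h1 : ∀ k ∈ Finset.range (n + 1), Tendsto (fun x : ℂ => p.coeff k * (x⁻¹) ^ (n - k))
      (Bornology.cobounded ℂ) (𝓝 (p.coeff k * 0 ^ (n - k))) := fun k _ =>
    (tendsto_inv₀_cobounded.pow _).const_mul _
  have h2 := tendsto_finsetSum _ h1
  have h3 : ∑ k ∈ Finset.range (n + 1), p.coeff k * 0 ^ (n - k) = p.coeff n := by
    rw [Finset.sum_range_succ, Finset.sum_eq_zero, zero_add, Nat.sub_self, pow_zero, mul_one]
    intro k hk
    rw [zero_pow (Nat.sub_ne_zero_of_lt (Finset.mem_range.1 hk)), mul_zero]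
  rw [h3] at h2
  refine h2.congr' ?_
  filter_upwards [Bornology.eventually_ne_cobounded (0 : ℂ)] with x hx
  rw [Polynomial.eval_eq_sum_range' (Nat.lt_succ_of_le hn), Finset.sum_div]
  refine Finset.sum_congr rfl fun k hk => ?_
  have hk' : k ≤ n := Nat.lt_succ_iff.1 (Finset.mem_range.1 hk)
  rw [inv_pow, mul_div_assoc]
  congr 1
  rw [eq_div_iff (pow_ne_zero _ hx), inv_mul_eq_div, div_eq_iff (pow_ne_zero _ hx), ← pow_add,
    Nat.add_sub_cancel' hk']

theorem Polynomial.eq_zero_of_tendsto_zero {p : ℂ[X]}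
    (h : Tendsto (fun x => p.eval x) (Bornology.cobounded ℂ) (𝓝 0)) : p = 0 := by
  have h1 := (p.tendsto_eval_div_pow le_rfl)
  have h2 : Tendsto (fun x => p.eval x / x ^ p.natDegree) (Bornology.cobounded ℂ) (𝓝 0) := by
    have h3 := h.mul (tendsto_inv₀_cobounded.pow p.natDegree)
    rw [zero_mul] at h3
    simpa [div_eq_mul_inv] using h3
  have h3 := tendsto_nhds_unique h1 h2
  exact Polynomial.leadingCoeff_eq_zero.1 h3

namespace SpectralCurve

variable {m : ℕ} {W : ℂ[X]} (Γ : SpectralCurve m W)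

/-- The path of a curve with cuts. -/
noncomputable def path : LogPath where
  lam := Γ.lam
  ell := Γ.logQuot
  contDiff_lam := Γ.contDiff_lam
  continuous_ell := Γ.continuous_logQuot
  exp_ell := Γ.exp_logQuot

/-- The parameters of the points on the cuts. -/
def cuts : Set ℝ := ⋃ i, Set.Icc (Γ.left i) (Γ.right i)

theorem isCompact_cuts : IsCompact Γ.cuts := isCompact_iUnion fun _ => isCompact_Icc

theorem image_cuts : ⋃ i, Γ.lam '' Set.Icc (Γ.left i) (Γ.right i) = Γ.path.lam '' Γ.cuts := by
  rw [cuts, Set.image_iUnion]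
  rfl

theorem mem_cuts {s : ℝ} {i : Fin (m + 1)} (hs : s ∈ Set.Icc (Γ.left i) (Γ.right i)) :
    s ∈ Γ.cuts := Set.mem_iUnion.2 ⟨i, hs⟩

theorem disjoint_cuts : Pairwise fun i j =>
    Disjoint (Set.Icc (Γ.left i) (Γ.right i)) (Set.Icc (Γ.left j) (Γ.right j)) := by
  have key : ∀ i j, i < j →
      Disjoint (Set.Icc (Γ.left i) (Γ.right i)) (Set.Icc (Γ.left j) (Γ.right j)) := by
    intro i j hij
    rw [Set.disjoint_left]
    intro s h1 h2
    linarith [h1.2, h2.1, Γ.right_lt_left i j hij]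
  intro i j hij
  rcases lt_or_gt_of_ne hij with h | h
  · exact key i j h
  · exact (key j i h).symm

/-- The square roots attached to the cuts. -/
noncomputable def root (i : Fin (m + 1)) (x : ℂ) : ℂ := Γ.path.root (Γ.left i) (Γ.right i) x

/-- The edge factors attached to the cuts. -/
noncomputable def edge (i : Fin (m + 1)) (s : ℝ) : ℂ := Γ.path.edge (Γ.left i) (Γ.right i) s

theorem notMem_arc {x : ℂ} (hx : x ∉ Γ.path.lam '' Γ.cuts) (i : Fin (m + 1)) :
    x ∉ Γ.path.lam '' Set.Icc (Γ.left i) (Γ.right i) :=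
  fun h => hx (Set.image_mono (Set.subset_iUnion _ i) h)

theorem sq_prod_root {x : ℂ} (hx : x ∉ Γ.path.lam '' Γ.cuts) :
    (∏ i, Γ.root i x) ^ 2 = (derivative W ^ 2 + Γ.f).eval x := by
  rw [Γ.branch_points, ← Finset.prod_pow, Polynomial.eval_prod]
  refine Finset.prod_congr rfl fun i _ => ?_
  rw [root, Γ.path.root_sq (Γ.left_lt_right i).le (Γ.notMem_arc hx i)]
  simp [path]

theorem isOpen_compl_cuts : IsOpen (Γ.path.lam '' Γ.cuts)ᶜ :=
  (Γ.isCompact_cuts.image Γ.path.continuous_lam).isClosed.isOpen_compl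

theorem compl_cuts_mem_cobounded : (Γ.path.lam '' Γ.cuts)ᶜ ∈ Bornology.cobounded ℂ :=
  Bornology.isBounded_def.1 (Γ.isCompact_cuts.image Γ.path.continuous_lam).isBounded

theorem natDegree_derivative (hdeg : W.natDegree = m + 2) :
    (derivative W).natDegree ≤ m + 1 := by
  have := W.natDegree_derivative_le
  omega

theorem coeff_derivative_top (hdeg : W.natDegree = m + 2)
    (hlead : W.leadingCoeff = 1 / ((m : ℂ) + 2)) : (derivative W).coeff (m + 1) = 1 := by
  rw [Polynomial.coeff_derivative]
  have h1 : W.coeff (m + 1 + 1) = 1 / ((m : ℂ) + 2) := by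
    rw [← hlead, Polynomial.leadingCoeff, hdeg]
  have h2 : (m : ℂ) + 2 ≠ 0 := by exact_mod_cast (by omega : m + 2 ≠ 0)
  rw [h1]
  push_cast
  field_simp
  ring

theorem tendsto_y₀_div (hdeg : W.natDegree = m + 2)
    (hlead : W.leadingCoeff = 1 / ((m : ℂ) + 2)) :
    Tendsto (fun x => Γ.y₀ x / x ^ (m + 1)) (Bornology.cobounded ℂ) (𝓝 1) := by
  have h1 := (derivative W).tendsto_eval_div_pow (natDegree_derivative hdeg)
  rw [coeff_derivative_top hdeg hlead] at h1
  have h2 := Γ.y₀_asymptotic.mul h1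
  rw [one_mul] at h2
  refine h2.congr' ?_
  filter_upwards [h1.eventually_ne one_ne_zero] with x hx
  have : (derivative W).eval x ≠ 0 := fun h => hx (by rw [h, zero_div])
  field_simp

/-- Two continuous square roots of one nowhere vanishing function on a connected set agree up to a
global sign, and the asymptotics at infinity exclude the minus sign. -/
theorem y₀_eq_prod_root (hdeg : W.natDegree = m + 2)
    (hlead : W.leadingCoeff = 1 / ((m : ℂ) + 2)) {x : ℂ} (hx : x ∉ Γ.path.lam '' Γ.cuts) :
    Γ.y₀ x = ∏ i, Γ.root i x := by
  have hY : ContinuousOn (fun x => ∏ i, Γ.root i x) (Γ.path.lam '' Γ.cuts)ᶜ := by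
    refine continuousOn_finsetProd _ fun i _ => ?_
    exact Γ.path.continuousOn_root.mono fun y hy => Γ.notMem_arc hy i
  have hY0 : ∀ {y}, y ∈ (Γ.path.lam '' Γ.cuts)ᶜ → (∏ i, Γ.root i y) ≠ 0 := fun {y} hy =>
    Finset.prod_ne_zero_iff.2 fun i _ =>
      Γ.path.root_ne_zero (Γ.left_lt_right i).le (Γ.notMem_arc hy i)
  have hconn : IsPreconnected (Γ.path.lam '' Γ.cuts)ᶜ := by
    rw [← Γ.image_cuts]
    exact isPreconnected_compl_arcs Γ.contDiff_lam.continuous Γ.injective_lam _ _ Γ.disjoint_cuts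
  have hy : ContinuousOn Γ.y₀ (Γ.path.lam '' Γ.cuts)ᶜ := by
    rw [← Γ.image_cuts]
    exact Γ.differentiableOn_y₀.continuousOn
  have hsq : Set.EqOn (Γ.y₀ ^ 2) ((fun x => ∏ i, Γ.root i x) ^ 2) (Γ.path.lam '' Γ.cuts)ᶜ := by
    intro y hy
    have h1 := Γ.sq_y₀ y (by rwa [Γ.image_cuts])
    simp only [Pi.pow_apply]
    rw [h1, Γ.sq_prod_root hy]
  have hYinf : Tendsto (fun x => (∏ i, Γ.root i x) / x ^ (m + 1)) (Bornology.cobounded ℂ)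
      (𝓝 1) := by
    have h1 : ∀ i ∈ (Finset.univ : Finset (Fin (m + 1))),
        Tendsto (fun x => Γ.root i x / (x - 0)) (Bornology.cobounded ℂ) (𝓝 1) := fun i _ =>
      Γ.path.tendsto_root_div 0
    have h2 := tendsto_finsetProd _ h1
    simpa [Finset.prod_div_distrib] using h2
  rcases hconn.eq_or_eq_neg_of_sq_eq hy hY hsq hY0 with h | h
  · exact h hx
  · exfalso
    have h1 := Γ.tendsto_y₀_div hdeg hlead
    have h2 : Tendsto (fun x => Γ.y₀ x / x ^ (m + 1)) (Bornology.cobounded ℂ) (𝓝 (-1)) := by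
      refine hYinf.neg.congr' ?_
      filter_upwards [Γ.compl_cuts_mem_cobounded] with y hy
      rw [h hy, Pi.neg_apply, neg_div]
    have h3 := tendsto_nhds_unique h1 h2
    norm_num at h3

theorem t_ne_zero : Γ.t ≠ 0 := by
  rw [t, div_ne_zero_iff]
  refine ⟨neg_ne_zero.2 ?_, by norm_num⟩
  rw [Polynomial.leadingCoeff_ne_zero]
  rintro h
  have := Γ.degree_f
  rw [h, Polynomial.degree_zero] at this
  exact absurd this (by simp)

theorem natDegree_f : Γ.f.natDegree = m := Polynomial.natDegree_eq_of_degree_eq_some Γ.degree_f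

/-- (W' − y₀)(W' + y₀) = −f, whose leading coefficient is 4t, while W' + y₀ is asymptotic to
2x^(m+1). -/
theorem tendsto_mul_sub_y₀ (hdeg : W.natDegree = m + 2)
    (hlead : W.leadingCoeff = 1 / ((m : ℂ) + 2)) :
    Tendsto (fun x => x * ((derivative W).eval x - Γ.y₀ x)) (Bornology.cobounded ℂ)
      (𝓝 (2 * Γ.t)) := by
  have h1 := (derivative W).tendsto_eval_div_pow (natDegree_derivative hdeg)
  rw [coeff_derivative_top hdeg hlead] at h1
  have h2 := h1.add (Γ.tendsto_y₀_div hdeg hlead)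
  have h3 := Γ.f.tendsto_eval_div_pow Γ.natDegree_f.le
  have h4 := (h3.div h2 (by norm_num : (1 + 1 : ℂ) ≠ 0)).neg
  have h5 : -(Γ.f.coeff m / (1 + 1)) = 2 * Γ.t := by
    rw [t, Polynomial.leadingCoeff, Γ.natDegree_f]
    ring
  rw [h5] at h4
  refine h4.congr' ?_
  filter_upwards [Γ.compl_cuts_mem_cobounded, h2.eventually_ne (by norm_num : (1 + 1 : ℂ) ≠ 0),
    Bornology.eventually_ne_cobounded (0 : ℂ)] with x hx hx2 hx0
  have h6 := Γ.sq_y₀ x (by rwa [Γ.image_cuts])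
  rw [eval_add, eval_pow] at h6
  simp only [Pi.div_apply]
  rw [← add_div] at hx2 ⊢
  have h7 : (derivative W).eval x + Γ.y₀ x ≠ 0 := fun h => hx2 (by rw [h, zero_div])
  have h8 : Γ.f.eval x = -(((derivative W).eval x - Γ.y₀ x) *
      ((derivative W).eval x + Γ.y₀ x)) := by
    linear_combination -h6
  rw [h8, pow_succ]
  field_simp

/-- The sign of the density on the `i`-th cut. -/
def sign (i : Fin (m + 1)) : ℂ := ∏ j ∈ Finset.univ.erase i, if j < i then 1 else -1

/-- The smooth factor of the density. -/
noncomputable def amplitude (s : ℝ) : ℂ :=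
  1 / (2 * Real.pi) * deriv Γ.lam s * ∏ i, Γ.edge i s

/-- The function equal to the sign of the density on each cut and to zero elsewhere. -/
noncomputable def signFun (s : ℝ) : ℂ :=
  ∑ i, (Set.Icc (Γ.left i) (Γ.right i)).indicator (fun _ => sign i) s

/-- The density normalised to have total mass `t`, in explicit form. -/
noncomputable def mass (s : ℝ) : ℂ := Γ.signFun s * Γ.amplitude s

theorem continuous_amplitude : Continuous Γ.amplitude :=
  (continuous_const.mul Γ.path.continuous_deriv).mul
    (continuous_finsetProd _ fun _ _ => Γ.path.continuous_edge _ _)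

theorem signFun_of_mem {s : ℝ} {i : Fin (m + 1)} (hs : s ∈ Set.Icc (Γ.left i) (Γ.right i)) :
    Γ.signFun s = sign i := by
  rw [signFun, Finset.sum_eq_single i, Set.indicator_of_mem hs]
  · intro j _ hj
    exact Set.indicator_of_notMem (fun h => Set.disjoint_left.1 (Γ.disjoint_cuts hj) h hs) _
  · simp

theorem signFun_of_notMem {s : ℝ} (hs : s ∉ Γ.cuts) : Γ.signFun s = 0 := by
  rw [signFun]
  refine Finset.sum_eq_zero fun i _ => Set.indicator_of_notMem (fun h => hs (Γ.mem_cuts h)) _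

theorem measurable_signFun : Measurable Γ.signFun :=
  Finset.measurable_fun_sum _ fun _ _ => measurable_const.indicator measurableSet_Icc

theorem mass_of_notMem {s : ℝ} (hs : s ∉ Γ.cuts) : Γ.mass s = 0 := by
  rw [mass, Γ.signFun_of_notMem hs, zero_mul]

theorem measurable_mass : Measurable Γ.mass :=
  Γ.measurable_signFun.mul Γ.continuous_amplitude.measurable

theorem continuousOn_mass : ContinuousOn Γ.mass Γ.cuts := by
  refine (locallyFinite_of_finite _).continuousOn_iUnion (fun i => isClosed_Icc) fun i => ?_
  refine ContinuousOn.congr (f := fun s => sign i * Γ.amplitude s)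
    (continuous_const.mul Γ.continuous_amplitude).continuousOn fun s hs => ?_
  rw [mass, Γ.signFun_of_mem hs]

/-- On the i-th cut the other roots take the values ± `edge` according to whether their cut comes
earlier or later, which is the content of `sign`. In this form the mass is visibly a multiple of the
jump of the product of the roots. -/
theorem mass_of_mem {s : ℝ} {i : Fin (m + 1)} (hs : s ∈ Set.Icc (Γ.left i) (Γ.right i)) :
    Γ.mass s = 1 / (2 * Real.pi) * (Γ.edge i s * deriv Γ.lam s *
      ∏ j ∈ Finset.univ.erase i, Γ.root j (Γ.lam s)) := by
  have h1 : ∏ j ∈ Finset.univ.erase i, Γ.root j (Γ.lam s) =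
      sign i * ∏ j ∈ Finset.univ.erase i, Γ.edge j s := by
    rw [sign, ← Finset.prod_mul_distrib]
    refine Finset.prod_congr rfl fun j hj => ?_
    rcases lt_or_gt_of_ne (Finset.ne_of_mem_erase hj) with h | h
    · rw [if_pos h, one_mul]
      exact Γ.path.root_lam_of_gt (Γ.left_lt_right j).le
        ((Γ.right_lt_left j i h).trans_le hs.1)
    · rw [if_neg (not_lt.2 h.le), neg_one_mul]
      exact Γ.path.root_lam_of_lt (Γ.left_lt_right j).le
        (hs.2.trans_lt (Γ.right_lt_left i j h))
  rw [mass, Γ.signFun_of_mem hs, amplitude, h1,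
    ← Finset.mul_prod_erase Finset.univ (fun i => Γ.edge i s) (Finset.mem_univ i)]
  ring

/-- The product of the roots is a polynomial plus the Cauchy transform of −2 `mass`. The polynomial
must be W', since W' − y₀ and the Cauchy transform both vanish at infinity. -/
theorem y₀_eq_sub_cauchy (hdeg : W.natDegree = m + 2)
    (hlead : W.leadingCoeff = 1 / ((m : ℂ) + 2)) {x : ℂ} (hx : x ∉ Γ.path.lam '' Γ.cuts) :
    Γ.y₀ x = (derivative W).eval x - 2 * Γ.path.cauchy Γ.cuts Γ.mass x := by
  obtain ⟨γ, hγ, hγ2, p, hp⟩ := Γ.path.exists_prod_root_rep Γ.left_lt_right Γ.disjoint_cuts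
    Finset.univ
  have hU : ⋃ i ∈ (Finset.univ : Finset (Fin (m + 1))), Set.Icc (Γ.left i) (Γ.right i) =
      Γ.cuts := by
    simp [cuts]
  rw [hU] at hγ hp
  have hγm : ∀ s ∈ Γ.cuts, γ s = -2 * Γ.mass s := by
    intro s hs
    obtain ⟨i, hi⟩ := Set.mem_iUnion.1 hs
    rw [hγ2 i (Finset.mem_univ i) s hi, Γ.mass_of_mem hi]
    have : (Real.pi : ℂ) ≠ 0 := by exact_mod_cast Real.pi_ne_zero
    simp only [edge, root, path]
    field_simp
  have hcauchy : ∀ z, Γ.path.cauchy Γ.cuts γ z = -2 * Γ.path.cauchy Γ.cuts Γ.mass z := by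
    intro z
    rw [LogPath.cauchy, LogPath.cauchy, ← MeasureTheory.integral_const_mul]
    refine MeasureTheory.setIntegral_congr_fun Γ.isCompact_cuts.measurableSet fun s hs => ?_
    simp only [hγm s hs]
    ring
  have hrep : ∀ z ∉ Γ.path.lam '' Γ.cuts, Γ.y₀ z =
      p.eval z - 2 * Γ.path.cauchy Γ.cuts Γ.mass z := by
    intro z hz
    have h1 := hp z hz
    rw [hcauchy] at h1
    rw [Γ.y₀_eq_prod_root hdeg hlead hz]
    simp only [root]
    rw [h1]
    ring
  have hi := Γ.continuousOn_mass.integrableOn_compact Γ.isCompact_cuts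
    (μ := MeasureTheory.volume)
  have hpW : p - derivative W = 0 := by
    apply Polynomial.eq_zero_of_tendsto_zero
    have h1 := (Γ.tendsto_mul_sub_y₀ hdeg hlead).mul tendsto_inv₀_cobounded
    have h2 := ((Γ.path.tendsto_cauchy Γ.isCompact_cuts hi).const_mul 2).sub h1
    rw [mul_zero, mul_zero, sub_zero] at h2
    refine h2.congr' ?_
    filter_upwards [Γ.compl_cuts_mem_cobounded, Bornology.eventually_ne_cobounded (0 : ℂ)]
      with z hz hz0
    rw [eval_sub, hrep z hz]
    field_simp
    ring
  rw [hrep x hx, sub_eq_zero.1 hpW]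

theorem integrableOn_mass : MeasureTheory.IntegrableOn Γ.mass Γ.cuts :=
  Γ.continuousOn_mass.integrableOn_compact Γ.isCompact_cuts

/-- Both sides are the coefficient of 1/x at infinity of (W' − y₀)/2. -/
theorem integral_mass (hdeg : W.natDegree = m + 2)
    (hlead : W.leadingCoeff = 1 / ((m : ℂ) + 2)) : ∫ s in Γ.cuts, Γ.mass s = Γ.t := by
  have h1 := Γ.path.tendsto_mul_cauchy Γ.isCompact_cuts Γ.integrableOn_mass
  have h2 := (Γ.tendsto_mul_sub_y₀ hdeg hlead).div_const 2
  refine tendsto_nhds_unique h1 ?_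
  rw [mul_div_cancel_left₀ _ (two_ne_zero' ℂ)] at h2
  refine h2.congr' ?_
  filter_upwards [Γ.compl_cuts_mem_cobounded] with z hz
  rw [Γ.y₀_eq_sub_cauchy hdeg hlead hz]
  ring

theorem eventually_off_notMem_cuts (s : ℝ) :
    ∀ᶠ ε in 𝓝[≠] (0 : ℝ), Γ.path.off s ε ∉ Γ.path.lam '' Γ.cuts := by
  have h1 := eventually_all.2 fun i => Γ.path.eventually_off_notMem (Γ.left i) (Γ.right i) s
  filter_upwards [h1] with ε hε
  rw [← Γ.image_cuts]
  simpa [path] using hε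

theorem tendsto_y₀_off_aux (hdeg : W.natDegree = m + 2)
    (hlead : W.leadingCoeff = 1 / ((m : ℂ) + 2)) {s : ℝ} {i : Fin (m + 1)}
    (hs : s ∈ Set.Icc (Γ.left i) (Γ.right i)) {l : Filter ℝ} (hl : l ≤ 𝓝[≠] 0) {c : ℂ}
    (h : Tendsto (fun ε => Γ.root i (Γ.path.off s ε)) l (𝓝 (c * Γ.edge i s))) :
    Tendsto (fun ε => Γ.y₀ (Γ.path.off s ε)) l
      (𝓝 (c * (2 * Real.pi * Γ.mass s / deriv Γ.lam s))) := by
  have h1 : Tendsto (fun ε => ∏ j ∈ Finset.univ.erase i, Γ.root j (Γ.path.off s ε)) l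
      (𝓝 (∏ j ∈ Finset.univ.erase i, Γ.root j (Γ.path.lam s))) := by
    refine tendsto_finsetProd _ fun j hj => ?_
    have h2 : Γ.path.lam s ∉ Γ.path.lam '' Set.Icc (Γ.left j) (Γ.right j) := by
      rintro ⟨τ, hτ, h⟩
      rw [Γ.path.injective_lam h] at hτ
      exact Set.disjoint_left.1 (Γ.disjoint_cuts (Finset.ne_of_mem_erase hj)) hτ hs
    exact (Γ.path.continuousAt_root h2).tendsto.comp
      ((Γ.path.tendsto_off s).mono_left (hl.trans nhdsWithin_le_nhds))
  have h2 := h.mul h1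
  have h3 : c * Γ.edge i s * ∏ j ∈ Finset.univ.erase i, Γ.root j (Γ.path.lam s) =
      c * (2 * Real.pi * Γ.mass s / deriv Γ.lam s) := by
    rw [Γ.mass_of_mem hs]
    have : (Real.pi : ℂ) ≠ 0 := by exact_mod_cast Real.pi_ne_zero
    have h4 := Γ.deriv_lam_ne_zero s
    simp only [path]
    field_simp
  rw [h3] at h2
  refine h2.congr' ?_
  filter_upwards [(Γ.eventually_off_notMem_cuts s).filter_mono hl] with ε hε
  rw [Γ.y₀_eq_prod_root hdeg hlead hε,
    Finset.mul_prod_erase Finset.univ (fun i => Γ.root i (Γ.path.off s ε)) (Finset.mem_univ i)]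

theorem tendsto_y₀_off_gt (hdeg : W.natDegree = m + 2)
    (hlead : W.leadingCoeff = 1 / ((m : ℂ) + 2)) {s : ℝ} (hs : s ∈ Γ.cuts) :
    Tendsto (fun ε => Γ.y₀ (Γ.path.off s ε)) (𝓝[>] 0)
      (𝓝 (Complex.I * (2 * Real.pi * Γ.mass s / deriv Γ.lam s))) := by
  obtain ⟨i, hi⟩ := Set.mem_iUnion.1 hs
  exact Γ.tendsto_y₀_off_aux hdeg hlead hi (nhdsWithin_mono _ fun x hx => ne_of_gt hx)
    (Γ.path.tendsto_root_off_gt (Γ.left_lt_right i).le hi)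

theorem tendsto_y₀_off_lt (hdeg : W.natDegree = m + 2)
    (hlead : W.leadingCoeff = 1 / ((m : ℂ) + 2)) {s : ℝ} (hs : s ∈ Γ.cuts) :
    Tendsto (fun ε => Γ.y₀ (Γ.path.off s (-ε))) (𝓝[>] 0)
      (𝓝 (-Complex.I * (2 * Real.pi * Γ.mass s / deriv Γ.lam s))) := by
  obtain ⟨i, hi⟩ := Set.mem_iUnion.1 hs
  have h1 := Γ.path.tendsto_root_off_lt (Γ.left_lt_right i).le hi
  rw [← neg_mul] at h1
  have hneg : Tendsto (fun ε : ℝ => -ε) (𝓝[>] 0) (𝓝[<] 0) := by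
    simpa using tendsto_neg_nhdsGT (a := (0 : ℝ))
  exact (Γ.tendsto_y₀_off_aux hdeg hlead hi (nhdsWithin_mono _ fun x hx => ne_of_lt hx)
    h1).comp hneg

theorem discontinuity_eq (s ε : ℝ) : Γ.discontinuity s ε =
    deriv Γ.lam s * (1 / (2 * (Real.pi : ℂ) * Complex.I)) *
      (Γ.resolvent (Γ.path.off s (-ε)) - Γ.resolvent (Γ.path.off s ε)) := by
  have h1 : Γ.path.off s (-ε) = Γ.lam s - Complex.I * ε * deriv Γ.lam s := by
    simp only [LogPath.off, path]
    push_cast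
    ring
  rw [h1]
  rfl

/-- On a cut, end points included, the one-sided limits of y₀ are opposite and W' does not jump; off
the cuts y₀ is continuous and both sides are zero. This identifies the density at every point, not
only almost everywhere. -/
theorem tendsto_discontinuity_mass (hdeg : W.natDegree = m + 2)
    (hlead : W.leadingCoeff = 1 / ((m : ℂ) + 2)) (s : ℝ) :
    Tendsto (Γ.discontinuity s) (𝓝[>] 0) (𝓝 (Γ.mass s / Γ.t)) := by
  have ht := Γ.t_ne_zero
  have hπ : (Real.pi : ℂ) ≠ 0 := by exact_mod_cast Real.pi_ne_zero
  have hd := Γ.deriv_lam_ne_zero s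
  have hneg : Tendsto (fun ε : ℝ => -ε) (𝓝[>] 0) (𝓝 0) := by
    simpa using ((continuous_neg (G := ℝ)).tendsto 0).mono_left
      (nhdsWithin_le_nhds (s := Set.Ioi 0))
  have o1 := (Γ.path.tendsto_off s).mono_left (nhdsWithin_le_nhds (s := Set.Ioi 0))
  have o2 := (Γ.path.tendsto_off s).comp hneg
  have w1 := ((derivative W).continuous.tendsto _).comp o1
  have w2 := ((derivative W).continuous.tendsto _).comp o2
  have key : ∀ v₁ v₂ : ℂ, Tendsto (fun ε => Γ.y₀ (Γ.path.off s ε)) (𝓝[>] 0) (𝓝 v₁) →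
      Tendsto (fun ε => Γ.y₀ (Γ.path.off s (-ε))) (𝓝[>] 0) (𝓝 v₂) →
      deriv Γ.lam s * (1 / (2 * (Real.pi : ℂ) * Complex.I)) * ((v₁ - v₂) / (2 * Γ.t)) =
        Γ.mass s / Γ.t →
      Tendsto (Γ.discontinuity s) (𝓝[>] 0) (𝓝 (Γ.mass s / Γ.t)) := by
    intro v₁ v₂ h1 h2 h3
    have h4 := (((w2.sub h2).div_const (2 * Γ.t)).sub ((w1.sub h1).div_const (2 * Γ.t))).const_mul
      (deriv Γ.lam s * (1 / (2 * (Real.pi : ℂ) * Complex.I)))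
    rw [← sub_div, sub_sub_sub_cancel_left, h3] at h4
    refine h4.congr fun ε => ?_
    rw [discontinuity_eq]
    rfl
  by_cases hs : s ∈ Γ.cuts
  · refine key _ _ (Γ.tendsto_y₀_off_gt hdeg hlead hs) (Γ.tendsto_y₀_off_lt hdeg hlead hs) ?_
    have := Complex.I_ne_zero
    field_simp
    ring
  · have h1 : Γ.path.lam s ∈ (Γ.path.lam '' Γ.cuts)ᶜ := by
      rintro ⟨τ, hτ, h⟩
      rw [Γ.path.injective_lam h] at hτ
      exact hs hτ
    have h2 : ContinuousAt Γ.y₀ (Γ.path.lam s) := by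
      have := Γ.differentiableOn_y₀.continuousOn
      rw [Γ.image_cuts] at this
      exact this.continuousAt (Γ.isOpen_compl_cuts.mem_nhds h1)
    refine key _ _ (h2.tendsto.comp o1) (h2.tendsto.comp o2) ?_
    rw [Γ.mass_of_notMem hs]
    simp

theorem density_eq (hdeg : W.natDegree = m + 2)
    (hlead : W.leadingCoeff = 1 / ((m : ℂ) + 2)) (s : ℝ) : Γ.density s = Γ.mass s / Γ.t :=
  (Γ.tendsto_discontinuity_mass hdeg hlead s).limUnder_eq

end SpectralCurve

/-! ### The principal value kernel and its regularisation. -/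

/-- The regularisation `a / (a² + ε²)` of `1 / a`. -/
noncomputable def regInv (ε a : ℝ) : ℝ := a / (a ^ 2 + ε ^ 2)

theorem regInv_neg (ε a : ℝ) : regInv ε (-a) = -regInv ε a := by
  simp [regInv, neg_div]

theorem measurable_regInv (ε : ℝ) : Measurable (regInv ε) := by
  unfold regInv
  fun_prop

theorem continuous_regInv {ε : ℝ} (hε : ε ≠ 0) : Continuous (regInv ε) := by
  unfold regInv
  exact continuous_id.div (by fun_prop) fun a => by positivity

theorem abs_mul_abs_regInv_le (ε a : ℝ) : |a| * |regInv ε a| ≤ 1 := by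
  rw [regInv, abs_div, mul_div_assoc', ← sq, sq_abs]
  refine div_le_one_of_le₀ ?_ (abs_nonneg _)
  exact (le_add_of_nonneg_right (sq_nonneg ε)).trans (le_abs_self _)

theorem tendsto_regInv (a : ℝ) : Tendsto (fun ε => regInv ε a) (𝓝[>] 0) (𝓝 a⁻¹) := by
  by_cases ha : a = 0
  · subst ha
    simp [regInv]
  · have h1 : Tendsto (fun ε : ℝ => a / (a ^ 2 + ε ^ 2)) (𝓝 0) (𝓝 (a / (a ^ 2 + 0 ^ 2))) := by
      have : ContinuousAt (fun ε : ℝ => a / (a ^ 2 + ε ^ 2)) 0 :=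
        continuousAt_const.div (by fun_prop) (by positivity)
      exact this
    have h2 : a / (a ^ 2 + 0 ^ 2) = a⁻¹ := by
      field_simp
      ring
    rw [h2] at h1
    exact h1.mono_left nhdsWithin_le_nhds

theorem regInv_eq (a : ℝ) {ε : ℝ} (hε : ε ≠ 0) : (regInv ε a : ℂ) =
    (1 / ((a : ℂ) + Complex.I * ε) + 1 / ((a : ℂ) - Complex.I * ε)) / 2 := by
  have h1 := sub_I_mul_ne_zero a hε
  have h2 := sub_I_mul_ne_zero a (neg_ne_zero.2 hε)
  have h2' : (a : ℂ) + Complex.I * ε ≠ 0 := by simpa using h2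
  have h3 : ((a : ℂ) + Complex.I * ε) * ((a : ℂ) - Complex.I * ε) = (a : ℂ) ^ 2 + ε ^ 2 := by
    linear_combination -(ε : ℂ) ^ 2 * Complex.I_sq
  rw [div_add_div _ _ h2' h1, h3, regInv]
  have h4 : (a : ℂ) ^ 2 + ε ^ 2 ≠ 0 := h3 ▸ mul_ne_zero h2' h1
  push_cast
  field_simp
  ring

theorem integral_regInv (s₁ s₂ s' : ℝ) {ε : ℝ} (hε : ε ≠ 0) :
    ∫ s in s₁..s₂, regInv ε (s - s') =
      Real.log ((s₂ - s') ^ 2 + ε ^ 2) / 2 - Real.log ((s₁ - s') ^ 2 + ε ^ 2) / 2 := by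
  refine intervalIntegral.integral_eq_sub_of_hasDerivAt
    (f := fun s => Real.log ((s - s') ^ 2 + ε ^ 2) / 2) (fun s _ => ?_) ?_
  · have h0 : (s - s') ^ 2 + ε ^ 2 ≠ 0 := by positivity
    have h1 := (((((hasDerivAt_id s).sub_const s').pow 2).add_const (ε ^ 2)).log h0).div_const 2
    convert! h1 using 1
    simp [regInv]
    field_simp
  · exact ((continuous_regInv hε).comp (by fun_prop)).intervalIntegrable _ _

/-- A majorant independent of ε and locally integrable in a, for passing to the limit in the
regularised logarithm. -/
theorem abs_log_sq_add_sq_le (a : ℝ) (ha : a ≠ 0) {ε : ℝ} (hε : |ε| ≤ 1) :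
    |Real.log (a ^ 2 + ε ^ 2) / 2| ≤ |(Real.log |a|)| + (a ^ 2 + 1) := by
  have ha2 : 0 < a ^ 2 := by positivity
  have hε2 : ε ^ 2 ≤ 1 := by
    rw [← sq_abs]
    exact pow_le_one₀ (abs_nonneg _) hε
  have h1 : Real.log |a| = Real.log (a ^ 2) / 2 := by
    rw [Real.log_abs, Real.log_pow]
    push_cast
    ring
  have h2 : Real.log (a ^ 2) ≤ Real.log (a ^ 2 + ε ^ 2) :=
    Real.log_le_log ha2 (by nlinarith [sq_nonneg ε])
  have h3 : Real.log (a ^ 2 + ε ^ 2) ≤ Real.log (a ^ 2 + 1) :=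
    Real.log_le_log (by positivity) (by linarith)
  have h4 : Real.log (a ^ 2 + 1) ≤ a ^ 2 + 1 := (Real.log_le_sub_one_of_pos (by positivity)).trans
    (by linarith)
  rw [h1, abs_le]
  have h5 := neg_abs_le (Real.log (a ^ 2) / 2)
  have h6 := abs_nonneg (Real.log (a ^ 2) / 2)
  constructor <;> linarith

theorem tendsto_log_sq_add_sq (a : ℝ) (ha : a ≠ 0) :
    Tendsto (fun ε : ℝ => Real.log (a ^ 2 + ε ^ 2) / 2) (𝓝[>] 0) (𝓝 (Real.log |a|)) := by
  have h1 : ContinuousAt (fun ε : ℝ => Real.log (a ^ 2 + ε ^ 2) / 2) 0 :=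
    (ContinuousAt.log (by fun_prop) (by positivity)).div_const 2
  have h2 : Real.log (a ^ 2 + 0 ^ 2) / 2 = Real.log |a| := by
    rw [Real.log_abs, zero_pow two_ne_zero, add_zero, Real.log_pow]
    push_cast
    ring
  have h3 := h1.tendsto
  rw [h2] at h3
  exact h3.mono_left nhdsWithin_le_nhds

theorem integrableOn_log_abs_sub (A B : ℝ) (s : ℝ) :
    MeasureTheory.IntegrableOn (fun s' => Real.log |s - s'|) (Set.Icc A B) := by
  rcases le_total A B with h | h
  · have h1 : IntervalIntegrable (fun x => Real.log (x - s)) MeasureTheory.volume A B := by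
      simpa using (intervalIntegral.intervalIntegrable_log' (a := A - s) (b := B - s)).comp_sub_right s
    rw [integrableOn_Icc_iff_integrableOn_Ioc,
      ← intervalIntegrable_iff_integrableOn_Ioc_of_le h]
    refine h1.congr fun x _ => ?_
    rw [← Real.log_abs, abs_sub_comm]
  · rcases h.eq_or_lt with h | h
    · subst h
      simp
    · rw [Set.Icc_eq_empty (not_le.2 h)]
      simp

/-- On the square all differences lie in [A − B, B − A], so the function is the integrand of a
convolution of two integrable functions: an indicator and a truncated logarithm. -/
theorem integrable_log_abs_sub_prod (A B : ℝ) :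
    MeasureTheory.IntegrableOn (fun q : ℝ × ℝ => Real.log |q.1 - q.2|)
      (Set.Icc A B ×ˢ Set.Icc A B) := by
  let R := B - A
  have hg : MeasureTheory.Integrable ((Set.Icc (-R) R).indicator fun x => Real.log |0 - x|) :=
    (integrableOn_log_abs_sub (-R) R 0).integrable_indicator measurableSet_Icc
  have hf : MeasureTheory.Integrable ((Set.Icc A B).indicator fun _ : ℝ => (1 : ℝ)) :=
    (MeasureTheory.integrableOn_const (by simp)).integrable_indicator measurableSet_Icc
  have h1 := hf.convolution_integrand (ContinuousLinearMap.mul ℝ ℝ) hg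
  refine (h1.integrableOn (s := Set.Icc A B ×ˢ Set.Icc A B)).congr_fun ?_
    (measurableSet_Icc.prod measurableSet_Icc)
  rintro ⟨s, s'⟩ ⟨hs, hs'⟩
  simp only [Set.mem_Icc] at hs hs'
  have h2 : s - s' ∈ Set.Icc (-R) R := by
    constructor <;> simp only [R] <;> linarith
  simp only [Set.indicator_of_mem (show s' ∈ Set.Icc A B from hs'), Set.indicator_of_mem h2,
    ContinuousLinearMap.mul_apply', one_mul, zero_sub, abs_neg]

namespace LogPath

variable (G : LogPath) {T : Set ℝ} {A B C c : ℝ}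

/-- The regular part of the kernel `λ'(s) / (λ(s) - λ(s'))`. -/
noncomputable def regPart (s s' : ℝ) : ℂ :=
  deriv G.lam s / (G.lam s - G.lam s') - 1 / ((s : ℂ) - s')

theorem regPart_self (s : ℝ) : G.regPart s s = 0 := by simp [regPart]

theorem measurable_regPart : Measurable fun q : ℝ × ℝ => G.regPart q.1 q.2 := by
  have h1 := G.continuous_lam.measurable
  have h2 := G.continuous_deriv.measurable
  unfold regPart
  fun_prop

/-- The symmetrised Cauchy kernel minus its singular part. -/
noncomputable def regKernel (s s' ε : ℝ) : ℂ :=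
  deriv G.lam s * (1 / (G.off s ε - G.lam s') + 1 / (G.off s (-ε) - G.lam s')) / 2 -
    (regInv ε (s - s') : ℂ)

variable {G} in
-- Over the common denominator (s' − s − iε)² the difference has a numerator of size O(|s' − s|²),
-- so subtracting the flat kernel removes the singularity uniformly in ε.
theorem Bounds.norm_kernel_sub_le (hG : G.Bounds A B C c) {s s' : ℝ} (hs : s ∈ Set.Icc A B)
    (hs' : s' ∈ Set.Icc A B) {ε : ℝ} (hε : ε ≠ 0) (hεc : C * |ε| ≤ c / 2) :
    ‖deriv G.lam s / (G.off s ε - G.lam s') - 1 / ((s : ℂ) - s' + Complex.I * ε)‖ ≤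
      2 * C / c := by
  have h0 := den_ne_zero s' s hε
  have hr := hG.ratio_ne_zero hs hs' hε hεc
  have hrc := hG.le_norm_ratio hs hs' hε hεc
  have hden : (s : ℂ) - s' + Complex.I * ε = -((s' : ℂ) - s - Complex.I * ε) := by ring
  have h1 : G.off s ε - G.lam s' = -((s' : ℂ) - s - Complex.I * ε) * G.ratio s ε s' := by
    rw [neg_mul, ← G.lam_sub_off s s' hε, neg_sub]
  have h2 := G.ratio_sub s s' hε
  rw [eq_div_iff h0] at h2
  have h3 : deriv G.lam s / (G.off s ε - G.lam s') - 1 / ((s : ℂ) - s' + Complex.I * ε) =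
      -((deriv G.lam s - Complex.exp (G.ell s' s)) * ((s' : ℂ) - s)) /
        (((s' : ℂ) - s - Complex.I * ε) * ((s' : ℂ) - s - Complex.I * ε) * G.ratio s ε s') := by
    rw [h1, hden]
    field_simp
    linear_combination h2
  have hle := abs_le_norm_sub_I_mul (s' - s) ε
  rw [Complex.ofReal_sub] at hle
  have hlip := hG.lip s' hs' s hs
  have hc := hG.c_pos
  have hC := hG.C_pos
  have hpos : 0 < ‖(s' : ℂ) - s - Complex.I * ε‖ := norm_pos_iff.2 h0
  have h4 : ‖(s' : ℂ) - s‖ = |s' - s| := by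
    rw [← Complex.ofReal_sub, Complex.norm_real, Real.norm_eq_abs]
  rw [h3, norm_div, norm_neg, norm_mul, norm_mul, norm_mul, h4,
    div_le_iff₀ (mul_pos (mul_pos hpos hpos) (norm_pos_iff.2 hr))]
  calc ‖deriv G.lam s - Complex.exp (G.ell s' s)‖ * |s' - s|
      ≤ C * ‖(s' : ℂ) - s - Complex.I * ε‖ * ‖(s' : ℂ) - s - Complex.I * ε‖ := by
        gcongr
        exact hlip.trans (by gcongr)
    _ = 2 * C / c * (‖(s' : ℂ) - s - Complex.I * ε‖ * ‖(s' : ℂ) - s - Complex.I * ε‖ *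
        (c / 2)) := by field_simp
    _ ≤ _ := by gcongr

variable {G} in
theorem Bounds.norm_regKernel_le (hG : G.Bounds A B C c) {s s' : ℝ} (hs : s ∈ Set.Icc A B)
    (hs' : s' ∈ Set.Icc A B) {ε : ℝ} (hε : ε ≠ 0) (hεc : C * |ε| ≤ c / 2) :
    ‖G.regKernel s s' ε‖ ≤ 2 * C / c := by
  have h1 := hG.norm_kernel_sub_le hs hs' hε hεc
  have h2 := hG.norm_kernel_sub_le hs hs' (neg_ne_zero.2 hε) (by rwa [abs_neg])
  have h3 : G.regKernel s s' ε =
      ((deriv G.lam s / (G.off s ε - G.lam s') - 1 / ((s : ℂ) - s' + Complex.I * ε)) +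
      (deriv G.lam s / (G.off s (-ε) - G.lam s') -
        1 / ((s : ℂ) - s' + Complex.I * ((-ε : ℝ) : ℂ)))) / 2 := by
    rw [regKernel, regInv_eq _ hε]
    push_cast
    ring
  rw [h3, norm_div, Complex.norm_two, div_le_iff₀ two_pos]
  refine (norm_add_le _ _).trans ?_
  linarith

theorem tendsto_regKernel {s s' : ℝ} (h : s ≠ s') :
    Tendsto (G.regKernel s s') (𝓝[>] 0) (𝓝 (G.regPart s s')) := by
  have hne := G.lam_sub_ne_zero h
  have o1 := (G.tendsto_off s).mono_left (nhdsWithin_le_nhds (s := Set.Ioi 0))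
  have hneg : Tendsto (fun ε : ℝ => -ε) (𝓝[>] 0) (𝓝 0) := by
    simpa using ((continuous_neg (G := ℝ)).tendsto 0).mono_left
      (nhdsWithin_le_nhds (s := Set.Ioi 0))
  have o2 := (G.tendsto_off s).comp hneg
  have h1 := (((tendsto_const_nhds (x := (1 : ℂ))).div (o1.sub_const (G.lam s')) hne).add
    ((tendsto_const_nhds (x := (1 : ℂ))).div (o2.sub_const (G.lam s')) hne)).const_mul
      (deriv G.lam s)
  have h2 : Tendsto (fun ε => (regInv ε (s - s') : ℂ)) (𝓝[>] 0) (𝓝 (((s - s')⁻¹ : ℝ) : ℂ)) :=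
    (Complex.continuous_ofReal.tendsto _).comp (tendsto_regInv (s - s'))
  have h3 := (h1.div_const 2).sub h2
  convert! h3 using 2
  rw [regPart]
  push_cast
  ring

variable {G} in
theorem Bounds.norm_regPart_le (hG : G.Bounds A B C c) {s s' : ℝ} (hs : s ∈ Set.Icc A B)
    (hs' : s' ∈ Set.Icc A B) : ‖G.regPart s s'‖ ≤ 2 * C / c := by
  by_cases h : s = s'
  · subst h
    have := hG.c_pos
    have := hG.C_pos
    rw [regPart_self, norm_zero]
    positivity
  · refine le_of_tendsto (G.tendsto_regKernel h).norm ?_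
    filter_upwards [nhdsWithin_le_nhds hG.eventually_small, self_mem_nhdsWithin] with ε h1 h2
    exact hG.norm_regKernel_le hs hs' (ne_of_gt h2) h1

theorem hasDerivAt_ell {s s' : ℝ} (h : s ≠ s') :
    HasDerivAt (fun s => G.ell s s') (G.regPart s s') s := by
  have hne := G.lam_sub_ne_zero h
  have hne' : (s : ℂ) - s' ≠ 0 := sub_ne_zero.2 (by exact_mod_cast h)
  have h1 := hasDerivAt_of_exp (f := fun s => G.ell s s')
    (d := (deriv G.lam s * ((s : ℂ) - s') - (G.lam s - G.lam s') * 1) / ((s : ℂ) - s') ^ 2)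
    (x := s) (G.continuous_ell_comp continuous_id continuous_const).continuousAt ?_
  · convert! h1 using 1
    rw [G.exp_ell_of_ne h, regPart]
    field_simp
  · have h2 := ((G.hasDerivAt_lam s).sub_const (G.lam s')).div
      ((Complex.ofRealCLM.hasDerivAt (x := s)).sub_const (s' : ℂ)) hne'
    refine h2.congr_of_eventuallyEq ?_
    filter_upwards [isOpen_ne.mem_nhds h] with y hy
    exact G.exp_ell_of_ne hy

theorem intervalIntegrable_regPart (s₁ s₂ s' : ℝ) :
    IntervalIntegrable (fun s => G.regPart s s') MeasureTheory.volume s₁ s₂ := by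
  obtain ⟨C, c, hG⟩ := G.exists_bounds (min (min s₁ s₂) s') (max (max s₁ s₂) s')
  rw [intervalIntegrable_iff]
  refine MeasureTheory.IntegrableOn.of_bound (by simp)
    (G.measurable_regPart.comp (measurable_id.prodMk measurable_const)).aestronglyMeasurable
    (2 * C / c) ?_
  filter_upwards [MeasureTheory.ae_restrict_mem measurableSet_uIoc] with s hs
  rw [Set.uIoc, Set.mem_Ioc] at hs
  exact hG.norm_regPart_le ⟨(min_le_left _ _).trans hs.1.le, hs.2.trans (le_max_left _ _)⟩
    ⟨min_le_right _ _, le_max_right _ _⟩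

/-- `regPart` is bounded on compact sets and is the derivative of `ell` off the diagonal; the
fundamental theorem of calculus tolerates the one exceptional point s'. -/
theorem integral_regPart (s₁ s₂ s' : ℝ) :
    ∫ s in s₁..s₂, G.regPart s s' = G.ell s₂ s' - G.ell s₁ s' := by
  refine MeasureTheory.integral_eq_of_hasDerivAt_off_countable (fun s => G.ell s s')
    (fun s => G.regPart s s')
    (Set.countable_singleton s')
    (G.continuous_ell_comp continuous_id continuous_const).continuousOn
    (fun s hs => G.hasDerivAt_ell hs.2) (G.intervalIntegrable_regPart s₁ s₂ s')

end LogPath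

theorem abs_regInv_le (ε a : ℝ) (hε : ε ≠ 0) : |regInv ε a| ≤ 1 / |ε| := by
  have h1 : 0 < |ε| := abs_pos.2 hε
  have h2 : 0 < a ^ 2 + ε ^ 2 := by positivity
  rw [regInv, abs_div, abs_of_pos h2, div_le_div_iff₀ h2 h1, one_mul, ← sq_abs a, ← sq_abs ε]
  nlinarith [abs_nonneg a, sq_nonneg (|a| - |ε|)]

/-! ### Equilibrium densities: logarithmic potential and loop equation. -/

namespace LogPath

/-- A bounded density on a subset of the path whose Cauchy transform has mean boundary values
`V / 2` on both sides of the path. -/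
structure Equilibrium (G : LogPath) (T : Set ℝ) (μ V : ℝ → ℂ) (A B M N : ℝ) : Prop where
  isCompact : IsCompact T
  subset : T ⊆ Set.Icc A B
  measurable : Measurable μ
  bound : ∀ s, ‖μ s‖ ≤ M
  tendsto : ∀ s ∈ T, Tendsto (fun ε => G.cauchy T μ (G.off s ε) + G.cauchy T μ (G.off s (-ε)))
    (𝓝[>] 0) (𝓝 (V s))
  bounded : ∀ᶠ ε in 𝓝[>] (0 : ℝ), ∀ s ∈ T,
    ‖G.cauchy T μ (G.off s ε) + G.cauchy T μ (G.off s (-ε))‖ ≤ N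

/-- The principal value of the logarithm of `λ(s) - λ(s')`. -/
noncomputable def pvLog (G : LogPath) (s s' : ℝ) : ℂ := (Real.log |s - s'| : ℂ) + G.ell s s'

/-- The regularised principal value integral of the density against `λ'(s) / (λ(s) - λ(s'))`. -/
noncomputable def pvInt (G : LogPath) (T : Set ℝ) (μ : ℝ → ℂ) (ε s : ℝ) : ℂ :=
  ∫ s' in T, ((regInv ε (s - s') : ℂ) + G.regPart s s') * μ s'

variable {G : LogPath} {T : Set ℝ} {μ V : ℝ → ℂ} {A B M N C c : ℝ}

theorem integrableOn_of_norm_le {f : ℝ → ℂ} (hT : IsCompact T) (hf : Measurable f) {K : ℝ}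
    (hK : ∀ s ∈ T, ‖f s‖ ≤ K) : MeasureTheory.IntegrableOn f T :=
  MeasureTheory.IntegrableOn.of_bound hT.measure_lt_top hf.aestronglyMeasurable K
    (by filter_upwards [MeasureTheory.ae_restrict_mem hT.measurableSet] with s hs using hK s hs)

theorem measurable_regPart_right (s : ℝ) : Measurable fun s' => G.regPart s s' :=
  G.measurable_regPart.comp (measurable_const.prodMk measurable_id)

theorem measurable_regInv_right (ε s : ℝ) : Measurable fun s' => (regInv ε (s - s') : ℂ) :=
  Complex.measurable_ofReal.comp ((measurable_regInv ε).comp (by fun_prop))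

theorem measurable_regKernel (s ε : ℝ) : Measurable fun s' => G.regKernel s s' ε := by
  have h1 := G.continuous_lam.measurable
  have h2 := measurable_regInv_right ε s
  unfold regKernel
  fun_prop

namespace Equilibrium

variable (h : G.Equilibrium T μ V A B M N)
include h

theorem integrableOn : MeasureTheory.IntegrableOn μ T :=
  integrableOn_of_norm_le h.isCompact h.measurable fun s _ => h.bound s

theorem integrableOn_mul {f : ℝ → ℂ} (hf : Measurable f) {K : ℝ} (hK : ∀ s ∈ T, ‖f s‖ ≤ K) :
    MeasureTheory.IntegrableOn (fun s => f s * μ s) T := by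
  refine integrableOn_of_norm_le (K := K * M) h.isCompact (hf.mul h.measurable) fun s hs => ?_
  rw [norm_mul]
  have h1 := hK s hs
  have h2 := (norm_nonneg _).trans h1
  exact mul_le_mul h1 (h.bound s) (norm_nonneg _) h2

/-- Adding the Cauchy transforms from the two sides cancels their jumps and leaves twice the
principal value. The correction has a bounded kernel that tends to zero off the diagonal, so the
equilibrium condition determines the limit of `pvInt`. -/
theorem pvInt_eq (hG : G.Bounds A B C c) {ε : ℝ} (hε : ε ≠ 0) (hεc : C * |ε| ≤ c / 2) {s : ℝ}
    (hs : s ∈ T) : G.pvInt T μ ε s =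
      deriv G.lam s * (G.cauchy T μ (G.off s ε) + G.cauchy T μ (G.off s (-ε))) / 2 -
        ∫ s' in T, (G.regKernel s s' ε - G.regPart s s') * μ s' := by
  have hx : ∀ e : ℝ, e ≠ 0 → C * |e| ≤ c / 2 → G.off s e ∉ G.lam '' T := by
    rintro e he hec ⟨σ, hσ, heq⟩
    exact hG.lam_ne_off (h.subset hs) (h.subset hσ) he hec heq
  have i1 := G.integrableOn_cauchy h.isCompact h.integrableOn (hx ε hε hεc)
  have i2 := G.integrableOn_cauchy h.isCompact h.integrableOn
    (hx (-ε) (neg_ne_zero.2 hε) (by rwa [abs_neg]))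
  have i3 := h.integrableOn_mul (f := fun s' => (regInv ε (s - s') : ℂ) + G.regPart s s')
    ((measurable_regInv_right ε s).add (measurable_regPart_right s)) (K := 1 / |ε| + 2 * C / c)
    fun s' hs' => (norm_add_le _ _).trans (add_le_add (by
      rw [Complex.norm_real, Real.norm_eq_abs]
      exact abs_regInv_le _ _ hε) (hG.norm_regPart_le (h.subset hs) (h.subset hs')))
  have i4 := h.integrableOn_mul (f := fun s' => G.regKernel s s' ε - G.regPart s s')
    ((measurable_regKernel s ε).sub (measurable_regPart_right s)) (K := 2 * C / c + 2 * C / c)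
    fun s' hs' => (norm_sub_le _ _).trans (add_le_add
      (hG.norm_regKernel_le (h.subset hs) (h.subset hs') hε hεc)
      (hG.norm_regPart_le (h.subset hs) (h.subset hs')))
  have i12 : MeasureTheory.IntegrableOn (fun s' => μ s' / (G.off s ε - G.lam s') +
      μ s' / (G.off s (-ε) - G.lam s')) T := i1.add i2
  rw [eq_sub_iff_add_eq, pvInt, ← MeasureTheory.integral_add i3 i4, cauchy, cauchy,
    ← MeasureTheory.integral_add i1 i2, mul_div_right_comm, ← MeasureTheory.integral_const_mul]
  congr 1
  ext s'
  rw [regKernel]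
  ring

theorem tendsto_pvInt {s : ℝ} (hs : s ∈ T) :
    Tendsto (fun ε => G.pvInt T μ ε s) (𝓝[>] 0) (𝓝 (deriv G.lam s * V s / 2)) := by
  obtain ⟨C, c, hG⟩ := G.exists_bounds A B
  have h1 : Tendsto (fun ε => ∫ s' in T, (G.regKernel s s' ε - G.regPart s s') * μ s') (𝓝[>] 0)
      (𝓝 (∫ _ in T, (0 : ℂ))) := by
    refine MeasureTheory.tendsto_integral_filter_of_dominated_convergence
      (fun _ => (2 * C / c + 2 * C / c) * M) ?_ ?_ ?_ ?_
    · exact Eventually.of_forall fun ε => (((measurable_regKernel s ε).sub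
        (measurable_regPart_right s)).mul h.measurable).aestronglyMeasurable
    · filter_upwards [nhdsWithin_le_nhds hG.eventually_small, self_mem_nhdsWithin] with ε h1 h2
      filter_upwards [MeasureTheory.ae_restrict_mem h.isCompact.measurableSet] with s' hs'
      rw [norm_mul]
      have h3 := (norm_sub_le (G.regKernel s s' ε) (G.regPart s s')).trans (add_le_add
        (hG.norm_regKernel_le (h.subset hs) (h.subset hs') (ne_of_gt h2) h1)
        (hG.norm_regPart_le (h.subset hs) (h.subset hs')))
      exact mul_le_mul h3 (h.bound _) (norm_nonneg _) ((norm_nonneg _).trans h3)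
    · exact MeasureTheory.integrableOn_const h.isCompact.measure_lt_top.ne
    · have h2 : ∀ᵐ s' ∂(MeasureTheory.volume.restrict T), s' ≠ s :=
        MeasureTheory.ae_restrict_of_ae (MeasureTheory.Measure.ae_ne _ s)
      filter_upwards [h2] with s' hs'
      have h3 := ((G.tendsto_regKernel hs'.symm).sub_const (G.regPart s s')).mul_const (μ s')
      simpa using h3
  have h2 := (((h.tendsto s hs).const_mul (deriv G.lam s)).div_const 2).sub h1
  rw [MeasureTheory.integral_zero, sub_zero] at h2
  refine h2.congr' ?_
  filter_upwards [nhdsWithin_le_nhds hG.eventually_small, self_mem_nhdsWithin] with ε h3 h4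
  rw [h.pvInt_eq hG (ne_of_gt h4) h3 hs]

theorem exists_bound_pvInt : ∃ K : ℝ, ∀ᶠ ε in 𝓝[>] (0 : ℝ), ∀ s ∈ T, ‖G.pvInt T μ ε s‖ ≤ K := by
  obtain ⟨C, c, hG⟩ := G.exists_bounds A B
  obtain ⟨D, hD⟩ := h.isCompact.exists_bound_of_continuousOn G.continuous_deriv.continuousOn
  refine ⟨D * N / 2 + (2 * C / c + 2 * C / c) * M * (MeasureTheory.volume.real T), ?_⟩
  filter_upwards [nhdsWithin_le_nhds hG.eventually_small, self_mem_nhdsWithin, h.bounded]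
    with ε h1 h2 h3 s hs
  rw [h.pvInt_eq hG (ne_of_gt h2) h1 hs]
  refine (norm_sub_le _ _).trans (add_le_add ?_ ?_)
  · rw [norm_div, Complex.norm_two, norm_mul]
    have h4 := hD s hs
    have h5 := (norm_nonneg _).trans h4
    have h6 := h3 s hs
    gcongr
  · refine MeasureTheory.norm_setIntegral_le_of_norm_le_const h.isCompact.measure_lt_top
      fun s' hs' => ?_
    rw [norm_mul]
    have h3 := (norm_sub_le (G.regKernel s s' ε) (G.regPart s s')).trans (add_le_add
      (hG.norm_regKernel_le (h.subset hs) (h.subset hs') (ne_of_gt h2) h1)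
      (hG.norm_regPart_le (h.subset hs) (h.subset hs')))
    exact mul_le_mul h3 (h.bound _) (norm_nonneg _) ((norm_nonneg _).trans h3)

theorem measurable_kernel (ε : ℝ) : Measurable fun q : ℝ × ℝ =>
    ((regInv ε (q.1 - q.2) : ℂ) + G.regPart q.1 q.2) * μ q.2 :=
  ((Complex.measurable_ofReal.comp ((measurable_regInv ε).comp (by fun_prop))).add
    G.measurable_regPart).mul (h.measurable.comp measurable_snd)

theorem measurable_pvInt (ε : ℝ) : MeasureTheory.StronglyMeasurable (G.pvInt T μ ε) :=
  (h.measurable_kernel ε).stronglyMeasurable.integral_prod_right'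

theorem norm_kernel_le (hG : G.Bounds A B C c) {ε : ℝ} (hε : ε ≠ 0) {s s' : ℝ} (hs : s ∈ T)
    (hs' : s' ∈ T) : ‖((regInv ε (s - s') : ℂ) + G.regPart s s') * μ s'‖ ≤
      (1 / |ε| + 2 * C / c) * M := by
  have h1 : ‖(regInv ε (s - s') : ℂ) + G.regPart s s'‖ ≤ 1 / |ε| + 2 * C / c :=
    (norm_add_le _ _).trans (add_le_add (by
      rw [Complex.norm_real, Real.norm_eq_abs]
      exact abs_regInv_le _ _ hε) (hG.norm_regPart_le (h.subset hs) (h.subset hs')))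
  rw [norm_mul]
  exact mul_le_mul h1 (h.bound _) (norm_nonneg _) ((norm_nonneg _).trans h1)

theorem integral_pvInt {s₁ s₂ : ℝ} (hs : s₁ ≤ s₂) (hsT : Set.Icc s₁ s₂ ⊆ T) {ε : ℝ}
    (hε : ε ≠ 0) : ∫ s in s₁..s₂, G.pvInt T μ ε s =
      ∫ s' in T, (((Real.log ((s₂ - s') ^ 2 + ε ^ 2) / 2 -
        Real.log ((s₁ - s') ^ 2 + ε ^ 2) / 2 : ℝ) : ℂ) + (G.ell s₂ s' - G.ell s₁ s')) * μ s' := by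
  obtain ⟨C, c, hG⟩ := G.exists_bounds A B
  have hprod : MeasureTheory.Integrable (Function.uncurry fun s s' =>
      ((regInv ε (s - s') : ℂ) + G.regPart s s') * μ s')
      ((MeasureTheory.volume.restrict (Set.Ioc s₁ s₂)).prod
        (MeasureTheory.volume.restrict T)) := by
    rw [MeasureTheory.Measure.prod_restrict]
    refine MeasureTheory.IntegrableOn.of_bound ?_ (h.measurable_kernel ε).aestronglyMeasurable
      ((1 / |ε| + 2 * C / c) * M) ?_
    · rw [MeasureTheory.Measure.prod_prod]
      exact ENNReal.mul_lt_top (by simp) h.isCompact.measure_lt_top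
    · filter_upwards [MeasureTheory.ae_restrict_mem
        (measurableSet_Ioc.prod h.isCompact.measurableSet)] with q hq
      exact h.norm_kernel_le hG hε (hsT (Set.Ioc_subset_Icc_self hq.1)) hq.2
  rw [intervalIntegral.integral_of_le hs]
  simp only [pvInt]
  rw [MeasureTheory.integral_integral_swap hprod]
  refine MeasureTheory.setIntegral_congr_fun h.isCompact.measurableSet fun s' _ => ?_
  have i1 : IntervalIntegrable (fun s => (regInv ε (s - s') : ℂ)) MeasureTheory.volume s₁ s₂ :=
    (Complex.continuous_ofReal.comp ((continuous_regInv hε).comp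
      (by fun_prop))).intervalIntegrable _ _
  rw [← intervalIntegral.integral_of_le hs, intervalIntegral.integral_mul_const,
    intervalIntegral.integral_add i1 (G.intervalIntegrable_regPart s₁ s₂ s'),
    intervalIntegral.integral_ofReal, integral_regInv _ _ _ hε, G.integral_regPart]

/-- Along an arc of `T`, the logarithmic potential is a primitive of its principal value force. -/
theorem integral_pvLog_sub {s₁ s₂ : ℝ} (hs : s₁ ≤ s₂) (hsT : Set.Icc s₁ s₂ ⊆ T) :
    ∫ s' in T, (G.pvLog s₂ s' - G.pvLog s₁ s') * μ s' =
      ∫ s in s₁..s₂, deriv G.lam s * V s / 2 := by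
  obtain ⟨K, hK⟩ := h.exists_bound_pvInt
  -- The primitive is taken at fixed ε, where Fubini is legitimate and the kernel integrates to ½
  -- log((s − s')² + ε²) + `ell`; then ε → 0 on both sides.
  have hlhs : Tendsto (fun ε => ∫ s in s₁..s₂, G.pvInt T μ ε s) (𝓝[>] 0)
      (𝓝 (∫ s in s₁..s₂, deriv G.lam s * V s / 2)) := by
    refine intervalIntegral.tendsto_integral_filter_of_dominated_convergence (fun _ => K)
      (Eventually.of_forall fun ε => (h.measurable_pvInt ε).aestronglyMeasurable) ?_
      (by simp) ?_
    · filter_upwards [hK] with ε hε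
      refine Eventually.of_forall fun s hs' => hε s ?_
      rw [Set.uIoc_of_le hs] at hs'
      exact hsT (Set.Ioc_subset_Icc_self hs')
    · refine Eventually.of_forall fun s hs' => h.tendsto_pvInt ?_
      rw [Set.uIoc_of_le hs] at hs'
      exact hsT (Set.Ioc_subset_Icc_self hs')
  obtain ⟨E, hE⟩ := h.isCompact.exists_bound_of_continuousOn
    ((G.continuous_ell_comp (continuous_const (y := s₂)) continuous_id).sub
      (G.continuous_ell_comp (continuous_const (y := s₁)) continuous_id)).continuousOn
  have hlog : ∀ s, MeasureTheory.IntegrableOn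
      (fun s' => |(Real.log |s - s'|)| + ((s - s') ^ 2 + 1)) T := fun s =>
    (((integrableOn_log_abs_sub A B s).mono_set h.subset).abs).add
      ((by fun_prop : Continuous fun s' : ℝ => (s - s') ^ 2 + 1).continuousOn.integrableOn_compact
        h.isCompact)
  have hrhs : Tendsto (fun ε : ℝ => ∫ s' in T, (((Real.log ((s₂ - s') ^ 2 + ε ^ 2) / 2 -
        Real.log ((s₁ - s') ^ 2 + ε ^ 2) / 2 : ℝ) : ℂ) + (G.ell s₂ s' - G.ell s₁ s')) * μ s')
      (𝓝[>] 0) (𝓝 (∫ s' in T, (((Real.log |s₂ - s'| - Real.log |s₁ - s'| : ℝ) : ℂ) +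
        (G.ell s₂ s' - G.ell s₁ s')) * μ s')) := by
    have hne : ∀ s : ℝ, ∀ᵐ s' ∂(MeasureTheory.volume.restrict T), s' ≠ s := fun s =>
      MeasureTheory.ae_restrict_of_ae (MeasureTheory.Measure.ae_ne _ s)
    refine MeasureTheory.tendsto_integral_filter_of_dominated_convergence
      (fun s' => ((|(Real.log |s₂ - s'|)| + ((s₂ - s') ^ 2 + 1)) +
        (|(Real.log |s₁ - s'|)| + ((s₁ - s') ^ 2 + 1)) + E) * M) ?_ ?_ ?_ ?_
    · refine Eventually.of_forall fun ε => Measurable.aestronglyMeasurable ?_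
      have h1 := (G.continuous_ell_comp (continuous_const (y := s₂)) continuous_id).measurable
      have h2 := (G.continuous_ell_comp (continuous_const (y := s₁)) continuous_id).measurable
      exact ((Complex.measurable_ofReal.comp (by fun_prop)).add (h1.sub h2)).mul h.measurable
    · have h1 : ∀ᶠ ε : ℝ in 𝓝[>] 0, |ε| ≤ 1 := by
        have : Tendsto (fun ε : ℝ => |ε|) (𝓝 0) (𝓝 |(0 : ℝ)|) := continuous_abs.tendsto 0
        rw [abs_zero] at this
        exact nhdsWithin_le_nhds (this.eventually_le_const one_pos)
      filter_upwards [h1] with ε hε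
      filter_upwards [MeasureTheory.ae_restrict_mem h.isCompact.measurableSet, hne s₁, hne s₂]
        with s' hs' h2 h3
      rw [norm_mul]
      have h4 : ‖((Real.log ((s₂ - s') ^ 2 + ε ^ 2) / 2 -
          Real.log ((s₁ - s') ^ 2 + ε ^ 2) / 2 : ℝ) : ℂ) + (G.ell s₂ s' - G.ell s₁ s')‖ ≤
          (|(Real.log |s₂ - s'|)| + ((s₂ - s') ^ 2 + 1)) +
          (|(Real.log |s₁ - s'|)| + ((s₁ - s') ^ 2 + 1)) + E := by
        refine (norm_add_le _ _).trans (add_le_add ?_ (hE s' hs'))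
        rw [Complex.norm_real, Real.norm_eq_abs]
        refine (abs_sub _ _).trans (add_le_add ?_ ?_)
        · exact abs_log_sq_add_sq_le _ (sub_ne_zero.2 h3.symm) hε
        · exact abs_log_sq_add_sq_le _ (sub_ne_zero.2 h2.symm) hε
      exact mul_le_mul h4 (h.bound _) (norm_nonneg _) ((norm_nonneg _).trans h4)
    · exact ((((hlog s₂).add (hlog s₁)).add
        (MeasureTheory.integrableOn_const h.isCompact.measure_lt_top.ne))).mul_const M
    · filter_upwards [hne s₁, hne s₂] with s' h2 h3
      refine Tendsto.mul_const _ (Tendsto.add_const _ ?_)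
      refine (Complex.continuous_ofReal.tendsto _).comp ?_
      exact (tendsto_log_sq_add_sq _ (sub_ne_zero.2 h3.symm)).sub
        (tendsto_log_sq_add_sq _ (sub_ne_zero.2 h2.symm))
  have h1 := tendsto_nhds_unique hlhs (hrhs.congr' ?_)
  · rw [h1]
    congr 1
    ext s'
    simp only [pvLog]
    push_cast
    ring
  · filter_upwards [self_mem_nhdsWithin] with ε hε
    rw [h.integral_pvInt hs hsT (ne_of_gt hε)]

/-- The loop equation: the first variation of the equilibrium energy under a deformation of the
path vanishes. -/
theorem loop_equation {η : ℝ → ℂ} (hη : ContDiff ℝ 1 η) :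
    ∫ q, (η q.1 - η q.2) / (G.lam q.1 - G.lam q.2) * μ q.1 * μ q.2
      ∂((MeasureTheory.volume.restrict T).prod (MeasureTheory.volume.restrict T)) =
      ∫ s in T, η s * μ s * V s := by
  obtain ⟨C, c, hG⟩ := G.exists_bounds A B
  obtain ⟨K, hK⟩ := h.exists_bound_pvInt
  set ν := MeasureTheory.volume.restrict T with hν
  have hνT : ∀ᵐ s ∂ν, s ∈ T := MeasureTheory.ae_restrict_mem h.isCompact.measurableSet
  have : MeasureTheory.IsFiniteMeasure ν := ⟨by
    rw [hν, MeasureTheory.Measure.restrict_apply_univ]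
    exact h.isCompact.measure_lt_top⟩
  have hννT : ∀ᵐ q ∂(ν.prod ν), q.1 ∈ T ∧ q.2 ∈ T := by
    rw [hν, MeasureTheory.Measure.prod_restrict]
    exact MeasureTheory.ae_restrict_mem (h.isCompact.measurableSet.prod h.isCompact.measurableSet)
  -- The force carries a factor λ'(s); dividing η by it produces the weight of the loop equation.
  let φ : ℝ → ℂ := fun s => η s / deriv G.lam s
  have hφ : ContDiff ℝ 1 φ := by
    have h1 : ContDiff ℝ 1 (deriv G.lam) := G.contDiff_deriv.of_le (by exact_mod_cast le_top)
    simp only [φ, div_eq_mul_inv]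
    exact hη.mul (h1.inv G.deriv_ne_zero)
  have hφm : Measurable φ := hφ.continuous.measurable
  obtain ⟨P, hP⟩ := isCompact_Icc.exists_bound_of_continuousOn (s := Set.Icc A B)
    hφ.continuous.continuousOn
  obtain ⟨L, hL⟩ := isCompact_Icc.exists_bound_of_continuousOn (s := Set.Icc A B)
    (f := deriv φ) (hφ.continuous_deriv le_rfl).continuousOn
  have hlip : ∀ s ∈ Set.Icc A B, ∀ s' ∈ Set.Icc A B, ‖φ s - φ s'‖ ≤ L * |s - s'| :=
    fun s hs s' hs' => (convex_Icc A B).norm_image_sub_le_of_norm_deriv_le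
      (fun x _ => hφ.differentiable one_ne_zero x) hL hs' hs
  have hlhs : Tendsto (fun ε => ∫ s, φ s * μ s * G.pvInt T μ ε s ∂ν) (𝓝[>] 0)
      (𝓝 (∫ s, φ s * μ s * (deriv G.lam s * V s / 2) ∂ν)) := by
    refine MeasureTheory.tendsto_integral_filter_of_dominated_convergence (fun _ => P * M * K)
      (Eventually.of_forall fun ε => (hφm.mul h.measurable).aestronglyMeasurable.mul
        (h.measurable_pvInt ε).aestronglyMeasurable) ?_ (MeasureTheory.integrable_const _) ?_
    · filter_upwards [hK] with ε hε
      filter_upwards [hνT] with s hs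
      rw [norm_mul, norm_mul]
      have h1 := hP s (h.subset hs)
      have h2 := h.bound s
      have h3 := hε s hs
      have h4 := (norm_nonneg _).trans h1
      have h5 := (norm_nonneg _).trans h2
      gcongr
    · filter_upwards [hνT] with s hs
      exact (h.tendsto_pvInt hs).const_mul _
  let k : ℝ → ℝ × ℝ → ℂ := fun ε q => (regInv ε (q.1 - q.2) : ℂ) + G.regPart q.1 q.2
  let F : ℝ → ℝ × ℝ → ℂ := fun ε q => φ q.1 * μ q.1 * (k ε q * μ q.2)
  -- The integrand plus its swap. Since `regInv` is odd, its two contributions combine with φ(s) −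
  -- φ(s'), and |a| |`regInv` ε a| ≤ 1 makes this bounded uniformly in ε.
  let F' : ℝ → ℝ × ℝ → ℂ := fun ε q =>
    ((φ q.1 - φ q.2) * (regInv ε (q.1 - q.2) : ℂ) + φ q.1 * G.regPart q.1 q.2 +
      φ q.2 * G.regPart q.2 q.1) * μ q.1 * μ q.2
  have hFm : ∀ ε, Measurable (F ε) := fun ε =>
    ((hφm.comp measurable_fst).mul (h.measurable.comp measurable_fst)).mul (h.measurable_kernel ε)
  have hFi : ∀ ε : ℝ, ε ≠ 0 → MeasureTheory.Integrable (F ε) (ν.prod ν) := by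
    intro ε hε
    refine MeasureTheory.Integrable.of_bound (hFm ε).aestronglyMeasurable
      (P * M * ((1 / |ε| + 2 * C / c) * M)) ?_
    filter_upwards [hννT] with q hq
    rw [norm_mul, norm_mul]
    have h1 := hP _ (h.subset hq.1)
    have h2 := h.bound q.1
    have h3 := h.norm_kernel_le hG hε hq.1 hq.2
    have h4 := (norm_nonneg _).trans h1
    have h5 := (norm_nonneg _).trans h2
    gcongr
  have hFF' : ∀ ε : ℝ, ε ≠ 0 → ∫ s, φ s * μ s * G.pvInt T μ ε s ∂ν =
      (∫ q, F' ε q ∂(ν.prod ν)) / 2 := by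
    intro ε hε
    have h1 : ∫ s, φ s * μ s * G.pvInt T μ ε s ∂ν = ∫ q, F ε q ∂(ν.prod ν) := by
      rw [MeasureTheory.integral_prod _ (hFi ε hε)]
      congr 1
      ext s
      rw [pvInt, ← MeasureTheory.integral_const_mul]
    have h2 : ∫ q, F ε q ∂(ν.prod ν) = ∫ q : ℝ × ℝ, F ε q.swap ∂(ν.prod ν) :=
      (MeasureTheory.integral_prod_swap (F ε)).symm
    have h3 : ∫ q, F' ε q ∂(ν.prod ν) =
        (∫ q, F ε q ∂(ν.prod ν)) + ∫ q : ℝ × ℝ, F ε q.swap ∂(ν.prod ν) := by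
      have hsw : MeasureTheory.Integrable (fun q : ℝ × ℝ => F ε q.swap) (ν.prod ν) :=
        (hFi ε hε).swap
      rw [← MeasureTheory.integral_add (hFi ε hε) hsw]
      congr 1
      ext q
      have h4 : regInv ε (q.2 - q.1) = -regInv ε (q.1 - q.2) := by
        rw [← regInv_neg, neg_sub]
      simp only [F', F, k, Prod.fst_swap, Prod.snd_swap, h4]
      push_cast
      ring
    rw [h1, h3, ← h2]
    ring
  have hrhs : Tendsto (fun ε => ∫ q, F' ε q ∂(ν.prod ν)) (𝓝[>] 0)
      (𝓝 (∫ q, (η q.1 - η q.2) / (G.lam q.1 - G.lam q.2) * μ q.1 * μ q.2 ∂(ν.prod ν))) := by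
    refine MeasureTheory.tendsto_integral_filter_of_dominated_convergence
      (fun _ => (L + P * (2 * C / c) + P * (2 * C / c)) * M * M) ?_ ?_
      (MeasureTheory.integrable_const _) ?_
    · refine Eventually.of_forall fun ε => Measurable.aestronglyMeasurable ?_
      have m1 : Measurable fun q : ℝ × ℝ => φ q.1 := hφm.comp measurable_fst
      have m2 : Measurable fun q : ℝ × ℝ => φ q.2 := hφm.comp measurable_snd
      have m3 : Measurable fun q : ℝ × ℝ => μ q.1 := h.measurable.comp measurable_fst
      have m4 : Measurable fun q : ℝ × ℝ => μ q.2 := h.measurable.comp measurable_snd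
      have m5 : Measurable fun q : ℝ × ℝ => (regInv ε (q.1 - q.2) : ℂ) :=
        Complex.measurable_ofReal.comp ((measurable_regInv ε).comp (by fun_prop))
      exact ((((m1.sub m2).mul m5).add (m1.mul G.measurable_regPart)).add
        (m2.mul (G.measurable_regPart.comp measurable_swap))).mul m3 |>.mul m4
    · filter_upwards with ε
      filter_upwards [hννT] with q hq
      have a1 := h.subset hq.1
      have a2 := h.subset hq.2
      rw [norm_mul, norm_mul]
      have b1 : ‖(φ q.1 - φ q.2) * (regInv ε (q.1 - q.2) : ℂ)‖ ≤ L := by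
        rw [norm_mul, Complex.norm_real, Real.norm_eq_abs]
        have hL0 : 0 ≤ L := (norm_nonneg _).trans (hL _ a1)
        calc ‖φ q.1 - φ q.2‖ * |regInv ε (q.1 - q.2)|
            ≤ L * |q.1 - q.2| * |regInv ε (q.1 - q.2)| := by
              gcongr
              exact hlip _ a1 _ a2
          _ = L * (|q.1 - q.2| * |regInv ε (q.1 - q.2)|) := by ring
          _ ≤ L * 1 := by
              gcongr
              exact abs_mul_abs_regInv_le _ _
          _ = L := mul_one _
      have hP0 : 0 ≤ P := (norm_nonneg _).trans (hP _ a1)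
      have b2 : ‖φ q.1 * G.regPart q.1 q.2‖ ≤ P * (2 * C / c) := by
        rw [norm_mul]
        exact mul_le_mul (hP _ a1) (hG.norm_regPart_le a1 a2) (norm_nonneg _) hP0
      have b3 : ‖φ q.2 * G.regPart q.2 q.1‖ ≤ P * (2 * C / c) := by
        rw [norm_mul]
        exact mul_le_mul (hP _ a2) (hG.norm_regPart_le a2 a1) (norm_nonneg _) hP0
      have b4 := (norm_add₃_le (a := (φ q.1 - φ q.2) * (regInv ε (q.1 - q.2) : ℂ))
        (b := φ q.1 * G.regPart q.1 q.2) (c := φ q.2 * G.regPart q.2 q.1)).trans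
          (add_le_add_three b1 b2 b3)
      have b5 := (norm_nonneg _).trans b4
      have b6 := (norm_nonneg _).trans (h.bound q.1)
      exact mul_le_mul (mul_le_mul b4 (h.bound _) (norm_nonneg _) b5) (h.bound _) (norm_nonneg _)
        (mul_nonneg b5 b6)
    · refine Eventually.of_forall fun q => ?_
      refine Tendsto.mul_const _ (Tendsto.mul_const _ ?_)
      by_cases hq : q.1 = q.2
      -- On the diagonal the quotients of the statement and of `regPart` are 0 by convention, and
      -- the integrand is 0 for every ε.
      · simp only [hq, sub_self, zero_mul, regPart_self, mul_zero, zero_div, add_zero]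
        exact tendsto_const_nhds
      · have h1 : Tendsto (fun ε => (regInv ε (q.1 - q.2) : ℂ)) (𝓝[>] 0)
            (𝓝 (((q.1 - q.2)⁻¹ : ℝ) : ℂ)) :=
          (Complex.continuous_ofReal.tendsto _).comp (tendsto_regInv (q.1 - q.2))
        have h2 := ((h1.const_mul (φ q.1 - φ q.2)).add_const
          (φ q.1 * G.regPart q.1 q.2)).add_const (φ q.2 * G.regPart q.2 q.1)
        -- In the limit the poles 1/(s − s') cancel against those subtracted in `regPart`, and φ λ'
        -- = η leaves (η(s) − η(s'))/(λ(s) − λ(s')).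
        convert! h2 using 2
        have e1 := G.deriv_ne_zero q.1
        have e2 := G.deriv_ne_zero q.2
        have e3 := G.lam_sub_ne_zero hq
        have e4 : (q.1 : ℂ) - q.2 ≠ 0 := sub_ne_zero.2 (by exact_mod_cast hq)
        have e5 : G.lam q.2 - G.lam q.1 = -(G.lam q.1 - G.lam q.2) := by ring
        have e6 : (q.2 : ℂ) - q.1 = -((q.1 : ℂ) - q.2) := by ring
        simp only [regPart, φ, e5, e6]
        push_cast
        field_simp
        ring
  have h1 := tendsto_nhds_unique hlhs ((hrhs.div_const 2).congr' (by
    filter_upwards [self_mem_nhdsWithin] with ε hε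
    rw [hFF' ε (ne_of_gt hε)]))
  have h2 : ∫ s, φ s * μ s * (deriv G.lam s * V s / 2) ∂ν = (∫ s in T, η s * μ s * V s) / 2 := by
    rw [← MeasureTheory.integral_div]
    congr 1
    ext s
    have := G.deriv_ne_zero s
    simp only [φ]
    field_simp
  rw [h2] at h1
  linear_combination -2 * h1

end Equilibrium

end LogPath

/-! ### Energy, effective potential and multipliers of a curve. -/

namespace LogPath

variable (G : LogPath) {T : Set ℝ} {A B : ℝ} {μ₁ μ₂ : ℝ → ℂ}

theorem measurable_pvLog : Measurable fun q : ℝ × ℝ => G.pvLog q.1 q.2 := by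
  have h1 := G.continuous_ell.measurable
  unfold pvLog
  have h2 : Measurable fun q : ℝ × ℝ => (Real.log |q.1 - q.2| : ℂ) :=
    Complex.measurable_ofReal.comp (Real.measurable_log.comp (by fun_prop))
  exact h2.add h1

theorem pvLog_symm (s s' : ℝ) : G.pvLog s s' = G.pvLog s' s := by
  rw [pvLog, pvLog, G.ell_symm, abs_sub_comm]

theorem integrableOn_pvLog (A B s : ℝ) :
    MeasureTheory.IntegrableOn (fun s' => G.pvLog s s') (Set.Icc A B) :=
  (integrableOn_log_abs_sub A B s).ofReal.add
    (G.continuous_ell_comp continuous_const continuous_id).continuousOn.integrableOn_Icc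

theorem integrableOn_pvLog_prod (A B : ℝ) :
    MeasureTheory.IntegrableOn (fun q : ℝ × ℝ => G.pvLog q.1 q.2)
      (Set.Icc A B ×ˢ Set.Icc A B) :=
  (integrable_log_abs_sub_prod A B).ofReal.add
    ((G.continuous_ell_comp continuous_fst continuous_snd).continuousOn.integrableOn_compact
      (isCompact_Icc.prod isCompact_Icc))

theorem integrableOn_pvLog_mul (hT : T ⊆ Set.Icc A B) (h₁ : Measurable μ₁) {M₁ : ℝ}
    (hM₁ : ∀ s, ‖μ₁ s‖ ≤ M₁) (s : ℝ) :
    MeasureTheory.IntegrableOn (fun s' => G.pvLog s s' * μ₁ s') T :=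
  MeasureTheory.Integrable.mul_bdd ((G.integrableOn_pvLog A B s).mono_set hT)
    h₁.aestronglyMeasurable (Eventually.of_forall hM₁)

theorem integrable_pvLog_mul_mul (hT : T ⊆ Set.Icc A B) (h₁ : Measurable μ₁) (h₂ : Measurable μ₂)
    {M₁ M₂ : ℝ} (hM₁ : ∀ s, ‖μ₁ s‖ ≤ M₁) (hM₂ : ∀ s, ‖μ₂ s‖ ≤ M₂) :
    MeasureTheory.Integrable (fun q : ℝ × ℝ => G.pvLog q.1 q.2 * μ₁ q.1 * μ₂ q.2)
      ((MeasureTheory.volume.restrict T).prod (MeasureTheory.volume.restrict T)) := by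
  rw [MeasureTheory.Measure.prod_restrict]
  exact MeasureTheory.Integrable.mul_bdd (MeasureTheory.Integrable.mul_bdd
    ((G.integrableOn_pvLog_prod A B).mono_set (Set.prod_mono hT hT))
    (h₁.comp measurable_fst).aestronglyMeasurable (Eventually.of_forall fun q => hM₁ q.1))
    (h₂.comp measurable_snd).aestronglyMeasurable (Eventually.of_forall fun q => hM₂ q.2)

end LogPath

/-- Integration of an effective potential against a density. -/
theorem integral_sub_two_mul_potential {ν : MeasureTheory.Measure ℝ} [MeasureTheory.SFinite ν]
    {k : ℝ → ℝ → ℂ} {w α β P : ℝ → ℂ}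
    (hk : MeasureTheory.Integrable (fun q : ℝ × ℝ => k q.1 q.2 * α q.1 * β q.2) (ν.prod ν))
    (hw : MeasureTheory.Integrable (fun s => w s * α s) ν)
    (hP : ∀ s, P s = w s - 2 * ∫ s', k s s' * β s' ∂ν) :
    MeasureTheory.Integrable (fun s => P s * α s) ν ∧ ∫ s, P s * α s ∂ν =
      (∫ s, w s * α s ∂ν) - 2 * ∫ q : ℝ × ℝ, k q.1 q.2 * α q.1 * β q.2 ∂(ν.prod ν) := by
  have h1 : ∀ s, P s * α s = w s * α s - 2 * ∫ s', k s s' * α s * β s' ∂ν := fun s => by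
    rw [hP, sub_mul, mul_assoc, ← MeasureTheory.integral_mul_const]
    simp_rw [mul_right_comm]
  have h2 := hk.integral_prod_left.const_mul 2
  simp_rw [h1]
  refine ⟨hw.sub h2, ?_⟩
  rw [MeasureTheory.integral_sub hw h2, MeasureTheory.integral_const_mul,
    MeasureTheory.integral_prod _ hk]

namespace SpectralCurve

variable {m : ℕ} {W : ℂ[X]} (Γ : SpectralCurve m W)

/-- The hull of the cuts. -/
def hull : Set ℝ := Set.Icc (Γ.left 0) (Γ.right (Fin.last m))

theorem cuts_subset_hull : Γ.cuts ⊆ Γ.hull := by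
  refine Set.iUnion_subset fun i => Set.Icc_subset_Icc ?_ ?_
  · rcases (Fin.zero_le i).eq_or_lt with h | h
    · rw [h]
    · linarith [Γ.right_lt_left _ _ h, Γ.left_lt_right 0]
  · rcases (Fin.le_last i).eq_or_lt with h | h
    · rw [h]
    · linarith [Γ.right_lt_left _ _ h, Γ.left_lt_right (Fin.last m)]

theorem exists_bound_mass : ∃ M, ∀ s, ‖Γ.mass s‖ ≤ M := by
  obtain ⟨M, hM⟩ := Γ.isCompact_cuts.exists_bound_of_continuousOn Γ.continuousOn_mass
  refine ⟨max M 0, fun s => ?_⟩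
  by_cases hs : s ∈ Γ.cuts
  · exact (hM s hs).trans (le_max_left _ _)
  · rw [Γ.mass_of_notMem hs, norm_zero]
    exact le_max_right _ _

theorem cauchy_mass_eq (hdeg : W.natDegree = m + 2) (hlead : W.leadingCoeff = 1 / ((m : ℂ) + 2))
    {x : ℂ} (hx : x ∉ Γ.path.lam '' Γ.cuts) :
    Γ.path.cauchy Γ.cuts Γ.mass x = ((derivative W).eval x - Γ.y₀ x) / 2 := by
  rw [Γ.y₀_eq_sub_cauchy hdeg hlead hx]
  ring

/-- The Cauchy transform is (W' − y₀)/2, and the opposite boundary values of y₀ cancel in the sum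
over the two sides. The uniform bound near the cuts comes from y₀² being a polynomial. -/
theorem exists_equilibrium (hdeg : W.natDegree = m + 2)
    (hlead : W.leadingCoeff = 1 / ((m : ℂ) + 2)) : ∃ M N, Γ.path.Equilibrium Γ.cuts Γ.mass
      (fun s => (derivative W).eval (Γ.lam s)) (Γ.left 0) (Γ.right (Fin.last m)) M N := by
  obtain ⟨M, hM⟩ := Γ.exists_bound_mass
  obtain ⟨C, c, hG⟩ := Γ.path.exists_bounds (Γ.left 0) (Γ.right (Fin.last m))
  have hoff : Continuous fun q : ℝ × ℝ => Γ.path.off q.1 q.2 := by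
    have h1 := Γ.path.continuous_lam
    have h2 := Γ.path.continuous_deriv
    unfold LogPath.off
    fun_prop
  have hK : IsCompact (Γ.cuts ×ˢ Set.Icc (-1 : ℝ) 1) := Γ.isCompact_cuts.prod isCompact_Icc
  obtain ⟨D, hD⟩ := hK.exists_bound_of_continuousOn
    ((derivative W).continuous.comp hoff).continuousOn
  obtain ⟨E, hE⟩ := hK.exists_bound_of_continuousOn
    ((derivative W ^ 2 + Γ.f).continuous.comp hoff).continuousOn
  have hneg : Tendsto (fun ε : ℝ => -ε) (𝓝[>] 0) (𝓝[≠] 0) := by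
    have : Tendsto (fun ε : ℝ => -ε) (𝓝[>] 0) (𝓝[<] 0) := by
      simpa using tendsto_neg_nhdsGT (a := (0 : ℝ))
    exact this.mono_right (nhdsWithin_mono _ fun x hx => ne_of_lt hx)
  have hpos : (𝓝[>] (0 : ℝ)) ≤ 𝓝[≠] 0 := nhdsWithin_mono _ fun x hx => ne_of_gt hx
  refine ⟨M, 2 * ((D + (E + 1)) / 2), Γ.isCompact_cuts, Γ.cuts_subset_hull, Γ.measurable_mass, hM,
    fun s hs => ?_, ?_⟩
  · have hW : ∀ l ≤ 𝓝 (0 : ℝ), Tendsto (fun ε => (derivative W).eval (Γ.path.off s ε)) l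
        (𝓝 ((derivative W).eval (Γ.lam s))) := fun l hl =>
      ((derivative W).continuous.tendsto _).comp ((Γ.path.tendsto_off s).mono_left hl)
    have h1 := hW _ (nhdsWithin_le_nhds (s := Set.Ioi 0))
    have h2 := (hW _ (nhdsWithin_le_nhds (s := {0}ᶜ))).comp hneg
    have h3 := ((h1.sub (Γ.tendsto_y₀_off_gt hdeg hlead hs)).add
      (h2.sub (Γ.tendsto_y₀_off_lt hdeg hlead hs))).div_const 2
    have h4 : ∀ w z : ℂ, (w - Complex.I * z + (w - -Complex.I * z)) / 2 = w := fun w z => by ring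
    rw [h4] at h3
    refine h3.congr' ?_
    filter_upwards [hpos (Γ.eventually_off_notMem_cuts s),
      hneg.eventually (Γ.eventually_off_notMem_cuts s)] with ε e1 e2
    rw [Γ.cauchy_mass_eq hdeg hlead e1, Γ.cauchy_mass_eq hdeg hlead e2]
    simp only [Function.comp]
    ring
  · have key : ∀ ε : ℝ, ε ≠ 0 → C * |ε| ≤ c / 2 → |ε| ≤ 1 → ∀ s ∈ Γ.cuts,
        ‖Γ.path.cauchy Γ.cuts Γ.mass (Γ.path.off s ε)‖ ≤ (D + (E + 1)) / 2 := by
      intro ε h1 h2 h3 s hs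
      have hx : Γ.path.off s ε ∉ Γ.path.lam '' Γ.cuts := by
        rintro ⟨σ, hσ, heq⟩
        exact hG.lam_ne_off (Γ.cuts_subset_hull hs) (Γ.cuts_subset_hull hσ) h1 h2 heq
      have hm : ((s, ε) : ℝ × ℝ) ∈ Γ.cuts ×ˢ Set.Icc (-1 : ℝ) 1 := ⟨hs, abs_le.1 h3⟩
      have h4 : ‖Γ.y₀ (Γ.path.off s ε)‖ ^ 2 ≤ E := by
        rw [← norm_pow, Γ.sq_y₀ _ (by rwa [Γ.image_cuts])]
        exact hE _ hm
      have h5 : ‖Γ.y₀ (Γ.path.off s ε)‖ ≤ E + 1 := by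
        nlinarith [sq_nonneg (‖Γ.y₀ (Γ.path.off s ε)‖ - 1), norm_nonneg (Γ.y₀ (Γ.path.off s ε))]
      rw [Γ.cauchy_mass_eq hdeg hlead hx, norm_div, Complex.norm_two]
      have h6 := norm_sub_le ((derivative W).eval (Γ.path.off s ε)) (Γ.y₀ (Γ.path.off s ε))
      have h7 : ‖(derivative W).eval (Γ.path.off s ε)‖ ≤ D := hD _ hm
      gcongr
      exact h6.trans (add_le_add h7 h5)
    have h1 : ∀ᶠ ε : ℝ in 𝓝[>] 0, |ε| ≤ 1 := by
      have : Tendsto (fun ε : ℝ => |ε|) (𝓝[>] 0) (𝓝 |0|) :=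
        (continuous_abs.tendsto 0).mono_left nhdsWithin_le_nhds
      rw [abs_zero] at this
      exact this.eventually_le_const one_pos
    filter_upwards [h1, nhdsWithin_le_nhds hG.eventually_small, self_mem_nhdsWithin]
      with ε e1 e2 e3 s hs
    have e4 : ε ≠ 0 := ne_of_gt e3
    refine (norm_add_le _ _).trans ?_
    rw [two_mul]
    exact add_le_add (key ε e4 e2 e1 s hs)
      (key (-ε) (neg_ne_zero.2 e4) (by rwa [abs_neg]) (by rwa [abs_neg]) s hs)

theorem integrableOn_pvLog_mass (s : ℝ) :
    MeasureTheory.IntegrableOn (fun s' => Γ.path.pvLog s s' * Γ.mass s') Γ.cuts := by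
  obtain ⟨M, hM⟩ := Γ.exists_bound_mass
  exact Γ.path.integrableOn_pvLog_mul Γ.cuts_subset_hull Γ.measurable_mass hM s

theorem integrable_pvLog_mass_mass :
    MeasureTheory.Integrable (fun q : ℝ × ℝ => Γ.path.pvLog q.1 q.2 * Γ.mass q.1 * Γ.mass q.2)
      ((MeasureTheory.volume.restrict Γ.cuts).prod (MeasureTheory.volume.restrict Γ.cuts)) := by
  obtain ⟨M, hM⟩ := Γ.exists_bound_mass
  exact Γ.path.integrable_pvLog_mul_mul Γ.cuts_subset_hull Γ.measurable_mass Γ.measurable_mass hM hM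

theorem integrableOn_mul_mass {g : ℝ → ℂ} (hg : Continuous g) :
    MeasureTheory.IntegrableOn (fun s => g s * Γ.mass s) Γ.cuts :=
  Γ.integrableOn_mass.continuousOn_mul hg.continuousOn Γ.isCompact_cuts

theorem continuous_eval_lam (p : ℂ[X]) : Continuous fun s => p.eval (Γ.lam s) :=
  p.continuous.comp Γ.path.continuous_lam

/-- The effective potential on the path. -/
noncomputable def potential (s : ℝ) : ℂ :=
  W.eval (Γ.lam s) - 2 * ∫ s' in Γ.cuts, Γ.path.pvLog s s' * Γ.mass s'

/-- The value of the effective potential on a cut. -/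
noncomputable def multiplier (i : Fin (m + 1)) : ℂ := Γ.potential (Γ.left i)

/-- Along a cut the logarithmic integral has derivative λ' W'(λ)/2, which is also the derivative of
W(λ)/2; the two cancel in the effective potential. -/
theorem potential_eq_multiplier (hdeg : W.natDegree = m + 2)
    (hlead : W.leadingCoeff = 1 / ((m : ℂ) + 2)) {i : Fin (m + 1)} {s : ℝ}
    (hs : s ∈ Set.Icc (Γ.left i) (Γ.right i)) : Γ.potential s = Γ.multiplier i := by
  obtain ⟨M, N, h⟩ := Γ.exists_equilibrium hdeg hlead
  have h1 := h.integral_pvLog_sub hs.1 fun x hx => Γ.mem_cuts ⟨hx.1, hx.2.trans hs.2⟩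
  have h2 : ∀ σ ∈ Set.uIcc (Γ.left i) s, HasDerivAt (fun σ => W.eval (Γ.lam σ) / 2)
      (deriv Γ.lam σ * (derivative W).eval (Γ.lam σ) / 2) σ := fun σ _ => by
    have h3 := ((W.hasDerivAt (Γ.lam σ)).comp_of_eq σ (Γ.path.hasDerivAt_lam σ) rfl).div_const 2
    rw [mul_comm] at h3
    exact h3
  have h3 := intervalIntegral.integral_eq_sub_of_hasDerivAt h2
    (((Γ.path.continuous_deriv.mul (Γ.continuous_eval_lam _)).div_const 2).intervalIntegrable _ _)
  have h4 : ∫ s' in Γ.cuts, (Γ.path.pvLog s s' - Γ.path.pvLog (Γ.left i) s') * Γ.mass s' =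
      (∫ s' in Γ.cuts, Γ.path.pvLog s s' * Γ.mass s') -
        ∫ s' in Γ.cuts, Γ.path.pvLog (Γ.left i) s' * Γ.mass s' := by
    rw [← MeasureTheory.integral_sub (Γ.integrableOn_pvLog_mass s)
      (Γ.integrableOn_pvLog_mass (Γ.left i))]
    simp_rw [sub_mul]
  have h5 : (∫ s' in Γ.cuts, Γ.path.pvLog s s' * Γ.mass s') -
      ∫ s' in Γ.cuts, Γ.path.pvLog (Γ.left i) s' * Γ.mass s' =
        W.eval (Γ.lam s) / 2 - W.eval (Γ.lam (Γ.left i)) / 2 := by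
    rw [← h4, h1, ← h3]
    rfl
  rw [multiplier, potential, potential]
  linear_combination -2 * h5

theorem loop_equation (hdeg : W.natDegree = m + 2) (hlead : W.leadingCoeff = 1 / ((m : ℂ) + 2))
    {η : ℝ → ℂ} (hη : ContDiff ℝ 1 η) :
    ∫ q, (η q.1 - η q.2) / (Γ.lam q.1 - Γ.lam q.2) * Γ.mass q.1 * Γ.mass q.2
      ∂((MeasureTheory.volume.restrict Γ.cuts).prod (MeasureTheory.volume.restrict Γ.cuts)) =
    ∫ s in Γ.cuts, η s * Γ.mass s * (derivative W).eval (Γ.lam s) := by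
  obtain ⟨M, N, h⟩ := Γ.exists_equilibrium hdeg hlead
  exact h.loop_equation hη

theorem integral_cuts {g : ℝ → ℂ} (hg : MeasureTheory.IntegrableOn g Γ.cuts) :
    ∫ s in Γ.cuts, g s = ∑ i, ∫ s in Set.Icc (Γ.left i) (Γ.right i), g s :=
  MeasureTheory.integral_iUnion_fintype (fun _ => measurableSet_Icc) Γ.disjoint_cuts
    fun _ => hg.mono_set fun _ hs => Γ.mem_cuts hs

theorem fillingFraction_eq (hdeg : W.natDegree = m + 2)
    (hlead : W.leadingCoeff = 1 / ((m : ℂ) + 2)) (i : Fin (m + 1)) :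
    Γ.fillingFraction i = ∫ s in Set.Icc (Γ.left i) (Γ.right i), Γ.mass s := by
  rw [fillingFraction, Γ.injective_lam.preimage_image, ← MeasureTheory.integral_const_mul]
  simp_rw [Γ.density_eq hdeg hlead, mul_div_cancel₀ _ Γ.t_ne_zero]

theorem sum_fillingFraction (hdeg : W.natDegree = m + 2)
    (hlead : W.leadingCoeff = 1 / ((m : ℂ) + 2)) : ∑ i, Γ.fillingFraction i = Γ.t := by
  simp_rw [← Γ.integral_mass hdeg hlead, Γ.integral_cuts Γ.integrableOn_mass,
    Γ.fillingFraction_eq hdeg hlead]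

theorem integral_mul_mass (g : ℝ → ℂ) : ∫ s, g s * Γ.mass s = ∫ s in Γ.cuts, g s * Γ.mass s :=
  (MeasureTheory.setIntegral_eq_integral_of_forall_compl_eq_zero fun s hs => by
    rw [Γ.mass_of_notMem hs, mul_zero]).symm

theorem t_mul_integral_density (hdeg : W.natDegree = m + 2)
    (hlead : W.leadingCoeff = 1 / ((m : ℂ) + 2)) (g : ℝ → ℂ) :
    Γ.t * ∫ s, g s * Γ.density s = ∫ s in Γ.cuts, g s * Γ.mass s := by
  rw [← Γ.integral_mul_mass, ← MeasureTheory.integral_const_mul]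
  refine MeasureTheory.integral_congr_ae (Eventually.of_forall fun s => ?_)
  have := Γ.t_ne_zero
  simp only [Γ.density_eq hdeg hlead]
  field_simp

/-- The quadratic form of the prepotential. -/
noncomputable def energy : ℂ :=
  ∫ q : ℝ × ℝ, Γ.path.pvLog q.1 q.2 * Γ.mass q.1 * Γ.mass q.2
    ∂((MeasureTheory.volume.restrict Γ.cuts).prod (MeasureTheory.volume.restrict Γ.cuts))

theorem prepotential_eq (hdeg : W.natDegree = m + 2)
    (hlead : W.leadingCoeff = 1 / ((m : ℂ) + 2)) :
    Γ.prepotential = Γ.energy - ∫ s in Γ.cuts, W.eval (Γ.lam s) * Γ.mass s := by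
  have ht := Γ.t_ne_zero
  have h1 : ∀ s, ∫ s', Γ.pvLog s s' * Γ.density s * Γ.density s' =
      (∫ s' in Γ.cuts, Γ.path.pvLog s s' * Γ.mass s * Γ.mass s') / Γ.t ^ 2 := fun s => by
    rw [← Γ.integral_mul_mass, ← MeasureTheory.integral_div]
    refine MeasureTheory.integral_congr_ae (Eventually.of_forall fun s' => ?_)
    simp only [Γ.density_eq hdeg hlead]
    change Γ.path.pvLog s s' * _ * _ = _
    field_simp
  have h2 : ∫ s, ∫ s', Γ.pvLog s s' * Γ.density s * Γ.density s' = Γ.energy / Γ.t ^ 2 := by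
    rw [energy, MeasureTheory.integral_prod _ Γ.integrable_pvLog_mass_mass,
      MeasureTheory.setIntegral_eq_integral_of_forall_compl_eq_zero fun s hs => by
        simp [Γ.mass_of_notMem hs], ← MeasureTheory.integral_div]
    exact MeasureTheory.integral_congr_ae (Eventually.of_forall h1)
  rw [prepotential, h2, Γ.t_mul_integral_density hdeg hlead fun s => W.eval (Γ.lam s)]
  field_simp

theorem integral_mul_of_eq_on_cuts {P α : ℝ → ℂ} {L : Fin (m + 1) → ℂ}
    (hP : ∀ i, ∀ s ∈ Set.Icc (Γ.left i) (Γ.right i), P s = L i)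
    (hi : MeasureTheory.IntegrableOn (fun s => P s * α s) Γ.cuts) :
    ∫ s in Γ.cuts, P s * α s = ∑ i, L i * ∫ s in Set.Icc (Γ.left i) (Γ.right i), α s := by
  rw [Γ.integral_cuts hi]
  refine Finset.sum_congr rfl fun i _ => ?_
  rw [← MeasureTheory.integral_const_mul]
  refine MeasureTheory.setIntegral_congr_fun measurableSet_Icc fun s hs => ?_
  simp only [hP i s hs]

/-- Both sides are the integral of the effective potential against the mass: on the left it is a
constant on each cut, on the right it is expanded. -/
theorem sum_multiplier_mul_fillingFraction (hdeg : W.natDegree = m + 2)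
    (hlead : W.leadingCoeff = 1 / ((m : ℂ) + 2)) :
    ∑ i, Γ.multiplier i * Γ.fillingFraction i =
      (∫ s in Γ.cuts, W.eval (Γ.lam s) * Γ.mass s) - 2 * Γ.energy := by
  obtain ⟨h1, h2⟩ := integral_sub_two_mul_potential Γ.integrable_pvLog_mass_mass
    (Γ.integrableOn_mul_mass (Γ.continuous_eval_lam W)) (P := Γ.potential) fun _ => rfl
  rw [energy, ← h2, Γ.integral_mul_of_eq_on_cuts
    (fun i s hs => Γ.potential_eq_multiplier hdeg hlead hs) h1]
  simp_rw [Γ.fillingFraction_eq hdeg hlead]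

theorem integrable_of_mass {g : ℝ → ℂ} (hg : Continuous g) :
    MeasureTheory.Integrable fun s => g s * Γ.mass s :=
  (MeasureTheory.integrableOn_iff_integrable_of_support_subset fun s hs => by
    by_contra h
    exact hs (by simp [Γ.mass_of_notMem h])).1 (Γ.integrableOn_mul_mass hg)

theorem integrable_density (hdeg : W.natDegree = m + 2)
    (hlead : W.leadingCoeff = 1 / ((m : ℂ) + 2)) {g : ℝ → ℂ} (hg : Continuous g) :
    MeasureTheory.Integrable fun s => g s * Γ.density s := by
  simp_rw [Γ.density_eq hdeg hlead, ← mul_div_assoc]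
  exact (Γ.integrable_of_mass hg).div_const _

theorem integrable_pvLog_density (hdeg : W.natDegree = m + 2)
    (hlead : W.leadingCoeff = 1 / ((m : ℂ) + 2)) :
    MeasureTheory.Integrable fun q : ℝ × ℝ =>
      Γ.pvLog q.1 q.2 * Γ.density q.1 * Γ.density q.2 := by
  have h1 := Γ.integrable_pvLog_mass_mass
  rw [MeasureTheory.Measure.prod_restrict] at h1
  have h2 := ((MeasureTheory.integrableOn_iff_integrable_of_support_subset (fun q hq => by
    refine ⟨?_, ?_⟩
    · by_contra h
      exact hq (by simp [Γ.mass_of_notMem h])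
    · by_contra h
      exact hq (by simp [Γ.mass_of_notMem h]))).1 h1).div_const (Γ.t ^ 2)
  refine h2.congr (Eventually.of_forall fun q => ?_)
  have ht := Γ.t_ne_zero
  simp only [Γ.density_eq hdeg hlead]
  change _ = Γ.path.pvLog q.1 q.2 * _ * _
  field_simp

end SpectralCurve

/-! ### Comparison of two curves on the cuts of the first. -/

theorem Polynomial.exists_second_order_remainder (p : ℂ[X]) : ∃ k : ℂ × ℂ → ℂ, Continuous k ∧
    ∀ z h, p.eval (z + h) = p.eval z + (derivative p).eval z * h + k (z, h) * h ^ 2 := by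
  induction p using Polynomial.induction_on with
  | C a => exact ⟨fun _ => 0, continuous_const, by simp⟩
  | add p q hp hq =>
    obtain ⟨k, hk, hk'⟩ := hp
    obtain ⟨l, hl, hl'⟩ := hq
    refine ⟨fun x => k x + l x, hk.add hl, fun z h => ?_⟩
    rw [eval_add, hk', hl', derivative_add, eval_add, eval_add]
    ring
  | monomial n a ih =>
    obtain ⟨k, hk, hk'⟩ := ih
    have hd := (derivative (C a * X ^ n)).continuous
    refine ⟨fun x => (derivative (C a * X ^ n)).eval x.1 + (x.1 + x.2) * k x,
      by fun_prop, fun z h => ?_⟩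
    have hd2 : derivative (C a * X ^ n * X) = derivative (C a * X ^ n) * X + C a * X ^ n := by
      rw [derivative_mul (f := C a * X ^ n), derivative_X, mul_one]
    rw [pow_succ, ← mul_assoc, eval_mul, hk', hd2]
    simp only [eval_mul, eval_add, eval_X]
    ring

theorem MeasureTheory.Measure.ae_fst_ne_snd (ν₁ ν₂ : MeasureTheory.Measure ℝ)
    [MeasureTheory.SFinite ν₂] [MeasureTheory.NullSingletonClass ν₂] :
    ∀ᵐ q ∂(ν₁.prod ν₂), q.1 ≠ q.2 := by
  rw [MeasureTheory.ae_iff]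
  have h : {q : ℝ × ℝ | ¬ q.1 ≠ q.2} = Set.diagonal ℝ := by
    ext q
    simp
  rw [h, MeasureTheory.Measure.measure_prod_null isClosed_diagonal.measurableSet]
  refine Eventually.of_forall fun x => ?_
  have : Prod.mk x ⁻¹' Set.diagonal ℝ = {x} := by
    ext y
    simp [eq_comm]
  simp [this]

/-- The absolute values in the real logarithms are harmless when both parameter differences have the
same sign, which an increasing change of parameter guarantees. -/
theorem LogPath.exp_pvLog_sub (G G' : LogPath) {s s' u u' : ℝ} (hs : s ≠ s')
    (h : 0 < (u - u') / (s - s')) :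
    Complex.exp (G'.pvLog u u' - G.pvLog s s') = (G'.lam u - G'.lam u') / (G.lam s - G.lam s') := by
  have h0 : s - s' ≠ 0 := sub_ne_zero.2 hs
  have h1 : u - u' ≠ 0 := fun h' => by simp [h'] at h
  have h2 : Complex.exp ((Real.log |u - u'| : ℂ) - Real.log |s - s'|) =
      ((u : ℂ) - u') / ((s : ℂ) - s') := by
    rw [← Complex.ofReal_sub, ← Real.log_div (abs_ne_zero.2 h1) (abs_ne_zero.2 h0), ← abs_div,
      abs_of_pos h, ← Complex.ofReal_exp, Real.exp_log h]
    push_cast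
    rfl
  have h3 : G'.pvLog u u' - G.pvLog s s' = ((Real.log |u - u'| : ℂ) - Real.log |s - s'|) +
      (G'.ell u u' - G.ell s s') := by
    rw [pvLog, pvLog]
    ring
  have h4 : (s : ℂ) - s' ≠ 0 := by exact_mod_cast h0
  rw [h3, Complex.exp_add, h2, Complex.exp_sub, ← G.exp_ell, ← G'.exp_ell]
  field_simp

namespace SpectralCurve

variable {m : ℕ} {W : ℂ[X]}

/-- A change of parameter identifying the cuts of two curves. -/
structure Chart (Γ Γ' : SpectralCurve m W) (θ : ℝ → ℝ) : Prop where
  contDiff : ContDiff ℝ ∞ θ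
  deriv_pos : ∀ u ∈ Γ.hull, 0 < deriv θ u
  map_left : ∀ i, θ (Γ.left i) = Γ'.left i
  map_right : ∀ i, θ (Γ.right i) = Γ'.right i

/-- The density of a second curve, transported to the cuts of the first one. -/
noncomputable def pullMass (Γ Γ' : SpectralCurve m W) (θ : ℝ → ℝ) (u : ℝ) : ℂ :=
  Γ.signFun u * (Γ'.amplitude (θ u) * deriv θ u)

variable {Γ Γ' : SpectralCurve m W} {θ : ℝ → ℝ}

theorem left_mem (Γ : SpectralCurve m W) (i : Fin (m + 1)) :
    Γ.left i ∈ Set.Icc (Γ.left i) (Γ.right i) := Set.left_mem_Icc.2 (Γ.left_lt_right i).le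

theorem right_mem (Γ : SpectralCurve m W) (i : Fin (m + 1)) :
    Γ.right i ∈ Set.Icc (Γ.left i) (Γ.right i) := Set.right_mem_Icc.2 (Γ.left_lt_right i).le

theorem pullMass_of_notMem {u : ℝ} (hu : u ∉ Γ.cuts) : pullMass Γ Γ' θ u = 0 := by
  rw [pullMass, Γ.signFun_of_notMem hu, zero_mul]

namespace Chart

variable (h : Chart Γ Γ' θ)
include h

theorem continuous_deriv : Continuous (deriv θ) :=
  ((contDiff_infty_iff_deriv).1 h.contDiff).2.continuous

theorem measurable_pullMass : Measurable (pullMass Γ Γ' θ) :=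
  Γ.measurable_signFun.mul ((Γ'.continuous_amplitude.comp h.contDiff.continuous).mul
    (Complex.continuous_ofReal.comp h.continuous_deriv)).measurable

theorem strictMonoOn : StrictMonoOn θ Γ.hull :=
  strictMonoOn_of_deriv_pos (convex_Icc _ _) h.contDiff.continuous.continuousOn
    fun u hu => h.deriv_pos u (interior_subset hu)

theorem image_Icc (i : Fin (m + 1)) : θ '' Set.Icc (Γ.left i) (Γ.right i) =
    Set.Icc (Γ'.left i) (Γ'.right i) := by
  have hI : Set.Icc (Γ.left i) (Γ.right i) ⊆ Γ.hull := fun u hu =>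
    Γ.cuts_subset_hull (Γ.mem_cuts hu)
  refine Set.Subset.antisymm ?_ ?_
  · rintro _ ⟨u, hu, rfl⟩
    rw [← h.map_left, ← h.map_right]
    exact ⟨h.strictMonoOn.monotoneOn (hI (Γ.left_mem i)) (hI hu) hu.1,
      h.strictMonoOn.monotoneOn (hI hu) (hI (Γ.right_mem i)) hu.2⟩
  · rw [← h.map_left, ← h.map_right]
    exact intermediate_value_Icc (Γ.left_lt_right i).le h.contDiff.continuous.continuousOn

theorem image_cuts : θ '' Γ.cuts = Γ'.cuts := by
  rw [cuts, Set.image_iUnion]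
  simp_rw [h.image_Icc]
  rfl

theorem signFun_map {u : ℝ} (hu : u ∈ Γ.cuts) : Γ'.signFun (θ u) = Γ.signFun u := by
  obtain ⟨i, hi⟩ := Set.mem_iUnion.1 hu
  rw [Γ.signFun_of_mem hi, Γ'.signFun_of_mem (i := i)]
  rw [← h.image_Icc i]
  exact ⟨u, hi, rfl⟩

/-- Change of variables: θ is increasing and preserves the numbering of the cuts, so the signs of
the two densities correspond and θ' enters without absolute value. -/
theorem setIntegral_image {S : Set ℝ} (hS : MeasurableSet S) (hST : S ⊆ Γ.cuts) (g : ℝ → ℂ) :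
    ∫ s in θ '' S, g s * Γ'.mass s = ∫ u in S, g (θ u) * pullMass Γ Γ' θ u := by
  rw [MeasureTheory.integral_image_eq_integral_abs_deriv_smul hS
    (fun u _ => ((h.contDiff.differentiable (by simp)) u).hasDerivAt.hasDerivWithinAt)
    (h.strictMonoOn.injOn.mono (hST.trans Γ.cuts_subset_hull))]
  refine MeasureTheory.setIntegral_congr_fun hS fun u hu => ?_
  simp only [pullMass, mass, h.signFun_map (hST hu),
    abs_of_pos (h.deriv_pos u (Γ.cuts_subset_hull (hST hu))), Complex.real_smul]
  ring

theorem setIntegral_cuts (g : ℝ → ℂ) :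
    ∫ s in Γ'.cuts, g s * Γ'.mass s = ∫ u in Γ.cuts, g (θ u) * pullMass Γ Γ' θ u := by
  rw [← h.image_cuts, h.setIntegral_image Γ.isCompact_cuts.measurableSet subset_rfl]

theorem fillingFraction_eq (hdeg : W.natDegree = m + 2)
    (hlead : W.leadingCoeff = 1 / ((m : ℂ) + 2)) (i : Fin (m + 1)) :
    Γ'.fillingFraction i = ∫ u in Set.Icc (Γ.left i) (Γ.right i), pullMass Γ Γ' θ u := by
  rw [Γ'.fillingFraction_eq hdeg hlead, ← h.image_Icc]
  simpa using h.setIntegral_image (S := Set.Icc (Γ.left i) (Γ.right i)) measurableSet_Icc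
    (fun u hu => Γ.mem_cuts hu) fun _ => 1

theorem potential_map (u : ℝ) : Γ'.potential (θ u) = W.eval (Γ'.lam (θ u)) -
    2 * ∫ v in Γ.cuts, Γ'.path.pvLog (θ u) (θ v) * pullMass Γ Γ' θ v := by
  rw [potential, h.setIntegral_cuts]

theorem potential_map_eq (hdeg : W.natDegree = m + 2)
    (hlead : W.leadingCoeff = 1 / ((m : ℂ) + 2)) {i : Fin (m + 1)} {u : ℝ}
    (hu : u ∈ Set.Icc (Γ.left i) (Γ.right i)) : Γ'.potential (θ u) = Γ'.multiplier i := by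
  refine Γ'.potential_eq_multiplier hdeg hlead ?_
  rw [← h.image_Icc i]
  exact ⟨u, hu, rfl⟩

theorem multiplier_eq (i : Fin (m + 1)) : Γ'.multiplier i = W.eval (Γ'.lam (θ (Γ.left i))) -
    2 * ∫ v in Γ.cuts, Γ'.path.pvLog (θ (Γ.left i)) (θ v) * pullMass Γ Γ' θ v := by
  rw [multiplier, ← h.map_left, h.potential_map]

end Chart

/-- The curves are close to each other, to order `D` for the paths and to order `ε` for the
densities. -/
structure Close (Γ Γ' : SpectralCurve m W) (θ : ℝ → ℝ) (D ε : ℝ) : Prop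
    extends Chart Γ Γ' θ where
  nonneg : 0 ≤ D
  le_half : D ≤ 1 / 2
  le_one : ε ≤ 1
  norm_sub_le : ∀ u ∈ Γ.hull, ‖Γ'.lam (θ u) - Γ.lam u‖ ≤ D
  norm_sub_sub_le : ∀ u ∈ Γ.hull, ∀ v ∈ Γ.hull,
    ‖(Γ'.lam (θ u) - Γ.lam u) - (Γ'.lam (θ v) - Γ.lam v)‖ ≤ D * ‖Γ.lam u - Γ.lam v‖
  abs_im_lt : ∀ u ∈ Γ.hull, ∀ v ∈ Γ.hull,
    |(Γ'.path.ell (θ u) (θ v) - Γ.path.ell u v).im| < Real.pi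
  norm_mass_sub_le : ∀ u ∈ Γ.cuts, ‖pullMass Γ Γ' θ u - Γ.mass u‖ ≤ ε

/-- The relative variation of the chords of the path. -/
noncomputable def chordVar (Γ Γ' : SpectralCurve m W) (θ : ℝ → ℝ) (q : ℝ × ℝ) : ℂ :=
  ((Γ'.lam (θ q.1) - Γ.lam q.1) - (Γ'.lam (θ q.2) - Γ.lam q.2)) / (Γ.lam q.1 - Γ.lam q.2)

namespace Close

variable {D ε : ℝ} (h : Close Γ Γ' θ D ε)
include h

theorem norm_chordVar_le {q : ℝ × ℝ} (h1 : q.1 ∈ Γ.hull) (h2 : q.2 ∈ Γ.hull) :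
    ‖chordVar Γ Γ' θ q‖ ≤ D := by
  rw [chordVar, norm_div]
  exact div_le_of_le_mul₀ (norm_nonneg _) h.nonneg (h.norm_sub_sub_le _ h1 _ h2)

/-- The difference of the kernels is a logarithm of 1 + `chordVar`, and the bound on its imaginary
part makes it the principal one. So it equals `chordVar` up to a quadratic error. -/
theorem norm_pvLog_sub_sub_le {q : ℝ × ℝ} (h1 : q.1 ∈ Γ.hull) (h2 : q.2 ∈ Γ.hull)
    (h3 : q.1 ≠ q.2) :
    ‖Γ'.path.pvLog (θ q.1) (θ q.2) - Γ.path.pvLog q.1 q.2 - chordVar Γ Γ' θ q‖ ≤ D ^ 2 := by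
  have hpos : 0 < (θ q.1 - θ q.2) / (q.1 - q.2) := by
    rcases lt_or_gt_of_ne h3 with hlt | hlt
    · exact div_pos_of_neg_of_neg (sub_neg.2 (h.strictMonoOn h1 h2 hlt)) (sub_neg.2 hlt)
    · exact div_pos (sub_pos.2 (h.strictMonoOn h2 h1 hlt)) (sub_pos.2 hlt)
  have hexp := Γ.path.exp_pvLog_sub Γ'.path h3 hpos
  have hne : Γ.lam q.1 - Γ.lam q.2 ≠ 0 := Γ.path.lam_sub_ne_zero h3
  have h4 : (Γ'.path.lam (θ q.1) - Γ'.path.lam (θ q.2)) / (Γ.path.lam q.1 - Γ.path.lam q.2) =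
      1 + chordVar Γ Γ' θ q := by
    change (Γ'.lam (θ q.1) - Γ'.lam (θ q.2)) / (Γ.lam q.1 - Γ.lam q.2) = _
    rw [chordVar]
    field_simp
    ring
  have him : (Γ'.path.pvLog (θ q.1) (θ q.2) - Γ.path.pvLog q.1 q.2).im =
      (Γ'.path.ell (θ q.1) (θ q.2) - Γ.path.ell q.1 q.2).im := by
    simp [LogPath.pvLog]
  have h5 := abs_lt.1 (h.abs_im_lt _ h1 _ h2)
  rw [← him] at h5
  have h6 := Complex.log_exp h5.1 h5.2.le
  rw [hexp, h4] at h6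
  rw [← h6]
  have h7 := h.norm_chordVar_le h1 h2
  have h8 := h.le_half
  have h9 := Complex.norm_log_one_add_sub_self_le (z := chordVar Γ Γ' θ q) (by linarith)
  refine h9.trans ?_
  have h10 : (1 - ‖chordVar Γ Γ' θ q‖)⁻¹ ≤ 2 := by
    rw [inv_le_comm₀ (by linarith) two_pos]
    linarith
  have h11 : ‖chordVar Γ Γ' θ q‖ ^ 2 ≤ D ^ 2 := by gcongr
  have h12 := sq_nonneg ‖chordVar Γ Γ' θ q‖
  nlinarith

theorem norm_pvLog_sub_le {q : ℝ × ℝ} (h1 : q.1 ∈ Γ.hull) (h2 : q.2 ∈ Γ.hull)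
    (h3 : q.1 ≠ q.2) : ‖Γ'.path.pvLog (θ q.1) (θ q.2) - Γ.path.pvLog q.1 q.2‖ ≤ 2 * D := by
  have h4 := h.norm_pvLog_sub_sub_le h1 h2 h3
  have h5 := h.norm_chordVar_le h1 h2
  have h6 := norm_add_le (Γ'.path.pvLog (θ q.1) (θ q.2) - Γ.path.pvLog q.1 q.2 -
    chordVar Γ Γ' θ q) (chordVar Γ Γ' θ q)
  rw [sub_add_cancel] at h6
  nlinarith [h.nonneg, h.le_half]

theorem norm_pullMass_le {M : ℝ} (hM : ∀ s, ‖Γ.mass s‖ ≤ M) (u : ℝ) :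
    ‖pullMass Γ Γ' θ u‖ ≤ M + 1 := by
  by_cases hu : u ∈ Γ.cuts
  · have h1 := h.norm_mass_sub_le u hu
    have h2 := norm_add_le (pullMass Γ Γ' θ u - Γ.mass u) (Γ.mass u)
    rw [sub_add_cancel] at h2
    linarith [hM u, h.le_one]
  · rw [pullMass_of_notMem hu, norm_zero]
    linarith [(norm_nonneg _).trans (hM u)]

theorem measurable_pvLog_map :
    Measurable fun q : ℝ × ℝ => Γ'.path.pvLog (θ q.1) (θ q.2) := by
  have hθ := h.contDiff.continuous.measurable
  exact Γ'.path.measurable_pvLog.comp ((hθ.comp measurable_fst).prodMk (hθ.comp measurable_snd))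

end Close

end SpectralCurve

open MeasureTheory in
theorem MeasureTheory.integrable_mul_mul_of_bound {α : Type*} [MeasurableSpace α] {ν : Measure α}
    [IsFiniteMeasure ν] {f g k : α → ℂ} (hf : Measurable f) (hg : Measurable g) (hk : Measurable k)
    {a b c : ℝ} (hfa : ∀ᵐ x ∂ν, ‖f x‖ ≤ a) (hgb : ∀ᵐ x ∂ν, ‖g x‖ ≤ b) (hkc : ∀ᵐ x ∂ν, ‖k x‖ ≤ c) :
    Integrable (fun x => f x * g x * k x) ν ∧
      ‖∫ x, f x * g x * k x ∂ν‖ ≤ a * b * c * ν.real Set.univ := by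
  have h : ∀ᵐ x ∂ν, ‖f x * g x * k x‖ ≤ a * b * c := by
    filter_upwards [hfa, hgb, hkc] with x h1 h2 h3
    rw [norm_mul, norm_mul]
    have h4 := (norm_nonneg _).trans h1
    have h5 := (norm_nonneg _).trans h2
    gcongr
  exact ⟨Integrable.of_bound ((hf.mul hg).mul hk).aestronglyMeasurable _ h,
    norm_integral_le_of_norm_le_const h⟩

namespace SpectralCurve

variable {m : ℕ} {W : ℂ[X]} {Γ Γ' : SpectralCurve m W} {θ : ℝ → ℝ} {D ε : ℝ}

/-- The double integral is eliminated in favour of the multipliers, so that in the difference of two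
curves it reappears only through mixed integrals. -/
theorem prepotential_eq_multiplier (Γ : SpectralCurve m W) (hdeg : W.natDegree = m + 2)
    (hlead : W.leadingCoeff = 1 / ((m : ℂ) + 2)) :
    Γ.prepotential = -((∫ s in Γ.cuts, W.eval (Γ.lam s) * Γ.mass s) +
      ∑ i, Γ.multiplier i * Γ.fillingFraction i) / 2 := by
  rw [Γ.prepotential_eq hdeg hlead, Γ.sum_multiplier_mul_fillingFraction hdeg hlead]
  ring

theorem exists_bound_potential (Γ : SpectralCurve m W) : ∃ K : ℝ, 0 ≤ K ∧
    (∀ u ∈ Γ.hull, ‖(derivative W).eval (Γ.lam u)‖ ≤ K) ∧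
    ∀ u ∈ Γ.hull, ∀ x : ℂ, ‖x - Γ.lam u‖ ≤ 1 / 2 →
      ‖W.eval x - W.eval (Γ.lam u) - (derivative W).eval (Γ.lam u) * (x - Γ.lam u)‖ ≤
        K * ‖x - Γ.lam u‖ ^ 2 := by
  obtain ⟨k, hk, hk'⟩ := W.exists_second_order_remainder
  obtain ⟨K₁, hK₁⟩ := isCompact_Icc.exists_bound_of_continuousOn (s := Γ.hull)
    (Γ.continuous_eval_lam (derivative W)).continuousOn
  have hcomp : IsCompact ((Γ.lam '' Γ.hull) ×ˢ Metric.closedBall (0 : ℂ) (1 / 2)) :=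
    (isCompact_Icc.image Γ.path.continuous_lam).prod (isCompact_closedBall _ _)
  obtain ⟨K₂, hK₂⟩ := hcomp.exists_bound_of_continuousOn hk.continuousOn
  refine ⟨max (max K₁ K₂) 0, le_max_right _ _,
    fun u hu => (hK₁ u hu).trans ((le_max_left _ _).trans (le_max_left _ _)), fun u hu x hx => ?_⟩
  have h1 := hk' (Γ.lam u) (x - Γ.lam u)
  rw [add_sub_cancel] at h1
  have h2 : W.eval x - W.eval (Γ.lam u) - (derivative W).eval (Γ.lam u) * (x - Γ.lam u) =
      k (Γ.lam u, x - Γ.lam u) * (x - Γ.lam u) ^ 2 := by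
    rw [h1]
    ring
  rw [h2, norm_mul, norm_pow]
  gcongr
  refine (hK₂ _ ⟨⟨u, hu, rfl⟩, by simpa using hx⟩).trans
    ((le_max_right _ _).trans (le_max_left _ _))

theorem isFiniteMeasure_cuts (Γ : SpectralCurve m W) :
    MeasureTheory.IsFiniteMeasure (MeasureTheory.volume.restrict Γ.cuts) := ⟨by
  rw [MeasureTheory.Measure.restrict_apply_univ]
  exact Γ.isCompact_cuts.measure_lt_top⟩

theorem ae_mem_cuts (Γ : SpectralCurve m W) :
    ∀ᵐ u ∂(MeasureTheory.volume.restrict Γ.cuts), u ∈ Γ.cuts :=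
  MeasureTheory.ae_restrict_mem Γ.isCompact_cuts.measurableSet

theorem ae_prod_cuts (Γ : SpectralCurve m W) :
    ∀ᵐ q ∂((MeasureTheory.volume.restrict Γ.cuts).prod (MeasureTheory.volume.restrict Γ.cuts)),
      (q.1 ∈ Γ.cuts ∧ q.2 ∈ Γ.cuts) ∧ q.1 ≠ q.2 := by
  refine Eventually.and ?_ (MeasureTheory.Measure.ae_fst_ne_snd _ _)
  rw [MeasureTheory.Measure.prod_restrict]
  exact MeasureTheory.ae_restrict_mem
    (Γ.isCompact_cuts.measurableSet.prod Γ.isCompact_cuts.measurableSet)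

namespace Close

variable (h : Close Γ Γ' θ D ε)
include h

theorem eps_nonneg : 0 ≤ ε :=
  (norm_nonneg _).trans (h.norm_mass_sub_le _ (Γ.mem_cuts (Γ.left_mem 0)))

theorem measurable_pvLog_sub : Measurable fun q : ℝ × ℝ =>
    Γ'.path.pvLog (θ q.1) (θ q.2) - Γ.path.pvLog q.1 q.2 :=
  h.measurable_pvLog_map.sub Γ.path.measurable_pvLog

theorem integrable_pvLog_sub_mul_mul : MeasureTheory.Integrable (fun q : ℝ × ℝ =>
    (Γ'.path.pvLog (θ q.1) (θ q.2) - Γ.path.pvLog q.1 q.2) * Γ.mass q.1 * pullMass Γ Γ' θ q.2)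
      ((MeasureTheory.volume.restrict Γ.cuts).prod (MeasureTheory.volume.restrict Γ.cuts)) := by
  have := Γ.isFiniteMeasure_cuts
  obtain ⟨M, hM⟩ := Γ.exists_bound_mass
  refine (MeasureTheory.integrable_mul_mul_of_bound h.measurable_pvLog_sub
    (Γ.measurable_mass.comp measurable_fst) (h.measurable_pullMass.comp measurable_snd)
    (a := 2 * D) (b := M) (c := M + 1) ?_ (Eventually.of_forall fun q => hM q.1)
    (Eventually.of_forall fun q => h.norm_pullMass_le hM q.2)).1
  filter_upwards [Γ.ae_prod_cuts] with q hq
  exact h.norm_pvLog_sub_le (Γ.cuts_subset_hull hq.1.1) (Γ.cuts_subset_hull hq.1.2) hq.2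

theorem continuous_eval_map : Continuous fun u => W.eval (Γ'.lam (θ u)) :=
  (Γ'.continuous_eval_lam W).comp h.contDiff.continuous

theorem integrableOn_pullMass : MeasureTheory.IntegrableOn (pullMass Γ Γ' θ) Γ.cuts := by
  obtain ⟨M, hM⟩ := Γ.exists_bound_mass
  exact LogPath.integrableOn_of_norm_le Γ.isCompact_cuts h.measurable_pullMass
    fun u _ => h.norm_pullMass_le hM u

/-- The exact variation of the prepotential. -/
theorem prepotential_sub (hdeg : W.natDegree = m + 2)
    (hlead : W.leadingCoeff = 1 / ((m : ℂ) + 2)) :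
    Γ'.prepotential - Γ.prepotential +
        (∑ i, (Γ.multiplier i + Γ'.multiplier i) * (Γ'.fillingFraction i - Γ.fillingFraction i)) / 2 =
      (∫ q : ℝ × ℝ, (Γ'.path.pvLog (θ q.1) (θ q.2) - Γ.path.pvLog q.1 q.2) * Γ.mass q.1 *
        pullMass Γ Γ' θ q.2
        ∂((MeasureTheory.volume.restrict Γ.cuts).prod (MeasureTheory.volume.restrict Γ.cuts))) -
      (∫ u in Γ.cuts, (W.eval (Γ'.lam (θ u)) - W.eval (Γ.lam u)) *
        (Γ.mass u + pullMass Γ Γ' θ u)) / 2 := by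
  obtain ⟨M, hM⟩ := Γ.exists_bound_mass
  have hn := h.measurable_pullMass
  have hnM := h.norm_pullMass_le hM
  have i1 := Γ.path.integrable_pvLog_mul_mul Γ.cuts_subset_hull Γ.measurable_mass hn hM hnM
  have i1' := Γ.path.integrable_pvLog_mul_mul Γ.cuts_subset_hull hn Γ.measurable_mass hnM hM
  have i2 := h.integrable_pvLog_sub_mul_mul
  have i3 : MeasureTheory.Integrable (fun q : ℝ × ℝ =>
      Γ'.path.pvLog (θ q.1) (θ q.2) * Γ.mass q.1 * pullMass Γ Γ' θ q.2)
      ((MeasureTheory.volume.restrict Γ.cuts).prod (MeasureTheory.volume.restrict Γ.cuts)) :=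
    (i1.add i2).congr (Eventually.of_forall fun q => by
      simp only [Pi.add_apply]
      ring)
  have e2 : ∫ q : ℝ × ℝ, (Γ'.path.pvLog (θ q.1) (θ q.2) - Γ.path.pvLog q.1 q.2) * Γ.mass q.1 *
        pullMass Γ Γ' θ q.2
        ∂((MeasureTheory.volume.restrict Γ.cuts).prod (MeasureTheory.volume.restrict Γ.cuts)) =
      (∫ q : ℝ × ℝ, Γ'.path.pvLog (θ q.1) (θ q.2) * Γ.mass q.1 * pullMass Γ Γ' θ q.2
        ∂((MeasureTheory.volume.restrict Γ.cuts).prod (MeasureTheory.volume.restrict Γ.cuts))) -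
      ∫ q : ℝ × ℝ, Γ.path.pvLog q.1 q.2 * Γ.mass q.1 * pullMass Γ Γ' θ q.2
        ∂((MeasureTheory.volume.restrict Γ.cuts).prod (MeasureTheory.volume.restrict Γ.cuts)) := by
    rw [← MeasureTheory.integral_sub i3 i1]
    simp_rw [sub_mul]
  have e1 : ∫ q : ℝ × ℝ, Γ.path.pvLog q.1 q.2 * pullMass Γ Γ' θ q.1 * Γ.mass q.2
        ∂((MeasureTheory.volume.restrict Γ.cuts).prod (MeasureTheory.volume.restrict Γ.cuts)) =
      ∫ q : ℝ × ℝ, Γ.path.pvLog q.1 q.2 * Γ.mass q.1 * pullMass Γ Γ' θ q.2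
        ∂((MeasureTheory.volume.restrict Γ.cuts).prod (MeasureTheory.volume.restrict Γ.cuts)) := by
    rw [← MeasureTheory.integral_prod_swap]
    refine MeasureTheory.integral_congr_ae (Eventually.of_forall fun q => ?_)
    simp only [Prod.fst_swap, Prod.snd_swap]
    rw [Γ.path.pvLog_symm]
    ring
  have w1 : MeasureTheory.IntegrableOn (fun u => W.eval (Γ.lam u) * Γ.mass u) Γ.cuts :=
    Γ.integrableOn_mul_mass (Γ.continuous_eval_lam W)
  have w2 : MeasureTheory.IntegrableOn (fun u => W.eval (Γ'.lam (θ u)) * Γ.mass u) Γ.cuts :=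
    Γ.integrableOn_mul_mass h.continuous_eval_map
  have w3 : MeasureTheory.IntegrableOn (fun u => W.eval (Γ.lam u) * pullMass Γ Γ' θ u) Γ.cuts :=
    h.integrableOn_pullMass.continuousOn_mul (Γ.continuous_eval_lam W).continuousOn
      Γ.isCompact_cuts
  have w4 : MeasureTheory.IntegrableOn (fun u => W.eval (Γ'.lam (θ u)) * pullMass Γ Γ' θ u)
      Γ.cuts :=
    h.integrableOn_pullMass.continuousOn_mul h.continuous_eval_map.continuousOn Γ.isCompact_cuts
  have e3 : ∫ u in Γ.cuts, (W.eval (Γ'.lam (θ u)) - W.eval (Γ.lam u)) *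
        (Γ.mass u + pullMass Γ Γ' θ u) =
      ((∫ u in Γ.cuts, W.eval (Γ'.lam (θ u)) * Γ.mass u) -
        ∫ u in Γ.cuts, W.eval (Γ.lam u) * Γ.mass u) +
      ((∫ u in Γ.cuts, W.eval (Γ'.lam (θ u)) * pullMass Γ Γ' θ u) -
        ∫ u in Γ.cuts, W.eval (Γ.lam u) * pullMass Γ Γ' θ u) := by
    have w5 : MeasureTheory.IntegrableOn (fun u => W.eval (Γ'.lam (θ u)) * Γ.mass u -
      W.eval (Γ.lam u) * Γ.mass u) Γ.cuts := w2.sub w1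
    have w6 : MeasureTheory.IntegrableOn (fun u => W.eval (Γ'.lam (θ u)) * pullMass Γ Γ' θ u -
      W.eval (Γ.lam u) * pullMass Γ Γ' θ u) Γ.cuts := w4.sub w3
    rw [← MeasureTheory.integral_sub w2 w1, ← MeasureTheory.integral_sub w4 w3,
      ← MeasureTheory.integral_add w5 w6]
    refine MeasureTheory.integral_congr_ae (Eventually.of_forall fun u => ?_)
    ring
  -- The potential of each curve is integrated against the density of the other. Constancy on cuts
  -- gives Σ L_i S_i' and Σ L_i' S_i, and the double integrals are mixed ones in both cases.
  obtain ⟨p1, p2⟩ := integral_sub_two_mul_potential i1' w3 (P := Γ.potential) fun _ => rfl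
  obtain ⟨p3, p4⟩ := integral_sub_two_mul_potential (k := fun u v => Γ'.path.pvLog (θ u) (θ v)) i3 w2
    (P := fun u => Γ'.potential (θ u)) h.potential_map
  rw [Γ.integral_mul_of_eq_on_cuts (fun i s hs => Γ.potential_eq_multiplier hdeg hlead hs) p1,
    e1] at p2
  rw [Γ.integral_mul_of_eq_on_cuts (fun i s hs => h.potential_map_eq hdeg hlead hs) p3] at p4
  simp_rw [← h.fillingFraction_eq hdeg hlead] at p2
  simp_rw [← Γ.fillingFraction_eq hdeg hlead] at p4
  have e4 : ∑ i, (Γ.multiplier i + Γ'.multiplier i) *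
        (Γ'.fillingFraction i - Γ.fillingFraction i) =
      (∑ i, Γ.multiplier i * Γ'.fillingFraction i) - (∑ i, Γ.multiplier i * Γ.fillingFraction i) +
      (∑ i, Γ'.multiplier i * Γ'.fillingFraction i) -
        ∑ i, Γ'.multiplier i * Γ.fillingFraction i := by
    rw [← Finset.sum_sub_distrib, ← Finset.sum_add_distrib, ← Finset.sum_sub_distrib]
    refine Finset.sum_congr rfl fun i _ => ?_
    ring
  rw [Γ.prepotential_eq_multiplier hdeg hlead, Γ'.prepotential_eq_multiplier hdeg hlead, e2, e3, e4,
    h.setIntegral_cuts fun s => W.eval (Γ'.lam s), p2, p4]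
  ring

end Close

end SpectralCurve

/-! ### First-order bounds for the variation of the prepotential. -/

namespace SpectralCurve

variable {m : ℕ} {W : ℂ[X]} {Γ Γ' : SpectralCurve m W} {θ : ℝ → ℝ} {D ε : ℝ}

namespace Close

variable (h : Close Γ Γ' θ D ε)
include h

theorem contDiff_lam_sub : ContDiff ℝ 1 fun u => Γ'.lam (θ u) - Γ.lam u :=
  ((Γ'.contDiff_lam.comp h.contDiff).sub Γ.contDiff_lam).of_le (by exact_mod_cast le_top)

theorem measurable_chordVar : Measurable (chordVar Γ Γ' θ) := by
  have h1 := h.contDiff_lam_sub.continuous.measurable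
  have h2 := Γ.path.continuous_lam.measurable
  exact ((h1.comp measurable_fst).sub (h1.comp measurable_snd)).div
    ((h2.comp measurable_fst).sub (h2.comp measurable_snd))

theorem ae_norm_mass_sub_le : ∀ᵐ u ∂(MeasureTheory.volume.restrict Γ.cuts),
    ‖pullMass Γ Γ' θ u - Γ.mass u‖ ≤ ε := by
  filter_upwards [Γ.ae_mem_cuts] with u hu using h.norm_mass_sub_le u hu

/-- Replacing the kernel difference by `chordVar` costs D², and replacing the second density by the
first costs Dε. What remains is the double integral of the loop equation, with η the displacement of
the path. -/
theorem norm_integral_pvLog_sub_le {M : ℝ} (hdeg : W.natDegree = m + 2)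
    (hlead : W.leadingCoeff = 1 / ((m : ℂ) + 2)) (hM : ∀ s, ‖Γ.mass s‖ ≤ M) :
    ‖(∫ q : ℝ × ℝ, (Γ'.path.pvLog (θ q.1) (θ q.2) - Γ.path.pvLog q.1 q.2) * Γ.mass q.1 *
        pullMass Γ Γ' θ q.2
        ∂((MeasureTheory.volume.restrict Γ.cuts).prod (MeasureTheory.volume.restrict Γ.cuts))) -
      ∫ u in Γ.cuts, (Γ'.lam (θ u) - Γ.lam u) * Γ.mass u * (derivative W).eval (Γ.lam u)‖ ≤
    (D ^ 2 * M * (M + 1) + D * M * ε) * ((MeasureTheory.volume.restrict Γ.cuts).prod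
      (MeasureTheory.volume.restrict Γ.cuts)).real Set.univ := by
  have := Γ.isFiniteMeasure_cuts
  have hm1 : Measurable fun q : ℝ × ℝ => Γ.mass q.1 := Γ.measurable_mass.comp measurable_fst
  have hm2 : Measurable fun q : ℝ × ℝ => Γ.mass q.2 := Γ.measurable_mass.comp measurable_snd
  have hn2 : Measurable fun q : ℝ × ℝ => pullMass Γ Γ' θ q.2 :=
    h.measurable_pullMass.comp measurable_snd
  have hM1 : ∀ᵐ q ∂((MeasureTheory.volume.restrict Γ.cuts).prod
      (MeasureTheory.volume.restrict Γ.cuts)), ‖Γ.mass q.1‖ ≤ M :=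
    Eventually.of_forall fun q => hM q.1
  have hξ : ∀ᵐ q ∂((MeasureTheory.volume.restrict Γ.cuts).prod
      (MeasureTheory.volume.restrict Γ.cuts)), ‖chordVar Γ Γ' θ q‖ ≤ D := by
    filter_upwards [Γ.ae_prod_cuts] with q hq
    exact h.norm_chordVar_le (Γ.cuts_subset_hull hq.1.1) (Γ.cuts_subset_hull hq.1.2)
  have hn : ∀ᵐ q ∂((MeasureTheory.volume.restrict Γ.cuts).prod
      (MeasureTheory.volume.restrict Γ.cuts)), ‖pullMass Γ Γ' θ q.2‖ ≤ M + 1 :=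
    Eventually.of_forall fun q => h.norm_pullMass_le hM q.2
  have hM2 : ∀ᵐ q ∂((MeasureTheory.volume.restrict Γ.cuts).prod
      (MeasureTheory.volume.restrict Γ.cuts)), ‖Γ.mass q.2‖ ≤ M :=
    Eventually.of_forall fun q => hM q.2
  have hk : ∀ᵐ q ∂((MeasureTheory.volume.restrict Γ.cuts).prod
      (MeasureTheory.volume.restrict Γ.cuts)), ‖Γ'.path.pvLog (θ q.1) (θ q.2) -
        Γ.path.pvLog q.1 q.2 - chordVar Γ Γ' θ q‖ ≤ D ^ 2 := by
    filter_upwards [Γ.ae_prod_cuts] with q hq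
    exact h.norm_pvLog_sub_sub_le (Γ.cuts_subset_hull hq.1.1) (Γ.cuts_subset_hull hq.1.2) hq.2
  have hd : ∀ᵐ q ∂((MeasureTheory.volume.restrict Γ.cuts).prod
      (MeasureTheory.volume.restrict Γ.cuts)), ‖pullMass Γ Γ' θ q.2 - Γ.mass q.2‖ ≤ ε := by
    filter_upwards [Γ.ae_prod_cuts] with q hq
    exact h.norm_mass_sub_le _ hq.1.2
  obtain ⟨i1, b1⟩ := MeasureTheory.integrable_mul_mul_of_bound
    (h.measurable_pvLog_sub.sub h.measurable_chordVar) hm1 hn2 hk hM1 hn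
  obtain ⟨i2, b2⟩ := MeasureTheory.integrable_mul_mul_of_bound h.measurable_chordVar hm1
    (hn2.sub hm2) hξ hM1 hd
  obtain ⟨i3, -⟩ := MeasureTheory.integrable_mul_mul_of_bound h.measurable_chordVar hm1 hm2
    hξ hM1 hM2
  simp only [Pi.sub_apply] at i1 b1 i2 b2
  have e := Γ.loop_equation hdeg hlead h.contDiff_lam_sub
  change ∫ q, chordVar Γ Γ' θ q * Γ.mass q.1 * Γ.mass q.2 ∂_ = _ at e
  rw [← e, ← MeasureTheory.integral_sub h.integrable_pvLog_sub_mul_mul i3, add_mul]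
  refine le_trans (le_of_eq ?_) ((norm_add_le _ _).trans (add_le_add b1 b2))
  rw [← MeasureTheory.integral_add i1 i2]
  congr 1
  refine MeasureTheory.integral_congr_ae (Eventually.of_forall fun q => ?_)
  ring

/-- Taylor expansion of W along the displacement, with the sum of the densities replaced by twice
the reference one, leaves the single integral of the loop equation. -/
theorem norm_integral_eval_sub_le {M K : ℝ} (hM : ∀ s, ‖Γ.mass s‖ ≤ M)
    (hK : ∀ u ∈ Γ.hull, ‖(derivative W).eval (Γ.lam u)‖ ≤ K)
    (hK' : ∀ u ∈ Γ.hull, ∀ x : ℂ, ‖x - Γ.lam u‖ ≤ 1 / 2 →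
      ‖W.eval x - W.eval (Γ.lam u) - (derivative W).eval (Γ.lam u) * (x - Γ.lam u)‖ ≤
        K * ‖x - Γ.lam u‖ ^ 2) :
    ‖(∫ u in Γ.cuts, (W.eval (Γ'.lam (θ u)) - W.eval (Γ.lam u)) *
        (Γ.mass u + pullMass Γ Γ' θ u)) / 2 -
      ∫ u in Γ.cuts, (Γ'.lam (θ u) - Γ.lam u) * Γ.mass u * (derivative W).eval (Γ.lam u)‖ ≤
    (K * D ^ 2 * (2 * M + 1) + D * K * ε) *
      (MeasureTheory.volume.restrict Γ.cuts).real Set.univ := by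
  have := Γ.isFiniteMeasure_cuts
  have hmm := Γ.measurable_mass
  have hmn := h.measurable_pullMass
  have hη := h.contDiff_lam_sub.continuous.measurable
  have hw := (Γ.continuous_eval_lam W).measurable
  have hw' := h.continuous_eval_map.measurable
  have hdw := (Γ.continuous_eval_lam (derivative W)).measurable
  have hηD : ∀ᵐ u ∂(MeasureTheory.volume.restrict Γ.cuts), ‖Γ'.lam (θ u) - Γ.lam u‖ ≤ D := by
    filter_upwards [Γ.ae_mem_cuts] with u hu using h.norm_sub_le u (Γ.cuts_subset_hull hu)
  have hdwK : ∀ᵐ u ∂(MeasureTheory.volume.restrict Γ.cuts),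
      ‖(derivative W).eval (Γ.lam u)‖ ≤ K := by
    filter_upwards [Γ.ae_mem_cuts] with u hu using hK u (Γ.cuts_subset_hull hu)
  have hs : ∀ u, ‖Γ.mass u + pullMass Γ Γ' θ u‖ ≤ 2 * M + 1 := fun u => by
    have := norm_add_le (Γ.mass u) (pullMass Γ Γ' θ u)
    linarith [hM u, h.norm_pullMass_le hM u]
  have hr : ∀ᵐ u ∂(MeasureTheory.volume.restrict Γ.cuts), ‖W.eval (Γ'.lam (θ u)) -
      W.eval (Γ.lam u) - (derivative W).eval (Γ.lam u) * (Γ'.lam (θ u) - Γ.lam u)‖ ≤ K * D ^ 2 := by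
    filter_upwards [Γ.ae_mem_cuts] with u hu
    have hu' := Γ.cuts_subset_hull hu
    have h1 := h.norm_sub_le u hu'
    have h2 := (norm_nonneg _).trans (hK u hu')
    refine (hK' u hu' _ (h1.trans h.le_half)).trans ?_
    gcongr
  have one : ∀ᵐ _u ∂(MeasureTheory.volume.restrict Γ.cuts), ‖(1 : ℂ)‖ ≤ 1 :=
    Eventually.of_forall fun _ => norm_one.le
  obtain ⟨i1, b1⟩ := MeasureTheory.integrable_mul_mul_of_bound ((hw'.sub hw).sub (hdw.mul hη))
    (hmm.add hmn) (measurable_const (a := (1 : ℂ))) hr (Eventually.of_forall hs) one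
  obtain ⟨i2, b2⟩ := MeasureTheory.integrable_mul_mul_of_bound hη hdw (hmn.sub hmm) hηD hdwK
    h.ae_norm_mass_sub_le
  obtain ⟨i3, -⟩ := MeasureTheory.integrable_mul_mul_of_bound hη hmm hdw hηD
    (Eventually.of_forall hM) hdwK
  simp only [Pi.sub_apply, Pi.add_apply, Pi.mul_apply, mul_one] at i1 b1 i2 b2 i3
  have e : (∫ u in Γ.cuts, (W.eval (Γ'.lam (θ u)) - W.eval (Γ.lam u)) *
        (Γ.mass u + pullMass Γ Γ' θ u)) =
      (∫ u in Γ.cuts, (W.eval (Γ'.lam (θ u)) - W.eval (Γ.lam u) -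
        (derivative W).eval (Γ.lam u) * (Γ'.lam (θ u) - Γ.lam u)) *
          (Γ.mass u + pullMass Γ Γ' θ u)) +
      (∫ u in Γ.cuts, (Γ'.lam (θ u) - Γ.lam u) * (derivative W).eval (Γ.lam u) *
        (pullMass Γ Γ' θ u - Γ.mass u)) +
      2 * ∫ u in Γ.cuts, (Γ'.lam (θ u) - Γ.lam u) * Γ.mass u * (derivative W).eval (Γ.lam u) := by
    have i4 := i1.add i2
    rw [← MeasureTheory.integral_const_mul, ← MeasureTheory.integral_add i1 i2]
    rw [← MeasureTheory.integral_add (by exact i4) (i3.const_mul 2)]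
    refine MeasureTheory.integral_congr_ae (Eventually.of_forall fun u => ?_)
    ring
  rw [e]
  have e2 : ∀ a b c : ℂ, (a + b + 2 * c) / 2 - c = (a + b) / 2 := fun a b c => by ring
  rw [e2, norm_div, Complex.norm_two, add_mul]
  exact (half_le_self (norm_nonneg _)).trans ((norm_add_le _ _).trans (add_le_add b1 b2))

/-- The multipliers need only be continuous: in the variation of the prepotential their difference
is multiplied by that of the filling fractions. The potential is compared at left end points, which
θ matches. -/
theorem norm_multiplier_sub_le {M K : ℝ} (hM : ∀ s, ‖Γ.mass s‖ ≤ M)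
    (hK : ∀ u ∈ Γ.hull, ‖(derivative W).eval (Γ.lam u)‖ ≤ K)
    (hK' : ∀ u ∈ Γ.hull, ∀ x : ℂ, ‖x - Γ.lam u‖ ≤ 1 / 2 →
      ‖W.eval x - W.eval (Γ.lam u) - (derivative W).eval (Γ.lam u) * (x - Γ.lam u)‖ ≤
        K * ‖x - Γ.lam u‖ ^ 2) (i : Fin (m + 1)) :
    ‖Γ'.multiplier i - Γ.multiplier i‖ ≤ 2 * K * D +
      2 * (2 * D * (M + 1) * (MeasureTheory.volume.restrict Γ.cuts).real Set.univ +
        ε * ∫ v in Γ.cuts, ‖Γ.path.pvLog (Γ.left i) v‖) := by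
  have := Γ.isFiniteMeasure_cuts
  have hi := Γ.cuts_subset_hull (Γ.mem_cuts (Γ.left_mem i))
  have hl := h.norm_sub_le _ hi
  have hK0 := (norm_nonneg _).trans (hK _ hi)
  have hD := h.nonneg
  have b1 : ‖W.eval (Γ'.lam (θ (Γ.left i))) - W.eval (Γ.lam (Γ.left i))‖ ≤ 2 * K * D := by
    have h1 := hK' _ hi _ (hl.trans h.le_half)
    have h2 := norm_add_le (W.eval (Γ'.lam (θ (Γ.left i))) - W.eval (Γ.lam (Γ.left i)) -
      (derivative W).eval (Γ.lam (Γ.left i)) * (Γ'.lam (θ (Γ.left i)) - Γ.lam (Γ.left i)))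
      ((derivative W).eval (Γ.lam (Γ.left i)) * (Γ'.lam (θ (Γ.left i)) - Γ.lam (Γ.left i)))
    rw [sub_add_cancel, norm_mul] at h2
    have h3 : ‖(derivative W).eval (Γ.lam (Γ.left i))‖ * ‖Γ'.lam (θ (Γ.left i)) - Γ.lam (Γ.left i)‖
        ≤ K * D := mul_le_mul (hK _ hi) hl (norm_nonneg _) hK0
    have h4 : K * ‖Γ'.lam (θ (Γ.left i)) - Γ.lam (Γ.left i)‖ ^ 2 ≤ K * D := by
      gcongr
      nlinarith [norm_nonneg (Γ'.lam (θ (Γ.left i)) - Γ.lam (Γ.left i)), h.le_half]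
    linarith
  have hne : ∀ᵐ v ∂(MeasureTheory.volume.restrict Γ.cuts), v ≠ Γ.left i :=
    MeasureTheory.Measure.ae_ne _ _
  have mk' : Measurable fun v => Γ'.path.pvLog (θ (Γ.left i)) (θ v) - Γ.path.pvLog (Γ.left i) v :=
    h.measurable_pvLog_sub.comp (measurable_const.prodMk measurable_id)
  obtain ⟨i2, b2⟩ := MeasureTheory.integrable_mul_mul_of_bound
    (ν := MeasureTheory.volume.restrict Γ.cuts) mk' h.measurable_pullMass
    (measurable_const (a := (1 : ℂ))) (a := 2 * D) (b := M + 1) (c := 1) (by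
      filter_upwards [hne, Γ.ae_mem_cuts] with v hv hv'
      exact h.norm_pvLog_sub_le (q := (Γ.left i, v)) hi (Γ.cuts_subset_hull hv') hv.symm)
    (Eventually.of_forall (h.norm_pullMass_le hM)) (Eventually.of_forall fun _ => norm_one.le)
  simp only [mul_one] at i2 b2
  have i3 : MeasureTheory.IntegrableOn (fun v => Γ.path.pvLog (Γ.left i) v * pullMass Γ Γ' θ v)
      Γ.cuts := Γ.path.integrableOn_pvLog_mul Γ.cuts_subset_hull h.measurable_pullMass
        (h.norm_pullMass_le hM) _
  have i4 := Γ.integrableOn_pvLog_mass (Γ.left i)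
  have i5 : MeasureTheory.IntegrableOn (fun v => Γ.path.pvLog (Γ.left i) v *
      (pullMass Γ Γ' θ v - Γ.mass v)) Γ.cuts := by
    simp_rw [mul_sub]
    exact i3.sub i4
  have b3 : ‖∫ v in Γ.cuts, Γ.path.pvLog (Γ.left i) v * (pullMass Γ Γ' θ v - Γ.mass v)‖ ≤
      ε * ∫ v in Γ.cuts, ‖Γ.path.pvLog (Γ.left i) v‖ := by
    rw [← MeasureTheory.integral_const_mul]
    refine MeasureTheory.norm_integral_le_of_norm_le
      (((Γ.path.integrableOn_pvLog _ _ _).mono_set Γ.cuts_subset_hull).norm.const_mul ε) ?_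
    filter_upwards [h.ae_norm_mass_sub_le] with v hv
    rw [norm_mul, mul_comm]
    gcongr
  have e : Γ'.multiplier i - Γ.multiplier i =
      (W.eval (Γ'.lam (θ (Γ.left i))) - W.eval (Γ.lam (Γ.left i))) -
      2 * ((∫ v in Γ.cuts, (Γ'.path.pvLog (θ (Γ.left i)) (θ v) - Γ.path.pvLog (Γ.left i) v) *
        pullMass Γ Γ' θ v) +
        ∫ v in Γ.cuts, Γ.path.pvLog (Γ.left i) v * (pullMass Γ Γ' θ v - Γ.mass v)) := by
    have e1 : (∫ v in Γ.cuts, Γ'.path.pvLog (θ (Γ.left i)) (θ v) * pullMass Γ Γ' θ v) -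
        ∫ v in Γ.cuts, Γ.path.pvLog (Γ.left i) v * Γ.mass v =
        (∫ v in Γ.cuts, (Γ'.path.pvLog (θ (Γ.left i)) (θ v) - Γ.path.pvLog (Γ.left i) v) *
        pullMass Γ Γ' θ v) +
        ∫ v in Γ.cuts, Γ.path.pvLog (Γ.left i) v * (pullMass Γ Γ' θ v - Γ.mass v) := by
      rw [← MeasureTheory.integral_add i2 i5, sub_eq_iff_eq_add]
      have i6 := i2.add i5
      rw [← MeasureTheory.integral_add (by exact i6) i4]
      refine MeasureTheory.integral_congr_ae (Eventually.of_forall fun v => ?_)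
      ring
    rw [h.multiplier_eq, ← e1, multiplier, potential]
    ring
  rw [e]
  refine (_root_.norm_sub_le _ _).trans (add_le_add b1 ?_)
  rw [norm_mul, Complex.norm_two]
  gcongr
  exact (norm_add_le _ _).trans (add_le_add b2 b3)

end Close

/-- The variation of the prepotential to first order. -/
theorem exists_bound_of_close (Γ : SpectralCurve m W) (hdeg : W.natDegree = m + 2)
    (hlead : W.leadingCoeff = 1 / ((m : ℂ) + 2)) :
    ∃ Q : ℝ, 0 ≤ Q ∧ ∀ Γ' θ D ε, Close Γ Γ' θ D ε →
      ‖Γ'.prepotential - Γ.prepotential + (∑ i, (Γ.multiplier i + Γ'.multiplier i) *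
        (Γ'.fillingFraction i - Γ.fillingFraction i)) / 2‖ ≤ Q * D * (D + ε) ∧
      ∀ i, ‖Γ'.multiplier i - Γ.multiplier i‖ ≤ Q * (D + ε) := by
  obtain ⟨M, hM⟩ := Γ.exists_bound_mass
  obtain ⟨K, hK0, hK, hK'⟩ := Γ.exists_bound_potential
  have hM0 : 0 ≤ M := (norm_nonneg _).trans (hM 0)
  set V₁ := (MeasureTheory.volume.restrict Γ.cuts).real Set.univ with hV₁
  set V₂ := ((MeasureTheory.volume.restrict Γ.cuts).prod
    (MeasureTheory.volume.restrict Γ.cuts)).real Set.univ with hV₂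
  have hV₁0 : 0 ≤ V₁ := MeasureTheory.measureReal_nonneg
  have hV₂0 : 0 ≤ V₂ := MeasureTheory.measureReal_nonneg
  have hI : ∀ i, 0 ≤ ∫ v in Γ.cuts, ‖Γ.path.pvLog (Γ.left i) v‖ := fun i =>
    MeasureTheory.integral_nonneg fun _ => norm_nonneg _
  set J := ∑ i, ∫ v in Γ.cuts, ‖Γ.path.pvLog (Γ.left i) v‖ with hJ
  have hJ0 : 0 ≤ J := Finset.sum_nonneg fun i _ => hI i
  set Q₁ := (M * (M + 1) + M) * V₂ + (K * (2 * M + 1) + K) * V₁ with hQ₁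
  set Q₂ := 2 * K + 2 * (2 * (M + 1) * V₁ + J) with hQ₂
  have hQ₁0 : 0 ≤ Q₁ := by positivity
  have hQ₂0 : 0 ≤ Q₂ := by positivity
  refine ⟨Q₁ + Q₂, by positivity, fun Γ' θ D ε h => ?_⟩
  have hD := h.nonneg
  have hε := h.eps_nonneg
  constructor
  · rw [h.prepotential_sub hdeg hlead]
    have h1 := h.norm_integral_pvLog_sub_le hdeg hlead hM
    have h2 := h.norm_integral_eval_sub_le hM hK hK'
    have h3 := (norm_sub_le _ _).trans (add_le_add h1 h2)
    -- By the loop equation both integrals have the same first-order part, so it cancels and only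
    -- products of two small quantities remain.
    rw [sub_sub_sub_cancel_right] at h3
    refine h3.trans ?_
    have h4 : (D ^ 2 * M * (M + 1) + D * M * ε) * V₂ +
        (K * D ^ 2 * (2 * M + 1) + D * K * ε) * V₁ ≤ Q₁ * D * (D + ε) := by
      have : Q₁ * D * (D + ε) = (D ^ 2 * M * (M + 1) + D * M * ε) * V₂ +
        (K * D ^ 2 * (2 * M + 1) + D * K * ε) * V₁ +
        (D ^ 2 * M * V₂ + D * M * (M + 1) * ε * V₂ + D ^ 2 * K * V₁ +
          D * K * (2 * M + 1) * ε * V₁) := by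
        rw [hQ₁]
        ring
      rw [this]
      exact le_add_of_nonneg_right (by positivity)
    refine h4.trans ?_
    gcongr
    linarith
  · intro i
    refine (h.norm_multiplier_sub_le hM hK hK' i).trans ?_
    have h5 : ∫ v in Γ.cuts, ‖Γ.path.pvLog (Γ.left i) v‖ ≤ J :=
      Finset.single_le_sum (f := fun i => ∫ v in Γ.cuts, ‖Γ.path.pvLog (Γ.left i) v‖)
        (fun i _ => hI i) (Finset.mem_univ i)
    calc _ ≤ 2 * K * D + 2 * (2 * D * (M + 1) * V₁ + ε * J) := by gcongr
      _ ≤ 2 * K * D + 2 * (2 * D * (M + 1) * V₁ + ε * J) +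
          (2 * K * ε + 2 * (2 * (M + 1) * V₁ * ε + J * D)) :=
        le_add_of_nonneg_right (by positivity)
      _ = Q₂ * (D + ε) := by
        rw [hQ₂]
        ring
      _ ≤ _ := by
        gcongr
        linarith

end SpectralCurve

/-! ### Estimates uniform along compact sets, and families of curves. -/

section Uniform

variable {E F : Type*} [NormedAddCommGroup E] [NormedAddCommGroup F] {U : Set E} {p₀ : E}

theorem ContinuousOn.eventually_norm_sub_lt {β : Type*} [TopologicalSpace β] {f : E × β → F}
    (hU : IsOpen U) (hp : p₀ ∈ U) (hf : ContinuousOn f (U ×ˢ Set.univ)) {K : Set β}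
    (hK : IsCompact K) {ε : ℝ} (hε : 0 < ε) :
    ∀ᶠ p in 𝓝 p₀, ∀ b ∈ K, ‖f (p, b) - f (p₀, b)‖ < ε := by
  refine hK.eventually_forall_of_forall_eventually
    (P := fun p b => ‖f (p, b) - f (p₀, b)‖ < ε) fun b _ => ?_
  have h1 : ∀ x ∈ U, ContinuousAt f (x, b) := fun x hx =>
    hf.continuousAt ((hU.prod isOpen_univ).mem_nhds ⟨hx, trivial⟩)
  have h2 : ContinuousAt (fun z : E × β => f (p₀, z.2)) (p₀, b) :=
    ContinuousAt.comp (f := fun z : E × β => (p₀, z.2)) (h1 p₀ hp) (by fun_prop)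
  have h3 := ((h1 p₀ hp).sub h2).norm
  have h4 : Tendsto (fun z : E × β => ‖f z - f (p₀, z.2)‖) (𝓝 (p₀, b)) (𝓝 0) := by
    simpa [ContinuousAt] using h3
  exact h4.eventually_lt_const hε

variable [NormedSpace ℝ E] [NormedSpace ℝ F]

/-- A C¹ function is locally Lipschitz; compactness of K makes the constant uniform. -/
theorem ContDiffOn.exists_eventually_norm_sub_le {f : E × ℝ → F} (hU : IsOpen U) (hp : p₀ ∈ U)
    (hf : ContDiffOn ℝ 1 f (U ×ˢ Set.univ)) {K : Set ℝ} (hK : IsCompact K) :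
    ∃ C : ℝ, ∀ᶠ p in 𝓝 p₀, ∀ u ∈ K, ‖f (p, u) - f (p₀, u)‖ ≤ C * ‖p - p₀‖ := by
  refine hK.induction_on
    (p := fun K => ∃ C : ℝ, ∀ᶠ p in 𝓝 p₀, ∀ u ∈ K, ‖f (p, u) - f (p₀, u)‖ ≤ C * ‖p - p₀‖)
    ⟨0, by simp⟩ (fun s t hst ht => ?_) (fun s t hs ht => ?_) fun u _ => ?_
  · obtain ⟨C, hC⟩ := ht
    exact ⟨C, hC.mono fun p hp u hu => hp u (hst hu)⟩
  · obtain ⟨C₁, h₁⟩ := hs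
    obtain ⟨C₂, h₂⟩ := ht
    refine ⟨max C₁ C₂, ?_⟩
    filter_upwards [h₁, h₂] with p a b u hu
    rcases hu with hu | hu
    · refine (a u hu).trans ?_
      gcongr
      exact le_max_left _ _
    · refine (b u hu).trans ?_
      gcongr
      exact le_max_right _ _
  · have h1 : ContDiffAt ℝ 1 f (p₀, u) :=
      hf.contDiffAt ((hU.prod isOpen_univ).mem_nhds ⟨hp, trivial⟩)
    obtain ⟨C, t, ht, hC⟩ := h1.exists_lipschitzOnWith
    obtain ⟨a, ha, b, hb, hab⟩ := mem_nhds_prod_iff.1 ht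
    refine ⟨b, mem_nhdsWithin_of_mem_nhds hb, C, ?_⟩
    filter_upwards [ha] with p hpa v hv
    have h2 := hC.norm_sub_le (hab (Set.mk_mem_prod hpa hv))
      (hab (Set.mk_mem_prod (mem_of_mem_nhds ha) hv))
    refine h2.trans (le_of_eq ?_)
    simp [Prod.norm_def]

theorem ContDiffOn.hasDerivAt_snd {f : E × ℝ → F} (hU : IsOpen U) (hp : p₀ ∈ U)
    (hf : ContDiffOn ℝ ∞ f (U ×ˢ Set.univ)) (u : ℝ) :
    HasDerivAt (fun u => f (p₀, u)) (fderiv ℝ f (p₀, u) (0, 1)) u := by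
  have h1 : HasFDerivAt f (fderiv ℝ f (p₀, u)) (p₀, u) :=
    ((hf.contDiffAt ((hU.prod isOpen_univ).mem_nhds ⟨hp, trivial⟩)).differentiableAt
      (by simp)).hasFDerivAt
  exact h1.comp_hasDerivAt u ((hasDerivAt_const u p₀).prodMk (hasDerivAt_id u))

theorem ContDiffOn.fderiv_snd {f : E × ℝ → F} (hU : IsOpen U)
    (hf : ContDiffOn ℝ ∞ f (U ×ˢ Set.univ)) :
    ContDiffOn ℝ ∞ (fun q => fderiv ℝ f q (0, 1)) (U ×ˢ Set.univ) :=
  (hf.fderiv_of_isOpen (m := ∞) (hU.prod isOpen_univ) (by simp)).clm_apply contDiffOn_const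

end Uniform

namespace SpectralCurve

variable {m : ℕ} {W : ℂ[X]}

/-- The end points of the cuts. -/
def endpoint (Γ : SpectralCurve m W) : Fin (m + 1) ⊕ Fin (m + 1) → ℝ := Sum.elim Γ.left Γ.right

theorem injective_endpoint (Γ : SpectralCurve m W) : Function.Injective Γ.endpoint := by
  have h1 : ∀ i j, i < j → Γ.left i < Γ.left j := fun i j hij =>
    (Γ.left_lt_right i).trans (Γ.right_lt_left i j hij)
  have h2 : ∀ i j, i < j → Γ.right i < Γ.right j := fun i j hij =>
    (Γ.right_lt_left i j hij).trans (Γ.left_lt_right j)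
  have h3 : ∀ i j, Γ.left i ≠ Γ.right j := by
    intro i j
    rcases lt_trichotomy i j with h | h | h
    · exact ((Γ.left_lt_right i).trans (h2 i j h)).ne
    · exact h ▸ (Γ.left_lt_right i).ne
    · exact (Γ.right_lt_left j i h).ne'
  refine Function.Injective.sumElim ?_ ?_ h3
  · exact (StrictMono.injective fun i j hij => h1 i j hij)
  · exact (StrictMono.injective fun i j hij => h2 i j hij)

/-- A change of parameter, close to the identity for curves close to each other, which identifies
the end points of the cuts of two curves. -/
noncomputable def interp (Γ Γ' : SpectralCurve m W) (u : ℝ) : ℝ :=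
  u + ∑ k, (Γ'.endpoint k - Γ.endpoint k) * (Lagrange.basis Finset.univ Γ.endpoint k).eval u

theorem interp_self (Γ : SpectralCurve m W) (u : ℝ) : interp Γ Γ u = u := by simp [interp]

theorem interp_endpoint (Γ Γ' : SpectralCurve m W) (k : Fin (m + 1) ⊕ Fin (m + 1)) :
    interp Γ Γ' (Γ.endpoint k) = Γ'.endpoint k := by
  rw [interp, Finset.sum_eq_single k, Lagrange.eval_basis_self Γ.injective_endpoint.injOn
    (Finset.mem_univ k)]
  · ring
  · intro j _ hj
    rw [Lagrange.eval_basis_of_ne hj (Finset.mem_univ k), mul_zero]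
  · simp

theorem contDiff_interp (Γ Γ' : SpectralCurve m W) : ContDiff ℝ ∞ (interp Γ Γ') :=
  contDiff_id.add (ContDiff.sum fun _ _ => contDiff_const.mul (by
    simpa [Polynomial.coe_aeval_eq_eval] using
      (Lagrange.basis Finset.univ Γ.endpoint _).contDiff_aeval (𝕜 := ℝ) ∞))

theorem deriv_interp (Γ Γ' : SpectralCurve m W) (u : ℝ) : deriv (interp Γ Γ') u =
    1 + ∑ k, (Γ'.endpoint k - Γ.endpoint k) *
      (derivative (Lagrange.basis Finset.univ Γ.endpoint k)).eval u :=
  ((hasDerivAt_id u).add (HasDerivAt.fun_sum fun k _ =>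
    ((Lagrange.basis Finset.univ Γ.endpoint k).hasDerivAt u).const_mul
      (Γ'.endpoint k - Γ.endpoint k))).deriv

end SpectralCurve

namespace IsSpecialCoordinateFamily

open SpectralCurve

variable {m : ℕ} {W : ℂ[X]} {U : Set (ℂ × (Fin m → ℂ))} {Γ : ℂ × (Fin m → ℂ) → SpectralCurve m W}
  (hΓ : IsSpecialCoordinateFamily U Γ)
include hΓ

theorem contDiffOn_endpoint (k : Fin (m + 1) ⊕ Fin (m + 1)) :
    ContDiffOn ℝ ∞ (fun p => (Γ p).endpoint k) U := by
  rcases k with i | i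
  · exact hΓ.contDiffOn_left i
  · exact hΓ.contDiffOn_right i

theorem contDiffOn_interp (p₀ : ℂ × (Fin m → ℂ)) : ContDiffOn ℝ ∞
    (fun q : (ℂ × (Fin m → ℂ)) × ℝ => interp (Γ p₀) (Γ q.1) q.2) (U ×ˢ Set.univ) := by
  refine contDiffOn_snd.add (ContDiffOn.sum fun k _ => ContDiffOn.mul ?_ ?_)
  · exact ((hΓ.contDiffOn_endpoint k).comp contDiffOn_fst fun q hq => hq.1).sub contDiffOn_const
  · have h1 := (Lagrange.basis Finset.univ (Γ p₀).endpoint k).contDiff_aeval (𝕜 := ℝ) ∞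
    simp only [Polynomial.coe_aeval_eq_eval] at h1
    exact (h1.comp contDiff_snd).contDiffOn

theorem continuousOn_deriv_interp (p₀ : ℂ × (Fin m → ℂ)) : ContinuousOn
    (fun q : (ℂ × (Fin m → ℂ)) × ℝ => deriv (interp (Γ p₀) (Γ q.1)) q.2) (U ×ˢ Set.univ) := by
  simp_rw [deriv_interp]
  refine continuousOn_const.add (continuousOn_finsetSum _ fun k _ => ContinuousOn.mul ?_ ?_)
  · exact ((hΓ.contDiffOn_endpoint k).continuousOn.comp continuousOn_fst fun q hq => hq.1).sub
      continuousOn_const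
  · exact ((Polynomial.continuous _).comp continuous_snd).continuousOn

/-- The path in the parameter of a reference curve. -/
theorem contDiffOn_lam_interp (p₀ : ℂ × (Fin m → ℂ)) : ContDiffOn ℝ ∞
    (fun q : (ℂ × (Fin m → ℂ)) × ℝ => (Γ q.1).lam (interp (Γ p₀) (Γ q.1) q.2))
    (U ×ˢ Set.univ) :=
  hΓ.contDiffOn_lam.comp (contDiffOn_fst.prodMk (hΓ.contDiffOn_interp p₀))
    fun _ hq => ⟨hq.1, trivial⟩

theorem continuousOn_deriv_lam : ContinuousOn
    (fun q : (ℂ × (Fin m → ℂ)) × ℝ => deriv (Γ q.1).lam q.2) (U ×ˢ Set.univ) :=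
  (hΓ.contDiffOn_lam.fderiv_snd hΓ.isOpen).continuousOn.congr fun q hq =>
    (hΓ.contDiffOn_lam.hasDerivAt_snd hΓ.isOpen hq.1 q.2).deriv

theorem continuousOn_edge (i : Fin (m + 1)) : ContinuousOn
    (fun q : (ℂ × (Fin m → ℂ)) × ℝ => (Γ q.1).edge i q.2) (U ×ˢ Set.univ) := by
  have hl : ContinuousOn (fun q : (ℂ × (Fin m → ℂ)) × ℝ => (Γ q.1).left i) (U ×ˢ Set.univ) :=
    (hΓ.contDiffOn_left i).continuousOn.comp continuousOn_fst fun q hq => hq.1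
  have hr : ContinuousOn (fun q : (ℂ × (Fin m → ℂ)) × ℝ => (Γ q.1).right i) (U ×ˢ Set.univ) :=
    (hΓ.contDiffOn_right i).continuousOn.comp continuousOn_fst fun q hq => hq.1
  have h1 : ContinuousOn (fun q : (ℂ × (Fin m → ℂ)) × ℝ => (Γ q.1).logQuot ((Γ q.1).left i) q.2)
      (U ×ˢ Set.univ) :=
    hΓ.continuousOn_logQuot.comp (continuousOn_fst.prodMk (hl.prodMk continuousOn_snd))
      fun q hq => ⟨hq.1, trivial⟩
  have h2 : ContinuousOn (fun q : (ℂ × (Fin m → ℂ)) × ℝ => (Γ q.1).logQuot ((Γ q.1).right i) q.2)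
      (U ×ˢ Set.univ) :=
    hΓ.continuousOn_logQuot.comp (continuousOn_fst.prodMk (hr.prodMk continuousOn_snd))
      fun q hq => ⟨hq.1, trivial⟩
  have h3 : ∀ {a : (ℂ × (Fin m → ℂ)) × ℝ → ℝ}, ContinuousOn a (U ×ˢ Set.univ) → ContinuousOn
      (fun q : (ℂ × (Fin m → ℂ)) × ℝ => (Real.sqrt |q.2 - a q| : ℂ)) (U ×ˢ Set.univ) :=
    fun ha => Complex.continuous_ofReal.comp_continuousOn
      (Real.continuous_sqrt.comp_continuousOn (continuousOn_snd.sub ha).abs)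
  exact ((h3 hl).mul (h3 hr)).mul ((h2.add h1).div_const 2).cexp

theorem continuousOn_amplitude : ContinuousOn
    (fun q : (ℂ × (Fin m → ℂ)) × ℝ => (Γ q.1).amplitude q.2) (U ×ˢ Set.univ) :=
  (continuousOn_const.mul hΓ.continuousOn_deriv_lam).mul
    (continuousOn_finsetProd _ fun i _ => hΓ.continuousOn_edge i)

theorem continuousOn_amplitude_interp (p₀ : ℂ × (Fin m → ℂ)) : ContinuousOn
    (fun q : (ℂ × (Fin m → ℂ)) × ℝ => (Γ q.1).amplitude (interp (Γ p₀) (Γ q.1) q.2) *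
      deriv (interp (Γ p₀) (Γ q.1)) q.2) (U ×ˢ Set.univ) :=
  (hΓ.continuousOn_amplitude.comp
    (continuousOn_fst.prodMk (hΓ.contDiffOn_interp p₀).continuousOn)
    fun _ hq => ⟨hq.1, trivial⟩).mul
    (Complex.continuous_ofReal.comp_continuousOn (hΓ.continuousOn_deriv_interp p₀))

theorem continuousOn_logQuot_interp (p₀ : ℂ × (Fin m → ℂ)) : ContinuousOn
    (fun q : (ℂ × (Fin m → ℂ)) × ℝ × ℝ => (Γ q.1).logQuot (interp (Γ p₀) (Γ q.1) q.2.1)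
      (interp (Γ p₀) (Γ q.1) q.2.2)) (U ×ˢ Set.univ) := by
  have h1 : ContinuousOn (fun q : (ℂ × (Fin m → ℂ)) × ℝ × ℝ => interp (Γ p₀) (Γ q.1) q.2.1)
      (U ×ˢ Set.univ) :=
    (hΓ.contDiffOn_interp p₀).continuousOn.comp (f := fun q : (ℂ × (Fin m → ℂ)) × ℝ × ℝ =>
      (q.1, q.2.1)) (by fun_prop) fun _ hq => ⟨hq.1, trivial⟩
  have h2 : ContinuousOn (fun q : (ℂ × (Fin m → ℂ)) × ℝ × ℝ => interp (Γ p₀) (Γ q.1) q.2.2)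
      (U ×ˢ Set.univ) :=
    (hΓ.contDiffOn_interp p₀).continuousOn.comp (f := fun q : (ℂ × (Fin m → ℂ)) × ℝ × ℝ =>
      (q.1, q.2.2)) (by fun_prop) fun _ hq => ⟨hq.1, trivial⟩
  exact hΓ.continuousOn_logQuot.comp (continuousOn_fst.prodMk (h1.prodMk h2))
    fun _ hq => ⟨hq.1, trivial⟩

variable {p₀ : ℂ × (Fin m → ℂ)} (hp₀ : p₀ ∈ U)
include hp₀

/-- In the reference parameter the supports coincide, so the discontinuous sign factor is common and
only the jointly continuous amplitudes are compared. No rate in p is claimed: square roots of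
distances to the moving end points occur in `edge`. -/
theorem eventually_mass_sub_le {ε : ℝ} (hε : 0 < ε) : ∀ᶠ p in 𝓝 p₀, ∀ u ∈ (Γ p₀).cuts,
    ‖pullMass (Γ p₀) (Γ p) (interp (Γ p₀) (Γ p)) u - (Γ p₀).mass u‖ ≤ ε := by
  have hs : ∀ i : Fin (m + 1), ‖sign i‖ ≤ 1 := fun i => by
    rw [sign, norm_prod]
    refine Finset.prod_le_one (fun _ _ => norm_nonneg _) fun j _ => ?_
    split_ifs <;> simp
  filter_upwards [(hΓ.continuousOn_amplitude_interp p₀).eventually_norm_sub_lt hΓ.isOpen hp₀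
    (Γ p₀).isCompact_cuts hε] with p hp u hu
  obtain ⟨i, hi⟩ := Set.mem_iUnion.1 hu
  have h1 : deriv (interp (Γ p₀) (Γ p₀)) u = 1 := by
    rw [show interp (Γ p₀) (Γ p₀) = id from funext fun u => interp_self _ u, deriv_id]
  have h2 := hp u hu
  simp only [interp_self, h1, Complex.ofReal_one, mul_one] at h2
  rw [pullMass, mass, ← mul_sub, (Γ p₀).signFun_of_mem hi, norm_mul]
  exact (mul_le_of_le_one_left (norm_nonneg _) (hs i)).trans h2.le

/-- Here the continuity of the chosen logarithms in the parameters is used: it excludes a jump by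
2πi between neighbouring curves. -/
theorem eventually_abs_im_lt : ∀ᶠ p in 𝓝 p₀, ∀ u ∈ (Γ p₀).hull, ∀ v ∈ (Γ p₀).hull,
    |((Γ p).path.ell (interp (Γ p₀) (Γ p) u) (interp (Γ p₀) (Γ p) v) -
      (Γ p₀).path.ell u v).im| < Real.pi := by
  filter_upwards [(hΓ.continuousOn_logQuot_interp p₀).eventually_norm_sub_lt hΓ.isOpen hp₀
    (K := (Γ p₀).hull ×ˢ (Γ p₀).hull) (isCompact_Icc.prod isCompact_Icc) Real.pi_pos]
    with p hp u hu v hv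
  have h2 := hp (u, v) ⟨hu, hv⟩
  simp only [interp_self] at h2
  exact (Complex.abs_im_le_norm _).trans_lt h2

theorem eventually_chart :
    ∀ᶠ p in 𝓝 p₀, Chart (Γ p₀) (Γ p) (interp (Γ p₀) (Γ p)) := by
  filter_upwards [(hΓ.continuousOn_deriv_interp p₀).eventually_norm_sub_lt hΓ.isOpen hp₀
    (K := (Γ p₀).hull) isCompact_Icc one_pos] with p hp
  refine ⟨contDiff_interp _ _, fun u hu => ?_, fun i => interp_endpoint (Γ p₀) (Γ p) (.inl i),
    fun i => interp_endpoint (Γ p₀) (Γ p) (.inr i)⟩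
  have h1 := hp u hu
  simp only [show interp (Γ p₀) (Γ p₀) = id from funext fun u => interp_self _ u, deriv_id,
    Real.norm_eq_abs] at h1
  linarith [(abs_lt.1 h1).1]

/-- The Lipschitz estimate in p is applied to the path and to its derivative in the path parameter.
The second, through the mean value inequality, bounds increments of the displacement by |u − v|,
which the chord dominates up to the constant c. -/
theorem exists_eventually_lam_sub_le : ∃ K : ℝ, ∀ᶠ p in 𝓝 p₀,
    (∀ u ∈ (Γ p₀).hull, ‖(Γ p).lam (interp (Γ p₀) (Γ p) u) - (Γ p₀).lam u‖ ≤ K * ‖p - p₀‖) ∧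
    ∀ u ∈ (Γ p₀).hull, ∀ v ∈ (Γ p₀).hull,
      ‖((Γ p).lam (interp (Γ p₀) (Γ p) u) - (Γ p₀).lam u) -
        ((Γ p).lam (interp (Γ p₀) (Γ p) v) - (Γ p₀).lam v)‖ ≤
          K * ‖p - p₀‖ * ‖(Γ p₀).lam u - (Γ p₀).lam v‖ := by
  have hX := hΓ.contDiffOn_lam_interp p₀
  obtain ⟨K₁, h₁⟩ := (hX.of_le (by exact_mod_cast le_top)).exists_eventually_norm_sub_le
    hΓ.isOpen hp₀ (K := (Γ p₀).hull) isCompact_Icc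
  obtain ⟨K₂, h₂⟩ := ((hX.fderiv_snd hΓ.isOpen).of_le
    (by exact_mod_cast le_top)).exists_eventually_norm_sub_le hΓ.isOpen hp₀
      (K := (Γ p₀).hull) isCompact_Icc
  obtain ⟨C, c, hG⟩ := (Γ p₀).path.exists_bounds ((Γ p₀).left 0) ((Γ p₀).right (Fin.last m))
  have hc := hG.c_pos
  refine ⟨max K₁ (K₂ / c), ?_⟩
  filter_upwards [h₁, h₂, hΓ.isOpen.mem_nhds hp₀] with p e1 e2 hp
  refine ⟨fun u hu => ?_, fun u hu v hv => ?_⟩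
  · have h3 := e1 u hu
    simp only [interp_self] at h3
    refine h3.trans ?_
    gcongr
    exact le_max_left _ _
  · have hd : ∀ x ∈ (Γ p₀).hull, HasDerivWithinAt
        (fun u => (Γ p).lam (interp (Γ p₀) (Γ p) u) - (Γ p₀).lam u) _ (Γ p₀).hull x := fun x _ => by
      have h4 := (hX.hasDerivAt_snd hΓ.isOpen hp x).sub (hX.hasDerivAt_snd hΓ.isOpen hp₀ x)
      simp only [interp_self] at h4
      exact h4.hasDerivWithinAt
    have h3 := (convex_Icc _ _).norm_image_sub_le_of_norm_hasDerivWithin_le hd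
      (fun x hx => by simpa only [interp_self] using e2 x hx) hv hu
    refine h3.trans ?_
    have h4 := hG.lower u hu v hv
    have h5 : c * ‖u - v‖ ≤ ‖(Γ p₀).lam u - (Γ p₀).lam v‖ := by
      have h6 := (Γ p₀).path.exp_ell u v
      change _ = (Γ p₀).lam u - (Γ p₀).lam v at h6
      rw [← h6, norm_mul, ← Complex.ofReal_sub, Complex.norm_real]
      gcongr
    have h7 : K₂ * ‖p - p₀‖ * ‖u - v‖ = K₂ / c * ‖p - p₀‖ * (c * ‖u - v‖) := by
      field_simp
    rw [h7]
    have h8 : K₂ / c * ‖p - p₀‖ ≤ max K₁ (K₂ / c) * ‖p - p₀‖ := by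
      gcongr
      exact le_max_right _ _
    have h9 : 0 ≤ max K₁ (K₂ / c) * ‖p - p₀‖ := (norm_nonneg _).trans ((e1 u hu).trans (by
      gcongr
      exact le_max_left _ _))
    calc _ ≤ max K₁ (K₂ / c) * ‖p - p₀‖ * (c * ‖u - v‖) := by gcongr
      _ ≤ _ := by gcongr

/-- The order of quantifiers is essential: the Lipschitz constant K of the paths does not depend on
the tolerance ε for the densities. -/
theorem exists_eventually_close : ∃ K : ℝ, 0 ≤ K ∧ ∀ ε > 0, ε ≤ 1 → ∀ᶠ p in 𝓝 p₀,
    Close (Γ p₀) (Γ p) (interp (Γ p₀) (Γ p)) (K * ‖p - p₀‖) ε := by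
  obtain ⟨K, hK⟩ := hΓ.exists_eventually_lam_sub_le hp₀
  refine ⟨max K 0, le_max_right _ _, fun ε hε hε1 => ?_⟩
  have h1 : Tendsto (fun p => max K 0 * ‖p - p₀‖) (𝓝 p₀) (𝓝 0) := by
    have : Continuous fun p => max K 0 * ‖p - p₀‖ := by fun_prop
    simpa using this.tendsto p₀
  filter_upwards [hK, hΓ.eventually_chart hp₀, hΓ.eventually_abs_im_lt hp₀,
    hΓ.eventually_mass_sub_le hp₀ hε, h1.eventually_le_const (by norm_num : (0 : ℝ) < 1 / 2)]
    with p e1 e2 e3 e4 e5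
  have h2 : K * ‖p - p₀‖ ≤ max K 0 * ‖p - p₀‖ := by
    gcongr
    exact le_max_left _ _
  exact {
    toChart := e2
    nonneg := by positivity
    le_half := e5
    le_one := hε1
    norm_sub_le := fun u hu => (e1.1 u hu).trans h2
    norm_sub_sub_le := fun u hu v hv => (e1.2 u hu v hv).trans (by gcongr)
    abs_im_lt := e3
    norm_mass_sub_le := e4 }

end IsSpecialCoordinateFamily

/-! ### The differential of the prepotential, and the homogeneity relation. -/

namespace IsSpecialCoordinateFamily

open SpectralCurve

variable {m : ℕ} {W : ℂ[X]} {U : Set (ℂ × (Fin m → ℂ))} {Γ : ℂ × (Fin m → ℂ) → SpectralCurve m W}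
  (hΓ : IsSpecialCoordinateFamily U Γ)
include hΓ

/-- The filling fractions are linear functions of the special coordinates. -/
theorem exists_fillingFraction_eq (hdeg : W.natDegree = m + 2)
    (hlead : W.leadingCoeff = 1 / ((m : ℂ) + 2)) :
    ∃ A : Fin (m + 1) → (ℂ × (Fin m → ℂ)) →L[ℂ] ℂ,
      ∀ p ∈ U, ∀ i, (Γ p).fillingFraction i = A i p := by
  -- The partial sums are the coordinates themselves, the last one being t since all filling
  -- fractions add up to t; the A i are successive differences.
  let T : Fin (m + 1) → (ℂ × (Fin m → ℂ)) →L[ℂ] ℂ := Fin.lastCases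
    (ContinuousLinearMap.fst ℂ ℂ (Fin m → ℂ))
    fun i => (ContinuousLinearMap.proj i).comp (ContinuousLinearMap.snd ℂ ℂ (Fin m → ℂ))
  have hT : ∀ p ∈ U, ∀ i, ∑ j ∈ Finset.Iic i, (Γ p).fillingFraction j = T i p := by
    intro p hp i
    induction i using Fin.lastCases with
    | last =>
      have h1 : Finset.Iic (Fin.last m) = Finset.univ := by
        ext j
        simp [Fin.le_last]
      simp only [T, Fin.lastCases_last, h1, (Γ p).sum_fillingFraction hdeg hlead, hΓ.t_eq p hp]
      rfl
    | cast i =>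
      simp only [T, Fin.lastCases_castSucc]
      exact hΓ.partialSum_eq p hp i
  refine ⟨Fin.cases (T 0) fun j => T j.succ - T j.castSucc, fun p hp i => ?_⟩
  induction i using Fin.cases with
  | zero =>
    change _ = T 0 p
    rw [← hT p hp 0]
    have h1 : Finset.Iic (0 : Fin (m + 1)) = {0} := by
      ext j
      simp
    rw [h1, Finset.sum_singleton]
  | succ j =>
    change _ = (T j.succ - T j.castSucc) p
    rw [sub_apply, ← hT p hp, ← hT p hp]
    have h1 : Finset.Iic j.succ = insert j.succ (Finset.Iic j.castSucc) := by
      ext l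
      simp only [Finset.mem_Iic, Finset.mem_insert, Fin.le_def, Fin.ext_iff, Fin.val_succ,
        Fin.val_castSucc]
      omega
    rw [h1, Finset.sum_insert (by simp [Fin.le_def]), add_sub_cancel_right]

/-- The averaged multipliers ½(L_i + L_i') may be replaced by L_i, since L_i' − L_i is small and the
filling fractions vary linearly. The total error is (r + ε) B ‖p − p₀‖ with r = K‖p − p₀‖ and ε
arbitrarily small. -/
theorem hasFDerivAt_prepotential (hdeg : W.natDegree = m + 2)
    (hlead : W.leadingCoeff = 1 / ((m : ℂ) + 2)) {A : Fin (m + 1) → (ℂ × (Fin m → ℂ)) →L[ℂ] ℂ}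
    (hA : ∀ p ∈ U, ∀ i, (Γ p).fillingFraction i = A i p) {p₀ : ℂ × (Fin m → ℂ)} (hp₀ : p₀ ∈ U) :
    HasFDerivAt (fun p => (Γ p).prepotential) (-∑ i, (Γ p₀).multiplier i • A i) p₀ := by
  obtain ⟨Q, hQ0, hQ⟩ := (Γ p₀).exists_bound_of_close hdeg hlead
  obtain ⟨K, hK0, hK⟩ := hΓ.exists_eventually_close hp₀
  set B := Q * (K + (∑ i, ‖A i‖) / 2) with hB
  have hA0 : 0 ≤ ∑ i, ‖A i‖ := Finset.sum_nonneg fun i _ => norm_nonneg _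
  have hB0 : 0 ≤ B := by positivity
  rw [hasFDerivAt_iff_isLittleO, Asymptotics.isLittleO_iff]
  intro c hc
  -- Chosen so that 2εB ≤ c, and at most 1 as `Close` requires; adding 1 to B avoids a vanishing
  -- denominator.
  set ε := min 1 (c / (2 * (B + 1))) with hε
  have hε0 : 0 < ε := by positivity
  have hεc : 2 * ε * B ≤ c := by
    have h1 : ε ≤ c / (2 * (B + 1)) := min_le_right _ _
    rw [le_div_iff₀ (by positivity)] at h1
    nlinarith
  have h1 : Tendsto (fun p => K * ‖p - p₀‖) (𝓝 p₀) (𝓝 0) := by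
    have : Continuous fun p => K * ‖p - p₀‖ := by fun_prop
    simpa using this.tendsto p₀
  filter_upwards [hK ε hε0 (min_le_left _ _), h1.eventually_le_const hε0,
    hΓ.isOpen.mem_nhds hp₀] with p hclose hle hp
  obtain ⟨b1, b2⟩ := hQ _ _ _ _ hclose
  have hS : ∀ i, (Γ p).fillingFraction i - (Γ p₀).fillingFraction i = A i (p - p₀) := fun i => by
    rw [hA p hp, hA p₀ hp₀, map_sub]
  simp_rw [hS] at b1
  set r := K * ‖p - p₀‖ with hr
  have hr0 : 0 ≤ r := by positivity
  have e : (Γ p).prepotential - (Γ p₀).prepotential -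
      (-∑ i, (Γ p₀).multiplier i • A i) (p - p₀) =
      ((Γ p).prepotential - (Γ p₀).prepotential +
        (∑ i, ((Γ p₀).multiplier i + (Γ p).multiplier i) * A i (p - p₀)) / 2) -
        (∑ i, ((Γ p).multiplier i - (Γ p₀).multiplier i) * A i (p - p₀)) / 2 := by
    have e1 : (-∑ i, (Γ p₀).multiplier i • A i) (p - p₀) =
        -∑ i, (Γ p₀).multiplier i * A i (p - p₀) := by
      simp
    rw [e1]
    simp only [add_mul, sub_mul, Finset.sum_add_distrib, Finset.sum_sub_distrib]
    ring
  rw [e]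
  have b3 : ‖(∑ i, ((Γ p).multiplier i - (Γ p₀).multiplier i) * A i (p - p₀)) / 2‖ ≤
      Q * (r + ε) * ((∑ i, ‖A i‖) / 2) * ‖p - p₀‖ := by
    rw [norm_div, Complex.norm_two, mul_div_assoc', div_mul_eq_mul_div, Finset.mul_sum,
      Finset.sum_mul]
    gcongr
    refine norm_sum_le_of_le _ fun i _ => ?_
    rw [norm_mul, mul_assoc]
    exact mul_le_mul (b2 i) ((A i).le_opNorm _) (norm_nonneg _) (by positivity)
  refine (norm_sub_le _ _).trans ((add_le_add b1 b3).trans ?_)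
  calc Q * r * (r + ε) + Q * (r + ε) * ((∑ i, ‖A i‖) / 2) * ‖p - p₀‖
      = (r + ε) * B * ‖p - p₀‖ := by
        rw [hB, hr]
        ring
    _ ≤ (ε + ε) * B * ‖p - p₀‖ := by gcongr
    _ = (2 * ε * B) * ‖p - p₀‖ := by ring
    _ ≤ c * ‖p - p₀‖ := by gcongr

end IsSpecialCoordinateFamily

theorem mainTheorem3 (m : ℕ) (W : ℂ[X]) (hdeg : W.natDegree = m + 2)
    (hlead : W.leadingCoeff = 1 / ((m : ℂ) + 2))
    (U : Set (ℂ × (Fin m → ℂ))) (Γ : ℂ × (Fin m → ℂ) → SpectralCurve m W)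
    (hΓ : IsSpecialCoordinateFamily U Γ) :
    -- the density and the integrals are well defined
    (∀ p ∈ U,
      (∀ s, Tendsto ((Γ p).discontinuity s) (𝓝[>] (0 : ℝ)) (𝓝 ((Γ p).density s))) ∧
      MeasureTheory.Integrable (fun s => (Γ p).density s) ∧
      MeasureTheory.Integrable (fun q : ℝ × ℝ =>
        (Γ p).pvLog q.1 q.2 * (Γ p).density q.1 * (Γ p).density q.2) ∧
      MeasureTheory.Integrable (fun s => W.eval ((Γ p).lam s) * (Γ p).density s)) ∧
    -- the prepotential is a holomorphic function of `(t, S̃)`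
    DifferentiableOn ℂ (fun p => (Γ p).prepotential) U ∧
    -- the generalised homogeneity relation
    ∀ t : ℂ, ∀ S : Fin m → ℂ, (t, S) ∈ U →
      (∑ i, S i * deriv (fun z => (Γ (t, Function.update S i z)).prepotential) (S i)) +
          t * deriv (fun z => (Γ (z, S)).prepotential) t =
        2 * (Γ (t, S)).prepotential +
          t * ∫ s, (Γ (t, S)).density s * W.eval ((Γ (t, S)).lam s) := by
  obtain ⟨A, hA⟩ := hΓ.exists_fillingFraction_eq hdeg hlead
  refine ⟨fun p _ => ⟨fun s => ?_, ?_, (Γ p).integrable_pvLog_density hdeg hlead,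
    (Γ p).integrable_density hdeg hlead ((Γ p).continuous_eval_lam W)⟩, fun p hp =>
    (hΓ.hasFDerivAt_prepotential hdeg hlead hA hp).differentiableAt.differentiableWithinAt,
    fun t S hp => ?_⟩
  · rw [(Γ p).density_eq hdeg hlead]
    exact (Γ p).tendsto_discontinuity_mass hdeg hlead s
  · simpa using (Γ p).integrable_density hdeg hlead (continuous_const (y := (1 : ℂ)))
  · have hF := hΓ.hasFDerivAt_prepotential hdeg hlead hA hp
    set F' := -∑ i, (Γ (t, S)).multiplier i • A i with hF'
    have h1 : ∀ i, deriv (fun z => (Γ (t, Function.update S i z)).prepotential) (S i) =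
        F' (0, Pi.single i 1) := fun i =>
      (HasFDerivAt.comp_hasDerivAt_of_eq (S i) hF
        ((hasDerivAt_const (S i) t).prodMk (hasDerivAt_update S i (S i)))
        (by rw [Function.update_eq_self])).deriv
    have h2 : deriv (fun z => (Γ (z, S)).prepotential) t = F' (1, 0) :=
      (HasFDerivAt.comp_hasDerivAt_of_eq t hF
        ((hasDerivAt_id t).prodMk (hasDerivAt_const t S)) rfl).deriv
    -- Euler's argument: the combination of partial derivatives in the statement is the differential
    -- at the point (t, S) applied to the vector (t, S).
    have h3 : ((t, S) : ℂ × (Fin m → ℂ)) =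
        (∑ i, S i • ((0, Pi.single i 1) : ℂ × (Fin m → ℂ))) + t • (1, 0) := by
      refine Prod.ext ?_ ?_
      · simp [Prod.fst_sum]
      · simp only [Prod.snd_add, Prod.snd_sum, Prod.smul_snd, smul_zero, add_zero]
        ext j
        simp [Finset.sum_apply, Pi.single_apply]
    have h4 : F' (t, S) = (∑ i, S i * F' (0, Pi.single i 1)) + t * F' (1, 0) := by
      conv_lhs => rw [h3]
      rw [map_add, map_sum, map_smul, smul_eq_mul]
      simp_rw [map_smul, smul_eq_mul]
    have h5 : F' (t, S) = -∑ i, (Γ (t, S)).multiplier i * (Γ (t, S)).fillingFraction i := by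
      simp [hF', hA _ hp]
    have h6 := (Γ (t, S)).t_mul_integral_density hdeg hlead fun s => W.eval ((Γ (t, S)).lam s)
    rw [hΓ.t_eq _ hp] at h6
    simp_rw [mul_comm ((Γ (t, S)).density _)]
    simp_rw [h1]
    rw [h2, ← h4, h5, (Γ (t, S)).sum_multiplier_mul_fillingFraction hdeg hlead,
      (Γ (t, S)).prepotential_eq hdeg hlead, h6]
    ring
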